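/- Let $Q$ be a commutative Noetherian ring, $Z\subseteq \operatorname{Spec}(Q)$ a closed subset, $G$ a finite group and $n\ge 1$; write $\Sigma_n$ for the symmetric group on $n$ letters. For a finite group $H$, let $\mathcal P^Z(Q;H)$ be the category of bounded complexes of finitely generated projective $Q$-modules, with homology supported on $Z$, equipped with a $Q$-linear left action of $H$ by chain maps; morphisms are the $H$-equivariant chain maps. Let $K_0^Z(Q;H)$ be the abelian group generated by the isomorphism classes $[X]$ of objects of $\mathcal P^Z(Q;H)$ modulo the relations $[X]=[X']+[X'']$ for every equivariant short exact sequence $0\to X'\to X\to X''\to 0$ and $[X]=[Y]$ whenever there is an equivariant quasi-isomorphism $X\to Y$. For $X\in\mathcal P^Z(Q;G)$ and $m\ge 0$ let $T^m(X)=X\otimes_Q\cdots\otimes_Q X$ ($m$ factors, with $T^0(X)=Q$ in degree $0$), with the diagonal action of $G$ and with the signed action of $\Sigma_m$ given on homogeneous elements by $$\sigma(x_1\otimes\cdots\otimes x_m)=\pm\,x_{\sigma^{-1}(1)}\otimes\cdots\otimes x_{\sigma^{-1}(m)},\qquad \pm=\prod_{i<j,\ \sigma(i)>\sigma(j)}(-1)^{|x_i||x_j|}.$$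 Equivalently, this is the left action for which the adjacent transposition $(i\ \,i{+}1)$ exchanges $x_i$ and $x_{i+1}$ with the sign $(-1)^{|x_i||x_{i+1}|}$. For $0\le i\le n$ let $\Sigma_{i,n-i}\cong\Sigma_i\times\Sigma_{n-i}$ be the subgroup of $\Sigma_n$ of permutations that preserve $\{1,\dots,i\}$ and $\{i+1,\dots,n\}$. Then $T^n(X)$ is an object of $\mathcal P^Z(Q;G\times\Sigma_n)$ for every object $X$ of $\mathcal P^Z(Q;G)$, and $Q[\Sigma_n]\otimes_{Q[\Sigma_{i,n-i}]}T^i(X')\otimes_Q T^{n-i}(X'')$, with $G$ acting diagonally on $T^i(X')\otimes_Q T^{n-i}(X'')$, is an object of $\mathcal P^Z(Q;G\times\Sigma_n)$ for all objects $X',X''$ of $\mathcal P^Z(Q;G)$ and all $0\le i\le n$. There is a function $$t^n_\Sigma: K_0^Z(Q;G)\to K_0^Z(Q;G\times\Sigma_n)$$ such that $t^n_\Sigma([X])=[T^n(X)]$ for every object $X$ of $\mathcal P^Z(Q;G)$. Moreover, if $0\to X'\to X\to X''\to 0$ is a short exact sequence of objects of $\mathcal P^Z(Q;G)$, then $$t^n_\Sigma([X])=\sum_{i=0}^n\left[\,Q[\Sigma_n]\otimes_{Q[\Sigma_{i,n-i}]}T^i(X')\otimes_Q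 T^{n-i}(X'')\,\right].$$ -/

import Mathlib

open CategoryTheory TensorProduct

universe u v

noncomputable section

namespace PowerOp

/-! ### Total spaces -/

section Total

variable {Q : Type u} [CommRing Q] {H : Type u} [Group H]

/-- The direct sum of all the components of a complex `X` of representations. -/
abbrev Tot (X : ChainComplex (Rep.{u} Q H) ℤ) : Type u :=
  DirectSum ℤ fun i => (X.X i).V

/-- The inclusion of the component of degree `i`. -/
abbrev homog (X : ChainComplex (Rep.{u} Q H) ℤ) (i : ℤ) : (X.X i).V →ₗ[Q] Tot X :=
  DirectSum.lof Q ℤ (fun i => (X.X i).V) i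

/-- The differential of `X`, on the total space. -/
def totD (X : ChainComplex (Rep.{u} Q H) ℤ) : Tot X →ₗ[Q] Tot X :=
  DirectSum.toModule Q ℤ _ fun i => homog X (i - 1) ∘ₗ (X.d i (i - 1)).hom.toLinearMap

/-- The grading involution: multiplication by `(-1)^i` in degree `i`. -/
def totSgn (X : ChainComplex (Rep.{u} Q H) ℤ) : Tot X →ₗ[Q] Tot X :=
  DirectSum.lmap fun i => ((i.negOnePow : ℤˣ) : ℤ) • LinearMap.id

/-- The projection to the part of even (`e = 0`) or odd (`e = 1`) degree. -/
def totParity (X : ChainComplex (Rep.{u} Q H) ℤ) (e : Fin 2) : Tot X →ₗ[Q] Tot X :=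
  DirectSum.lmap fun i => if i % 2 = ((e : ℕ) : ℤ) then LinearMap.id else 0

/-- The action of `H` on the total space. -/
def totRho (X : ChainComplex (Rep.{u} Q H) ℤ) : Representation Q H (Tot X) where
  toFun h := DirectSum.lmap fun i => (X.X i).ρ h
  map_one' := by ext i x; simp
  map_mul' a b := by
    ext i x
    simp [Module.End.mul_apply]

variable (X : ChainComplex (Rep.{u} Q H) ℤ)

@[simp] lemma totD_homog (i : ℤ) (x : (X.X i).V) :
    totD X (homog X i x) = homog X (i - 1) ((X.d i (i - 1)).hom x) := by
  simp [totD]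

@[simp] lemma totSgn_homog (i : ℤ) (x : (X.X i).V) :
    totSgn X (homog X i x) = homog X i (((i.negOnePow : ℤˣ) : ℤ) • x) := by
  simp only [totSgn, homog, DirectSum.lmap_lof]; rfl

lemma totParity_homog (e : Fin 2) (i : ℤ) (x : (X.X i).V) :
    totParity X e (homog X i x) = if i % 2 = ((e : ℕ) : ℤ) then homog X i x else 0 := by
  simp only [totParity, homog, DirectSum.lmap_lof]
  split_ifs <;> simp

@[simp] lemma totRho_homog (h : H) (i : ℤ) (x : (X.X i).V) :
    totRho X h (homog X i x) = homog X i ((X.X i).ρ h x) := by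
  simp [totRho]

lemma totD_totD (x : Tot X) : totD X (totD X x) = 0 := by
  have : totD X ∘ₗ totD X = 0 := by
    apply DirectSum.linearMap_ext
    intro i
    ext x
    simp only [LinearMap.comp_apply]
    rw [totD_homog, totD_homog]
    have h := X.d_comp_d i (i - 1) (i - 1 - 1)
    have h' : (X.d (i - 1) (i - 1 - 1)).hom ((X.d i (i - 1)).hom x) = 0 :=
      LinearMap.congr_fun (congrArg (fun f => f.hom.toLinearMap) h) x
    rw [h', map_zero]
    rfl
  exact LinearMap.congr_fun this x

lemma totD_totRho (h : H) (x : Tot X) : totD X (totRho X h x) = totRho X h (totD X x) := by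
  have : totD X ∘ₗ totRho X h = totRho X h ∘ₗ totD X := by
    apply DirectSum.linearMap_ext
    intro i
    ext x
    simp only [LinearMap.comp_apply]
    rw [totRho_homog, totD_homog, totD_homog, totRho_homog, Rep.hom_comm_apply]
  exact LinearMap.congr_fun this x

lemma totSgn_totRho (h : H) (x : Tot X) : totSgn X (totRho X h x) = totRho X h (totSgn X x) := by
  have : totSgn X ∘ₗ totRho X h = totRho X h ∘ₗ totSgn X := by
    apply DirectSum.linearMap_ext
    intro i
    ext x
    simp only [LinearMap.comp_apply]
    rw [totRho_homog, totSgn_homog, totSgn_homog, totRho_homog,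
      map_zsmul ((X.X i).ρ h)]
  exact LinearMap.congr_fun this x

lemma totD_totSgn (x : Tot X) : totD X (totSgn X x) = - totSgn X (totD X x) := by
  have : totD X ∘ₗ totSgn X = - (totSgn X ∘ₗ totD X) := by
    apply DirectSum.linearMap_ext
    intro i
    ext x
    simp only [LinearMap.comp_apply, LinearMap.neg_apply]
    rw [totSgn_homog, totD_homog, totD_homog, totSgn_homog, map_zsmul, Int.negOnePow_sub]
    simp
  exact LinearMap.congr_fun this x

lemma totSgn_totSgn (x : Tot X) : totSgn X (totSgn X x) = x := by
  have : totSgn X ∘ₗ totSgn X = LinearMap.id := by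
    apply DirectSum.linearMap_ext
    intro i
    ext x
    simp only [LinearMap.comp_apply, LinearMap.id_apply]
    rw [totSgn_homog, totSgn_homog, smul_smul, ← Units.val_mul, Int.units_mul_self]
    simp
  exact LinearMap.congr_fun this x

end Total

/-! ### Complexes cut out of a graded space -/

/-- The complex whose component of degree `m` is the submodule `P m` of `V`, with the
differential and the group action restricted from `V`. -/
def ofGraded {Q : Type u} [CommRing Q] {H : Type u} [Group H] {V : Type u} [AddCommGroup V]
    [Module Q V] (ρ : Representation Q H V) (d : V →ₗ[Q] V) (P : ℤ → Submodule Q V)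
    (hρ : ∀ h m, ∀ x ∈ P m, ρ h x ∈ P m) (hd : ∀ m, ∀ x ∈ P m, d x ∈ P (m - 1))
    (hdd : ∀ x, d (d x) = 0) (hdρ : ∀ h x, d (ρ h x) = ρ h (d x)) :
    ChainComplex (Rep.{u} Q H) ℤ where
  X m := Rep.of (X := P m)
    { toFun := fun h => (ρ h).restrict (hρ h m)
      map_one' := by ext; simp
      map_mul' := fun a b => by ext; simp }
  d i j := if h : j + 1 = i then
      Rep.ofHom ⟨d.restrict (p := P i) (q := P j) (fun x hx => by
        obtain rfl : j = i - 1 := by omega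
        exact hd i x hx), fun g => by ext x; simp [hdρ]⟩
    else 0
  shape i j hij := dif_neg hij
  d_comp_d' i j k hij hjk := by
    have h1 : j + 1 = i := hij
    have h2 : k + 1 = j := hjk
    rw [dif_pos h1, dif_pos h2]
    ext x
    simp [hdd]

/-! ### Koszul signs -/

section Sign

variable {n : ℕ}

/-- The sign by which `σ` acts on a tensor of homogeneous elements of degrees `f 0, …, f (n - 1)`:
one factor `(-1)^(f i * f j)` for each pair `i < j` whose order is reversed by `σ`. -/
def koszulSign (σ : Equiv.Perm (Fin n)) (f : Fin n → ℤ) : ℤˣ :=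
  ∏ i, ∏ j, if i < j ∧ σ j < σ i then (f i * f j).negOnePow else 1

lemma prod_pairs (t : Fin n → Fin n → ℤˣ) :
    ∏ i, ∏ j, t i j = (∏ i, t i i) * ∏ i, ∏ j, if i < j then t i j * t j i else 1 := by
  have h1 : ∏ i, ∏ j, t i j = (∏ i, ∏ j, if i = j then t i j else 1) *
      ((∏ i, ∏ j, if i < j then t i j else 1) * ∏ i, ∏ j, if j < i then t i j else 1) := by
    simp only [← Finset.prod_mul_distrib]
    refine Finset.prod_congr rfl fun i _ => Finset.prod_congr rfl fun j _ => ?_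
    rcases lt_trichotomy i j with h | h | h
    · simp [h, h.ne, h.not_gt]
    · simp [h]
    · simp [h, h.ne', h.not_gt]
  have h2 : (∏ i : Fin n, ∏ j : Fin n, if j < i then t i j else (1 : ℤˣ)) =
      ∏ i : Fin n, ∏ j : Fin n, if i < j then t j i else 1 :=
    Finset.prod_comm
  rw [h1, h2]
  have h3 : (∏ i, ∏ j, if i = j then t i j else 1) = ∏ i, t i i := by simp
  rw [h3]
  congr 1
  simp only [← Finset.prod_mul_distrib]
  refine Finset.prod_congr rfl fun i _ => Finset.prod_congr rfl fun j _ => ?_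
  split_ifs <;> simp

lemma koszulSign_one (f : Fin n → ℤ) : koszulSign 1 f = 1 := by
  refine Finset.prod_eq_one fun i _ => Finset.prod_eq_one fun j _ => if_neg ?_
  rintro ⟨h1, h2⟩
  exact lt_asymm h1 h2

lemma koszulSign_mul (σ τ : Equiv.Perm (Fin n)) (f : Fin n → ℤ) :
    koszulSign (σ * τ) f = koszulSign σ (fun k => f (τ.symm k)) * koszulSign τ f := by
  have h : koszulSign σ (fun k => f (τ.symm k)) =
      ∏ i, ∏ j, if τ i < τ j ∧ σ (τ j) < σ (τ i) then (f i * f j).negOnePow else 1 := by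
    unfold koszulSign
    rw [← Equiv.prod_comp τ]
    refine Finset.prod_congr rfl fun i _ => ?_
    rw [← Equiv.prod_comp τ]
    simp
  rw [h, prod_pairs]
  unfold koszulSign
  simp only [lt_irrefl, false_and, if_false, Finset.prod_const_one, one_mul,
    ← Finset.prod_mul_distrib]
  refine Finset.prod_congr rfl fun i _ => Finset.prod_congr rfl fun j _ => ?_
  rcases lt_or_ge i j with hij | hij
  · have h1 : τ i ≠ τ j := fun e => hij.ne (τ.injective e)
    have h2 : σ (τ i) ≠ σ (τ j) := fun e => h1 (σ.injective e)
    rcases lt_or_gt_of_ne h1 with h1 | h1 <;> rcases lt_or_gt_of_ne h2 with h2 | h2 <;>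
      simp [hij, h1, h2, h1.not_gt, h2.not_gt, mul_comm (f j) (f i), Int.units_mul_self]
  · simp [hij.not_gt]

lemma koszulSign_congr (σ : Equiv.Perm (Fin n)) {f g : Fin n → ℤ}
    (h : ∀ i, f i % 2 = g i % 2) : koszulSign σ f = koszulSign σ g := by
  refine Finset.prod_congr rfl fun i _ => Finset.prod_congr rfl fun j _ => ?_
  split_ifs
  · rw [Int.negOnePow_eq_iff, Int.even_iff, Int.sub_emod, Int.mul_emod, h i, h j, ← Int.mul_emod]
    simp
  · rfl

/-- The sign `(-1)^(f 0 + ⋯ + f (k - 1))`. -/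
def prefixSign (k : Fin n) (f : Fin n → ℤ) : ℤˣ := ∏ j, if j < k then (f j).negOnePow else 1

lemma koszulSign_update (σ : Equiv.Perm (Fin n)) (f : Fin n → ℤ) (k : Fin n) :
    prefixSign k f * koszulSign σ (Function.update f k (f k - 1)) =
      koszulSign σ f * prefixSign (σ k) (fun j => f (σ.symm j)) := by
  have h1 : prefixSign (σ k) (fun j => f (σ.symm j)) =
      ∏ j, if σ j < σ k then (f j).negOnePow else 1 := by
    unfold prefixSign
    rw [← Equiv.prod_comp σ]
    simp
  let a : Fin n → ℤˣ := fun j => if k < j ∧ σ j < σ k then (f j).negOnePow else 1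
  let b : Fin n → ℤˣ := fun j => if j < k ∧ σ k < σ j then (f j).negOnePow else 1
  have h2 : koszulSign σ (Function.update f k (f k - 1)) =
      koszulSign σ f * ((∏ j, a j) * ∏ j, b j) := by
    have ha : ∏ j, a j = ∏ i, ∏ j, if i = k then a j else 1 := by
      rw [Finset.prod_comm]
      simp
    have hb : ∏ j, b j = ∏ i, ∏ j, if j = k then b i else 1 := by
      simp
    rw [ha, hb]
    unfold koszulSign
    simp only [← Finset.prod_mul_distrib]
    refine Finset.prod_congr rfl fun i _ => Finset.prod_congr rfl fun j _ => ?_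
    by_cases hi : i = k
    · subst hi
      by_cases hj : j = i
      · subst hj
        simp [b, a]
      · simp only [Function.update_self, Function.update_of_ne hj, if_true, hj, if_false, a]
        split_ifs
        · rw [sub_mul, Int.negOnePow_sub, one_mul, mul_one]
        · simp
    · by_cases hj : j = k
      · subst hj
        simp only [Function.update_self, Function.update_of_ne hi, if_true, hi, if_false, b]
        split_ifs
        · rw [mul_sub, Int.negOnePow_sub, mul_one, one_mul]
        · simp
      · simp [hi, hj]
  rw [h2, h1, mul_left_comm]
  congr 1
  unfold prefixSign
  simp only [← Finset.prod_mul_distrib, a, b]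
  refine Finset.prod_congr rfl fun j _ => ?_
  rcases lt_trichotomy j k with h | h | h
  · have h' : σ j ≠ σ k := fun e => h.ne (σ.injective e)
    rcases lt_or_gt_of_ne h' with h' | h' <;>
      simp [h, h', h.not_gt, h'.not_gt, Int.units_mul_self]
  · simp [h]
  · have h' : σ j ≠ σ k := fun e => h.ne' (σ.injective e)
    rcases lt_or_gt_of_ne h' with h' | h' <;>
      simp [h, h', h.not_gt, h'.not_gt]

end Sign

/-! ### Tensor powers -/

section TensorPower

variable {Q : Type u} [CommRing Q] {G : Type u} [Group G]
  (X : ChainComplex (Rep.{u} Q G) ℤ) (n : ℕ)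

/-- The `n`-fold tensor power over `Q` of the total space of `X`. -/
abbrev TotPow : Type u := PiTensorProduct Q fun _ : Fin n => Tot X

/-- The part of degree `m` of the tensor power: it is spanned by the tensors `x₁ ⊗ ⋯ ⊗ xₙ` of
homogeneous elements whose degrees add up to `m`. -/
def powDeg (m : ℤ) : Submodule Q (TotPow X n) :=
  Submodule.span Q {t | ∃ (f : Fin n → ℤ) (x : ∀ k, (X.X (f k)).V), ∑ k, f k = m ∧
    t = PiTensorProduct.tprod Q fun k => homog X (f k) (x k)}

/-- The summand `x₁ ⊗ ⋯ ⊗ xₙ ↦ (-1)^(|x₁| + ⋯ + |xₖ₋₁|) x₁ ⊗ ⋯ ⊗ d xₖ ⊗ ⋯ ⊗ xₙ` of the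
differential. -/
def powDAt (k : Fin n) : TotPow X n →ₗ[Q] TotPow X n :=
  PiTensorProduct.map fun j => if j < k then totSgn X else if j = k then totD X else LinearMap.id

/-- The differential of the tensor power. -/
def powD : TotPow X n →ₗ[Q] TotPow X n := ∑ k, powDAt X n k

/-- The signed action of a permutation. The sum runs over all patterns of parities; see
`powPerm_tprod` for the value on a tensor of homogeneous elements. -/
def powPerm (σ : Equiv.Perm (Fin n)) : TotPow X n →ₗ[Q] TotPow X n :=
  ∑ p : Fin n → Fin 2, (((koszulSign σ fun k => ((p k : ℕ) : ℤ) : ℤˣ) : ℤ) : Q) •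
    ((PiTensorProduct.reindex Q (fun _ => Tot X) σ).toLinearMap ∘ₗ
      PiTensorProduct.map fun k => totParity X (p k))

/-- The diagonal action of a group element. -/
def powDiag (g : G) : TotPow X n →ₗ[Q] TotPow X n :=
  PiTensorProduct.map fun _ => totRho X g

variable {X n}

lemma powPerm_tprod (σ : Equiv.Perm (Fin n)) (f : Fin n → ℤ) (x : ∀ k, (X.X (f k)).V) :
    powPerm X n σ (PiTensorProduct.tprod Q fun k => homog X (f k) (x k)) =
      ((koszulSign σ f : ℤˣ) : ℤ) • PiTensorProduct.tprod Q
        fun k => homog X (f (σ.symm k)) (x (σ.symm k)) := by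
  let p₀ : Fin n → Fin 2 := fun k => if f k % 2 = 0 then 0 else 1
  have hp₀ : ∀ k, f k % 2 = ((p₀ k : ℕ) : ℤ) := by
    intro k
    rcases Int.emod_two_eq_zero_or_one (f k) with h | h <;> simp only [p₀, h] <;> simp
  unfold powPerm
  rw [LinearMap.sum_apply, Finset.sum_eq_single p₀]
  · rw [LinearMap.smul_apply, LinearMap.comp_apply, PiTensorProduct.map_tprod]
    simp only [totParity_homog, hp₀, if_true]
    rw [LinearEquiv.coe_coe, PiTensorProduct.reindex_tprod, Int.cast_smul_eq_zsmul]
    congr 2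
    refine koszulSign_congr σ fun i => ?_
    rw [← hp₀ i]
    simp
  · intro p _ hp
    obtain ⟨k, hk⟩ := Function.ne_iff.mp hp
    rw [LinearMap.smul_apply, LinearMap.comp_apply, PiTensorProduct.map_tprod]
    have : (PiTensorProduct.tprod Q fun i => totParity X (p i) (homog X (f i) (x i))) = 0 := by
      refine MultilinearMap.map_coord_zero _ k ?_
      rw [totParity_homog, if_neg]
      rw [hp₀]
      intro h
      apply hk
      ext
      exact_mod_cast h.symm
    rw [this, map_zero, smul_zero]
  · simp

/-- A linear map on a tensor power is determined by its values on tensors of homogeneous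
elements. -/
lemma totPow_ext {N : Type*} [AddCommGroup N] [Module Q N] {a b : TotPow X n →ₗ[Q] N}
    (h : ∀ (f : Fin n → ℤ) (x : ∀ k, (X.X (f k)).V),
      a (PiTensorProduct.tprod Q fun k => homog X (f k) (x k)) =
        b (PiTensorProduct.tprod Q fun k => homog X (f k) (x k))) : a = b := by
  apply PiTensorProduct.ext
  apply MultilinearMap.dfinsupp_ext
  intro f
  ext x
  exact h f x

lemma powDAt_tprod (k : Fin n) (f : Fin n → ℤ) (x : ∀ k, (X.X (f k)).V) :
    powDAt X n k (PiTensorProduct.tprod Q fun k => homog X (f k) (x k)) =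
      ((prefixSign k f : ℤˣ) : ℤ) • PiTensorProduct.tprod Q
        (Function.update (fun k => homog X (f k) (x k)) k (totD X (homog X (f k) (x k)))) := by
  unfold powDAt
  rw [PiTensorProduct.map_tprod]
  let c : Fin n → Q := fun j => if j < k then (((f j).negOnePow : ℤˣ) : ℤ) else 1
  have h : (fun j => (if j < k then totSgn X else if j = k then totD X else LinearMap.id)
      (homog X (f j) (x j))) = fun j => c j •
      Function.update (fun k => homog X (f k) (x k)) k (totD X (homog X (f k) (x k))) j := by
    funext j
    rcases lt_trichotomy j k with h | h | h
    · simp only [h, if_true, c, Function.update_of_ne h.ne]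
      rw [totSgn_homog, map_zsmul, Int.cast_smul_eq_zsmul]
    · subst h
      simp [c]
    · simp [h.not_gt, h.ne', c]
  rw [h, MultilinearMap.map_smul_univ]
  have hc : ∏ j, c j = (((prefixSign k f : ℤˣ) : ℤ) : Q) := by
    simp only [prefixSign, Units.coe_prod, Int.cast_prod, c]
    refine Finset.prod_congr rfl fun j _ => ?_
    split_ifs <;> simp
  rw [hc, Int.cast_smul_eq_zsmul]

/-- `update` of a family of homogeneous elements by a differential is again such a family. -/
lemma update_homog (k : Fin n) (f : Fin n → ℤ) (x : ∀ k, (X.X (f k)).V) :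
    ∃ y : ∀ j, (X.X (Function.update f k (f k - 1) j)).V,
      Function.update (fun k => homog X (f k) (x k)) k (totD X (homog X (f k) (x k))) =
        fun j => homog X (Function.update f k (f k - 1) j) (y j) := by
  have : ∀ j, ∃ y : (X.X (Function.update f k (f k - 1) j)).V,
      Function.update (fun k => homog X (f k) (x k)) k (totD X (homog X (f k) (x k))) j =
        homog X (Function.update f k (f k - 1) j) y := by
    intro j
    by_cases h : j = k
    · subst h
      rw [Function.update_self, Function.update_self, totD_homog]
      exact ⟨_, rfl⟩
    · rw [Function.update_of_ne h, Function.update_of_ne h]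
      exact ⟨_, rfl⟩
  choose y hy using this
  exact ⟨y, funext hy⟩

lemma powDAt_sq (k : Fin n) (t : TotPow X n) : powDAt X n k (powDAt X n k t) = 0 := by
  have : powDAt X n k ∘ₗ powDAt X n k = 0 := by
    unfold powDAt
    rw [← PiTensorProduct.map_comp]
    refine PiTensorProduct.ext (MultilinearMap.ext fun x => ?_)
    simp only [LinearMap.compMultilinearMap_apply, PiTensorProduct.map_tprod]
    refine MultilinearMap.map_coord_zero _ k ?_
    simp [totD_totD]
  exact LinearMap.congr_fun this t

lemma powDAt_anticomm {k l : Fin n} (hkl : k < l) (t : TotPow X n) :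
    powDAt X n k (powDAt X n l t) + powDAt X n l (powDAt X n k t) = 0 := by
  have : powDAt X n k ∘ₗ powDAt X n l + powDAt X n l ∘ₗ powDAt X n k = 0 := by
    unfold powDAt
    rw [← PiTensorProduct.map_comp, ← PiTensorProduct.map_comp]
    refine PiTensorProduct.ext (MultilinearMap.ext fun x => ?_)
    simp only [LinearMap.compMultilinearMap_apply, LinearMap.add_apply, PiTensorProduct.map_tprod]
    let w : Fin n → Tot X := fun j =>
      ((if j < l then totSgn X else if j = l then totD X else LinearMap.id) ∘ₗ
        (if j < k then totSgn X else if j = k then totD X else LinearMap.id)) (x j)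
    have h1 : (fun j => ((if j < k then totSgn X else if j = k then totD X else LinearMap.id) ∘ₗ
        (if j < l then totSgn X else if j = l then totD X else LinearMap.id)) (x j)) =
        Function.update w k ((-1 : Q) • w k) := by
      funext j
      rcases lt_trichotomy j k with h | h | h
      · simp [h, h.trans hkl, Function.update_of_ne h.ne, w]
      · subst h
        simp [hkl, w, totD_totSgn]
      · rw [Function.update_of_ne h.ne']
        rcases lt_trichotomy j l with h' | h' | h'
        · simp [h', h.not_gt, h.ne', w]
        · subst h'
          simp [h.not_gt, h.ne', w]
        · simp [h'.not_gt, h'.ne', h.not_gt, h.ne', w]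
    rw [h1, MultilinearMap.map_update_smul, Function.update_eq_self]
    simp [w]
  exact LinearMap.congr_fun this t

lemma powD_powD (t : TotPow X n) : powD X n (powD X n t) = 0 := by
  unfold powD
  simp only [LinearMap.sum_apply, map_sum]
  rw [← Finset.sum_product']
  refine Finset.sum_involution (fun p _ => p.swap) ?_ ?_ (by simp) (by simp)
  · rintro ⟨k, l⟩ _
    rcases lt_trichotomy k l with h | h | h
    · rw [add_comm]; exact powDAt_anticomm h t
    · subst h; simp [powDAt_sq]
    · exact powDAt_anticomm h t
  · rintro ⟨k, l⟩ _ hne heq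
    obtain rfl : l = k := congrArg Prod.fst heq
    exact hne (powDAt_sq _ t)

lemma powD_mem (m : ℤ) : ∀ t ∈ powDeg X n m, powD X n t ∈ powDeg X n (m - 1) := by
  intro t ht
  induction ht using Submodule.span_induction with
  | mem t ht =>
    obtain ⟨f, x, hf, rfl⟩ := ht
    unfold powD
    rw [LinearMap.sum_apply]
    refine Submodule.sum_mem _ fun k _ => ?_
    rw [powDAt_tprod]
    refine zsmul_mem (Submodule.subset_span ?_) _
    obtain ⟨y, hy⟩ := update_homog k f x
    refine ⟨_, y, ?_, by rw [hy]⟩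
    rw [Finset.sum_update_of_mem (Finset.mem_univ k), ← hf,
      ← Finset.add_sum_erase _ _ (Finset.mem_univ k), Finset.sdiff_singleton_eq_erase]
    ring
  | zero => simp
  | add a b _ _ ha hb => rw [map_add]; exact add_mem ha hb
  | smul r a _ ha => rw [map_smul]; exact Submodule.smul_mem _ _ ha

lemma powPerm_mem (σ : Equiv.Perm (Fin n)) (m : ℤ) :
    ∀ t ∈ powDeg X n m, powPerm X n σ t ∈ powDeg X n m := by
  intro t ht
  induction ht using Submodule.span_induction with
  | mem t ht =>
    obtain ⟨f, x, hf, rfl⟩ := ht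
    rw [powPerm_tprod]
    refine zsmul_mem (Submodule.subset_span ?_) _
    exact ⟨fun k => f (σ.symm k), fun k => x (σ.symm k),
      (Equiv.sum_comp σ.symm f).trans hf, rfl⟩
  | zero => simp
  | add a b _ _ ha hb => rw [map_add]; exact add_mem ha hb
  | smul r a _ ha => rw [map_smul]; exact Submodule.smul_mem _ _ ha

lemma powDiag_tprod (g : G) (f : Fin n → ℤ) (x : ∀ k, (X.X (f k)).V) :
    powDiag X n g (PiTensorProduct.tprod Q fun k => homog X (f k) (x k)) =
      PiTensorProduct.tprod Q fun k => homog X (f k) ((X.X (f k)).ρ g (x k)) := by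
  unfold powDiag
  rw [PiTensorProduct.map_tprod]
  simp only [totRho_homog]

lemma powDiag_mem (g : G) (m : ℤ) :
    ∀ t ∈ powDeg X n m, powDiag X n g t ∈ powDeg X n m := by
  intro t ht
  induction ht using Submodule.span_induction with
  | mem t ht =>
    obtain ⟨f, x, hf, rfl⟩ := ht
    rw [powDiag_tprod]
    exact Submodule.subset_span ⟨f, _, hf, rfl⟩
  | zero => simp
  | add a b _ _ ha hb => rw [map_add]; exact add_mem ha hb
  | smul r a _ ha => rw [map_smul]; exact Submodule.smul_mem _ _ ha

lemma powPerm_one : powPerm X n 1 = LinearMap.id := by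
  apply totPow_ext
  intro f x
  rw [powPerm_tprod, koszulSign_one, Units.val_one, one_smul]
  rfl

lemma powPerm_mul (σ τ : Equiv.Perm (Fin n)) :
    powPerm X n (σ * τ) = powPerm X n σ ∘ₗ powPerm X n τ := by
  apply totPow_ext
  intro f x
  rw [LinearMap.comp_apply, powPerm_tprod, powPerm_tprod, map_zsmul,
    powPerm_tprod σ (fun k => f (τ.symm k)) (fun k => x (τ.symm k)), smul_smul, koszulSign_mul,
    Units.val_mul, mul_comm]
  rfl

lemma powPerm_powDiag (σ : Equiv.Perm (Fin n)) (g : G) :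
    powPerm X n σ ∘ₗ powDiag X n g = powDiag X n g ∘ₗ powPerm X n σ := by
  apply totPow_ext
  intro f x
  rw [LinearMap.comp_apply, LinearMap.comp_apply, powPerm_tprod, powDiag_tprod, powPerm_tprod,
    map_zsmul, powDiag_tprod g (fun k => f (σ.symm k)) (fun k => x (σ.symm k))]

lemma powDiag_one : powDiag X n 1 = LinearMap.id := by
  apply totPow_ext
  intro f x
  rw [powDiag_tprod]
  simp

lemma powDiag_mul (a b : G) : powDiag X n (a * b) = powDiag X n a ∘ₗ powDiag X n b := by
  apply totPow_ext
  intro f x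
  rw [LinearMap.comp_apply, powDiag_tprod, powDiag_tprod, powDiag_tprod]
  simp

lemma powD_powDiag (g : G) (t : TotPow X n) :
    powD X n (powDiag X n g t) = powDiag X n g (powD X n t) := by
  have h : ∀ k, powDAt X n k ∘ₗ powDiag X n g = powDiag X n g ∘ₗ powDAt X n k := by
    intro k
    unfold powDAt powDiag
    rw [← PiTensorProduct.map_comp, ← PiTensorProduct.map_comp]
    congr 1
    funext j
    refine LinearMap.ext fun x => ?_
    rw [LinearMap.comp_apply, LinearMap.comp_apply]
    split_ifs
    · exact totSgn_totRho X g x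
    · exact totD_totRho X g x
    · rfl
  unfold powD
  simp only [LinearMap.sum_apply, map_sum]
  exact Finset.sum_congr rfl fun k _ => LinearMap.congr_fun (h k) t

lemma powD_powPerm (σ : Equiv.Perm (Fin n)) (t : TotPow X n) :
    powD X n (powPerm X n σ t) = powPerm X n σ (powD X n t) := by
  have h : ∀ k, powDAt X n (σ k) ∘ₗ powPerm X n σ = powPerm X n σ ∘ₗ powDAt X n k := by
    intro k
    apply totPow_ext
    intro f x
    obtain ⟨y, hy⟩ := update_homog k f x
    rw [LinearMap.comp_apply, LinearMap.comp_apply, powPerm_tprod, powDAt_tprod, map_zsmul,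
      map_zsmul, powDAt_tprod (σ k) (fun k => f (σ.symm k)) (fun k => x (σ.symm k)), hy,
      powPerm_tprod, smul_smul, smul_smul, ← Units.val_mul, ← Units.val_mul, koszulSign_update]
    congr 2
    have hy' := fun j => congrFun hy (σ.symm j)
    funext j
    rw [← hy' j]
    by_cases hj : j = σ k
    · subst hj
      rw [Function.update_self]
      have e : σ.symm (σ k) = k := σ.symm_apply_apply k
      generalize σ.symm (σ k) = l at e
      subst e
      rw [Function.update_self]
    · have : σ.symm j ≠ k := fun e => hj (by rw [← e]; simp)
      rw [Function.update_of_ne hj, Function.update_of_ne this]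
  unfold powD
  simp only [LinearMap.sum_apply, map_sum]
  rw [← Equiv.sum_comp σ]
  exact Finset.sum_congr rfl fun k _ => LinearMap.congr_fun (h k) t

variable (X n)

/-- The action of `G × Σₙ` on the tensor power: `G` acts diagonally and `Σₙ` by signed
permutations of the factors. -/
def powRho : Representation Q (G × Equiv.Perm (Fin n)) (TotPow X n) where
  toFun a := powPerm X n a.2 ∘ₗ powDiag X n a.1
  map_one' := by
    rw [Prod.fst_one, Prod.snd_one, powPerm_one, powDiag_one]
    rfl
  map_mul' a b := by
    rw [Prod.fst_mul, Prod.snd_mul, powPerm_mul, powDiag_mul]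
    change _ = (powPerm X n a.2 ∘ₗ powDiag X n a.1) ∘ₗ (powPerm X n b.2 ∘ₗ powDiag X n b.1)
    rw [LinearMap.comp_assoc, LinearMap.comp_assoc, ← LinearMap.comp_assoc _ _ (powDiag X n a.1),
      ← powPerm_powDiag, LinearMap.comp_assoc]

/-- The `n`-th tensor power of a complex of representations of `G`, as a complex of
representations of `G × Σₙ`. -/
def tensorPower : ChainComplex (Rep.{u} Q (G × Equiv.Perm (Fin n))) ℤ :=
  ofGraded (powRho X n) (powD X n) (powDeg X n)
    (fun a m t ht => powPerm_mem a.2 m _ (powDiag_mem a.1 m t ht))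
    powD_mem powD_powD
    (fun a t => by
      change powD X n (powPerm X n a.2 (powDiag X n a.1 t)) =
        powPerm X n a.2 (powDiag X n a.1 (powD X n t))
      rw [powD_powPerm, powD_powDiag])

end TensorPower

/-! ### The tensor product of two complexes -/

section Tensor

variable {Q : Type u} [CommRing Q] {H : Type u} [Group H]
  (X Y : ChainComplex (Rep.{u} Q H) ℤ)

/-- The part of degree `m` of the tensor product of the total spaces. -/
def tensorDeg (m : ℤ) : Submodule Q (Tot X ⊗[Q] Tot Y) :=
  Submodule.span Q {t | ∃ (i j : ℤ) (x : (X.X i).V) (y : (Y.X j).V), i + j = m ∧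
    t = homog X i x ⊗ₜ[Q] homog Y j y}

/-- The differential `x ⊗ y ↦ d x ⊗ y + (-1)^|x| x ⊗ d y`. -/
def tensorD : Tot X ⊗[Q] Tot Y →ₗ[Q] Tot X ⊗[Q] Tot Y :=
  TensorProduct.map (totD X) LinearMap.id + TensorProduct.map (totSgn X) (totD Y)

variable {X Y}

lemma tensorD_mem (m : ℤ) : ∀ t ∈ tensorDeg X Y m, tensorD X Y t ∈ tensorDeg X Y (m - 1) := by
  intro t ht
  induction ht using Submodule.span_induction with
  | mem t ht =>
    obtain ⟨i, j, x, y, hij, rfl⟩ := ht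
    simp only [tensorD, LinearMap.add_apply, TensorProduct.map_tmul, LinearMap.id_apply]
    rw [totD_homog, totSgn_homog, totD_homog]
    exact add_mem (Submodule.subset_span ⟨_, _, _, _, by omega, rfl⟩)
      (Submodule.subset_span ⟨_, _, _, _, by omega, rfl⟩)
  | zero => simp
  | add a b _ _ ha hb => rw [map_add]; exact add_mem ha hb
  | smul r a _ ha => rw [map_smul]; exact Submodule.smul_mem _ _ ha

lemma tensorRho_mem (h : H) (m : ℤ) :
    ∀ t ∈ tensorDeg X Y m, (totRho X).tprod (totRho Y) h t ∈ tensorDeg X Y m := by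
  intro t ht
  induction ht using Submodule.span_induction with
  | mem t ht =>
    obtain ⟨i, j, x, y, hij, rfl⟩ := ht
    rw [Representation.tprod_apply, TensorProduct.map_tmul, totRho_homog, totRho_homog]
    exact Submodule.subset_span ⟨_, _, _, _, hij, rfl⟩
  | zero => simp
  | add a b _ _ ha hb => rw [map_add]; exact add_mem ha hb
  | smul r a _ ha => rw [map_smul]; exact Submodule.smul_mem _ _ ha

lemma tensorD_tensorD (t : Tot X ⊗[Q] Tot Y) : tensorD X Y (tensorD X Y t) = 0 := by
  induction t using TensorProduct.induction_on with
  | zero => simp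
  | add a b ha hb => rw [map_add, map_add, ha, hb, add_zero]
  | tmul x y =>
    simp [tensorD, totD_totD, totD_totSgn, TensorProduct.neg_tmul]

lemma tensorD_tensorRho (h : H) (t : Tot X ⊗[Q] Tot Y) :
    tensorD X Y ((totRho X).tprod (totRho Y) h t) =
      (totRho X).tprod (totRho Y) h (tensorD X Y t) := by
  induction t using TensorProduct.induction_on with
  | zero => simp
  | add a b ha hb => rw [map_add, map_add, ha, hb, map_add, map_add]
  | tmul x y =>
    simp [tensorD, totD_totRho, totSgn_totRho]

variable (X Y)

/-- The tensor product over `Q` of two complexes of representations, with the diagonal action. -/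
def tensorComplex : ChainComplex (Rep.{u} Q H) ℤ :=
  ofGraded ((totRho X).tprod (totRho Y)) (tensorD X Y) (tensorDeg X Y)
    tensorRho_mem tensorD_mem tensorD_tensorD tensorD_tensorRho

end Tensor

/-! ### Restriction and induction of complexes -/

section Induction

variable {Q : Type u} [CommRing Q] {H K : Type u} [Group H] [Group K]

instance (φ : H →* K) : (Rep.indFunctor.{u} Q φ).Additive where
  map_add {_ _} f g := by
    apply Rep.hom_ext
    apply Representation.IntertwiningMap.ext
    apply Representation.IndV.hom_ext
    intro h
    ext x
    simp [Rep.indMap, Rep.add_hom]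

/-- Restriction of complexes of representations along a group homomorphism. -/
def resComplex (φ : H →* K) (X : ChainComplex (Rep.{u} Q K) ℤ) : ChainComplex (Rep.{u} Q H) ℤ :=
  ((Rep.resFunctor φ).mapHomologicalComplex _).obj X

/-- Induction `Q[K] ⊗_{Q[H]} X` of complexes of representations along a group homomorphism. -/
def indComplex (φ : H →* K) (X : ChainComplex (Rep.{u} Q H) ℤ) : ChainComplex (Rep.{u} Q K) ℤ :=
  ((Rep.indFunctor.{u} Q φ).mapHomologicalComplex _).obj X

end Induction

/-! ### The category of perfect complexes with support and its Grothendieck group -/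

section Grothendieck

variable {Q : Type u} [CommRing Q]

/-- A bounded complex of finitely generated projective `Q`-modules with an action of `H`, whose
homology is supported on `Z`. -/
structure IsPerfectOn (Z : Set (PrimeSpectrum Q)) {H : Type u} [Group H]
    (X : ChainComplex (Rep.{u} Q H) ℤ) : Prop where
  bounded : ∃ a b : ℤ, ∀ i, i < a ∨ b < i → Subsingleton (X.X i).V
  finite : ∀ i, Module.Finite Q (X.X i).V
  projective : ∀ i, Module.Projective Q (X.X i).V
  support : ∀ i, Module.support Q (X.homology i).V ⊆ Z

/-- The category of bounded complexes of finitely generated projective `Q`-modules with homology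
supported on `Z` and with an action of `H`; morphisms are the equivariant chain maps. -/
abbrev Perf (Z : Set (PrimeSpectrum Q)) (H : Type u) [Group H] : Type (u + 1) :=
  ObjectProperty.FullSubcategory fun X : ChainComplex (Rep.{u} Q H) ℤ => IsPerfectOn Z X

variable (Z : Set (PrimeSpectrum Q)) (H : Type u) [Group H]

/-- The relations `[X] = [X'] + [X'']` for short exact sequences `0 → X' → X → X'' → 0`, and
`[X] = [Y]` for quasi-isomorphisms `X → Y`. -/
inductive K0Rel : FreeAbelianGroup (Perf Z H) → Prop
  | shortExact (X' X X'' : Perf Z H) (f : X'.obj ⟶ X.obj) (g : X.obj ⟶ X''.obj)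
      (w : f ≫ g = 0) (h : (ShortComplex.mk f g w).ShortExact) :
      K0Rel (FreeAbelianGroup.of X - (FreeAbelianGroup.of X' + FreeAbelianGroup.of X''))
  | quasiIso (X Y : Perf Z H) (f : X.obj ⟶ Y.obj) (h : QuasiIso f) :
      K0Rel (FreeAbelianGroup.of X - FreeAbelianGroup.of Y)

/-- The Grothendieck group. (Isomorphic complexes have equal classes, because an isomorphism is a
quasi-isomorphism.) -/
abbrev K0 : Type (u + 1) :=
  FreeAbelianGroup (Perf Z H) ⧸ AddSubgroup.closure {r | K0Rel Z H r}

variable {Z H}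

/-- The class `[X]`. -/
def K0.mk (X : ChainComplex (Rep.{u} Q H) ℤ) (hX : IsPerfectOn Z X) : K0 Z H :=
  QuotientAddGroup.mk (FreeAbelianGroup.of ⟨X, hX⟩)

end Grothendieck

/-! ### Young subgroups and the products of tensor powers -/

section Young

variable {n : ℕ}

/-- The splitting of `n` points into the first `i` and the last `n - i`. -/
def splitEquiv (i : Fin (n + 1)) : Fin i ⊕ Fin (n - i) ≃ Fin n :=
  finSumFinEquiv.trans (finCongr (by omega))

/-- The embedding of `Σᵢ × Σₙ₋ᵢ` into `Σₙ` as the subgroup of the permutations that preserve the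
set of the first `i` points and the set of the last `n - i` points. -/
def youngHom (i : Fin (n + 1)) :
    Equiv.Perm (Fin i) × Equiv.Perm (Fin (n - i)) →* Equiv.Perm (Fin n) :=
  (splitEquiv i).permCongrHom.toMonoidHom.comp (Equiv.Perm.sumCongrHom (Fin i) (Fin (n - i)))

/-- The complex `T^i(X') ⊗ T^(n-i)(X'')` with its action of `G × (Σᵢ × Σₙ₋ᵢ)`. -/
def powTensorPow {Q : Type u} [CommRing Q] {G : Type u} [Group G]
    (X' X'' : ChainComplex (Rep.{u} Q G) ℤ) (i : Fin (n + 1)) :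
    ChainComplex (Rep.{u} Q
      (G × (Equiv.Perm (Fin i) × Equiv.Perm (Fin (n - i))))) ℤ :=
  tensorComplex
    (resComplex ((MonoidHom.id G).prodMap (MonoidHom.fst _ _)) (tensorPower X' i))
    (resComplex ((MonoidHom.id G).prodMap (MonoidHom.snd _ _)) (tensorPower X'' (n - i)))

/-- The complex `Q[Σₙ] ⊗_{Q[Σ_{i,n-i}]} T^i(X') ⊗ T^(n-i)(X'')` with its action of `G × Σₙ`. As
`G` is carried along, this is the induction from `G × (Σᵢ × Σₙ₋ᵢ)` to `G × Σₙ`. -/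
def indPowTensorPow {Q : Type u} [CommRing Q] {G : Type u} [Group G]
    (X' X'' : ChainComplex (Rep.{u} Q G) ℤ) (i : Fin (n + 1)) :
    ChainComplex (Rep.{u} Q (G × Equiv.Perm (Fin n))) ℤ :=
  indComplex ((MonoidHom.id G).prodMap (youngHom i)) (powTensorPow X' X'' i)

end Young

end PowerOp
end

noncomputable section

namespace PowerOp

/-! ### Exactness and homology in terms of elements -/

section Elements

variable {Q : Type u} [CommRing Q] {H : Type u} [Group H]

/-! A function on perfect complexes, with values in a mere set, descends to `K0` once its value on
an extension is determined by its values on the two ends and every acyclic complex has the value of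
the zero complex (`exists_K0_factorization`). Its fibres then form an abelian group under direct
sum: the cone of the identity makes the shift a negative, and the cone of a quasi-isomorphism, being
acyclic, forces source and target to agree. This criterion suits the nonadditive assignment X ↦
[T^n(X)].

For an extension 0 → X' → X → X'' → 0, filter T^n(X) by the number of tensor factors in the image of
X'. The layer with i such factors is Q[Σₙ] ⊗ T^i(X') ⊗ T^(n-i)(X''). As X'' is degreewise
projective, the sequence splits as one of graded modules. The section is neither equivariant nor a
chain map, but its errors lie in the image of X', one step deeper in the filtration
(`isExtension_quotPow`). Adding up the layers gives the formula for [T^n(X)]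
(`K0.mk_tensorPower_of_isExtension`).

It remains to see that this sum depends only on the classes of the tensor powers of the two ends.
For fixed X'', the functor Q[Σₙ] ⊗ - ⊗ T^(n-i)(X'') preserves extensions of perfect complexes and
acyclic complexes, so it acts on `K0`, and the i-th summand depends on X' through [T^i(X')] alone
(`K0.mk_indPowTensorPow_congr`). The sum is symmetric in X' and X'', because X' ⊕ X'' is an
extension in either order; this settles the other variable. Since T^i occurs for all i ≤ n, the
criterion is applied to the family of all [T^m(X)] at once. The power T^0(X) is Q for every X and is
not supported on Z, which `powSupport` takes into account.

Supports are controlled without localizing: for a prime p outside Z some scalar s outside p is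
null-homotopic on X (`IsPerfectOn.exists_isContractedBy`), and this homotopy, applied to one tensor
factor, contracts s on a tensor power or tensor product. -/

lemma Rep.exact_iff (S : ShortComplex (Rep.{u} Q H)) :
    S.Exact ↔ ∀ y, S.g.hom y = 0 → ∃ x, S.f.hom x = y := by
  rw [← S.exact_map_iff_of_faithful (forget₂ (Rep.{u} Q H) (ModuleCat.{u} Q)),
    ShortComplex.moduleCat_exact_iff]
  rfl

lemma Rep.shortExact_iff (S : ShortComplex (Rep.{u} Q H)) :
    S.ShortExact ↔ Function.Injective S.f.hom ∧ Function.Surjective S.g.hom ∧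
      ∀ y, S.g.hom y = 0 → ∃ x, S.f.hom x = y := by
  rw [← Rep.mono_iff_injective, ← Rep.epi_iff_surjective, ← Rep.exact_iff]
  exact ⟨fun h => ⟨h.mono_f, h.epi_g, h.exact⟩, fun ⟨h1, h2, h3⟩ => { exact := h3 }⟩

/-- A short exact sequence of complexes, in terms of elements. -/
lemma shortExact_iff {X' X X'' : ChainComplex (Rep.{u} Q H) ℤ} (f : X' ⟶ X) (g : X ⟶ X'')
    (w : f ≫ g = 0) : (ShortComplex.mk f g w).ShortExact ↔ ∀ i,
      Function.Injective (f.f i).hom ∧ Function.Surjective (g.f i).hom ∧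
        ∀ y, (g.f i).hom y = 0 → ∃ x, (f.f i).hom x = y := by
  rw [HomologicalComplex.shortExact_iff_degreewise_shortExact]
  exact forall_congr' fun i => Rep.shortExact_iff _

variable {X Y : ChainComplex (Rep.{u} Q H) ℤ}

lemma d_d (X : ChainComplex (Rep.{u} Q H) ℤ) (i j k : ℤ) (x : (X.X i).V) :
    (X.d j k).hom ((X.d i j).hom x) = 0 :=
  LinearMap.congr_fun (congrArg (fun f => f.hom.toLinearMap) (X.d_comp_d i j k)) x

lemma hom_d (f : X ⟶ Y) (i j : ℤ) (x : (X.X i).V) :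
    (f.f j).hom ((X.d i j).hom x) = (Y.d i j).hom ((f.f i).hom x) :=
  (LinearMap.congr_fun (congrArg (fun f => f.hom.toLinearMap) (f.comm i j)) x).symm

lemma Rep.comp_hom_apply {A B C : Rep.{u} Q H} (f : A ⟶ B) (g : B ⟶ C) (x : A.V) :
    (f ≫ g).hom x = g.hom (f.hom x) := rfl

lemma exists_cycle (X : ChainComplex (Rep.{u} Q H) ℤ) (i : ℤ) (x : (X.X i).V)
    (hx : (X.d i (i - 1)).hom x = 0) : ∃ z, (X.iCycles i).hom z = x :=
  (Rep.exact_iff (ShortComplex.mk _ _ (X.iCycles_d i (i - 1)))).1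
    (ShortComplex.exact_of_f_is_kernel _ (X.cyclesIsKernel i (i - 1) (by simp))) x hx

lemma exists_toCycles (X : ChainComplex (Rep.{u} Q H) ℤ) (i : ℤ) (z : (X.cycles i).V)
    (hz : (X.homologyπ i).hom z = 0) : ∃ y, (X.toCycles (i + 1) i).hom y = z :=
  (Rep.exact_iff (ShortComplex.mk _ _ (X.toCycles_comp_homologyπ (i + 1) i))).1
    (ShortComplex.exact_of_g_is_cokernel _ (X.homologyIsCokernel (i + 1) i (by simp))) z hz

lemma homologyπ_surjective (X : ChainComplex (Rep.{u} Q H) ℤ) (i : ℤ) :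
    Function.Surjective (X.homologyπ i).hom :=
  (Rep.epi_iff_surjective _).1 inferInstance

lemma iCycles_injective (X : ChainComplex (Rep.{u} Q H) ℤ) (i : ℤ) :
    Function.Injective (X.iCycles i).hom :=
  (Rep.mono_iff_injective _).1 inferInstance

lemma iCycles_toCycles (X : ChainComplex (Rep.{u} Q H) ℤ) (i j : ℤ) (y : (X.X i).V) :
    (X.iCycles j).hom ((X.toCycles i j).hom y) = (X.d i j).hom y := by
  rw [← Rep.comp_hom_apply, X.toCycles_i]

lemma homologyπ_toCycles (X : ChainComplex (Rep.{u} Q H) ℤ) (i j : ℤ) (y : (X.X i).V) :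
    (X.homologyπ j).hom ((X.toCycles i j).hom y) = 0 := by
  rw [← Rep.comp_hom_apply, X.toCycles_comp_homologyπ]
  rfl

lemma d_iCycles (X : ChainComplex (Rep.{u} Q H) ℤ) (i j : ℤ) (z : (X.cycles i).V) :
    (X.d i j).hom ((X.iCycles i).hom z) = 0 := by
  rw [← Rep.comp_hom_apply, X.iCycles_d]
  rfl

/-- The complex `X` is exact at the prime `p`. -/
def ExactAt (X : ChainComplex (Rep.{u} Q H) ℤ) (p : PrimeSpectrum Q) : Prop :=
  ∀ (i : ℤ) (x : (X.X i).V), (X.d i (i - 1)).hom x = 0 →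
    ∃ s ∉ p.asIdeal, ∃ y : (X.X (i + 1)).V, s • x = (X.d (i + 1) i).hom y

/-- A homology class vanishes in the localization at `p` exactly when some scalar outside `p` turns
a representing cycle into a boundary. Later arguments on supports can thus work with elements and
avoid homology objects. -/
lemma support_homology_iff (Z : Set (PrimeSpectrum Q)) :
    (∀ i, Module.support Q (X.homology i).V ⊆ Z) ↔ ∀ p ∉ Z, ExactAt X p := by
  constructor
  · intro h p hp i x hx
    have hp' : p ∉ Module.support Q (X.homology i).V := fun h' => hp (h i h')
    rw [Module.notMem_support_iff'] at hp'
    obtain ⟨z, rfl⟩ := exists_cycle X i x hx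
    obtain ⟨s, hs, h0⟩ := hp' ((X.homologyπ i).hom z)
    rw [← map_smul] at h0
    obtain ⟨y, hy⟩ := exists_toCycles X i _ h0
    exact ⟨s, hs, y, by rw [← iCycles_toCycles, hy, map_smul]⟩
  · intro h i p hp
    by_contra hpZ
    refine (Module.notMem_support_iff'.2 fun m => ?_) hp
    obtain ⟨z, rfl⟩ := homologyπ_surjective X i m
    obtain ⟨s, hs, y, hy⟩ := h p hpZ i _ (d_iCycles X i _ z)
    refine ⟨s, hs, ?_⟩
    rw [← map_smul]
    have : s • z = (X.toCycles (i + 1) i).hom y := by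
      apply iCycles_injective
      rw [iCycles_toCycles, ← hy, map_smul]
    rw [this, homologyπ_toCycles]

/-- What the diagram chase in the cone needs from injectivity on homology. -/
lemma exists_of_mono_homologyMap (f : X ⟶ Y) [QuasiIso f] (i : ℤ) (x : (X.X i).V)
    (hx : (X.d i (i - 1)).hom x = 0) (y : (Y.X (i + 1)).V)
    (hy : (f.f i).hom x = (Y.d (i + 1) i).hom y) : ∃ x', x = (X.d (i + 1) i).hom x' := by
  obtain ⟨z, rfl⟩ := exists_cycle X i x hx
  have h1 : (HomologicalComplex.cyclesMap f i).hom z = (Y.toCycles (i + 1) i).hom y := by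
    apply iCycles_injective
    rw [iCycles_toCycles, ← hy, ← Rep.comp_hom_apply, HomologicalComplex.cyclesMap_i]
    rfl
  have h2 : (HomologicalComplex.homologyMap f i).hom ((X.homologyπ i).hom z) = 0 := by
    rw [← Rep.comp_hom_apply, HomologicalComplex.homologyπ_naturality, Rep.comp_hom_apply, h1,
      homologyπ_toCycles]
  have h3 : (X.homologyπ i).hom z = 0 := by
    apply (Rep.mono_iff_injective (HomologicalComplex.homologyMap f i)).1 inferInstance
    rw [h2, map_zero]
  obtain ⟨x', hx'⟩ := exists_toCycles X i z h3
  exact ⟨x', by rw [← hx', iCycles_toCycles]⟩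

/-- What the same chase needs from surjectivity on homology. -/
lemma exists_of_epi_homologyMap (f : X ⟶ Y) [QuasiIso f] (i : ℤ) (y : (Y.X i).V)
    (hy : (Y.d i (i - 1)).hom y = 0) : ∃ (x : (X.X i).V) (y' : (Y.X (i + 1)).V),
      (X.d i (i - 1)).hom x = 0 ∧ y = (f.f i).hom x + (Y.d (i + 1) i).hom y' := by
  obtain ⟨z, rfl⟩ := exists_cycle Y i y hy
  obtain ⟨m, hm⟩ := (Rep.epi_iff_surjective (HomologicalComplex.homologyMap f i)).1 inferInstance
    ((Y.homologyπ i).hom z)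
  obtain ⟨t, rfl⟩ := homologyπ_surjective X i m
  have h1 : (Y.homologyπ i).hom (z - (HomologicalComplex.cyclesMap f i).hom t) = 0 := by
    rw [map_sub, ← hm, ← Rep.comp_hom_apply, ← Rep.comp_hom_apply,
      HomologicalComplex.homologyπ_naturality, sub_self]
  obtain ⟨y', hy'⟩ := exists_toCycles Y i _ h1
  refine ⟨(X.iCycles i).hom t, y', d_iCycles X i _ t, ?_⟩
  rw [← iCycles_toCycles, hy', map_sub, ← Rep.comp_hom_apply _ (Y.iCycles i),
    HomologicalComplex.cyclesMap_i, Rep.comp_hom_apply, add_sub_cancel]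

/-- A morphism between complexes without homology is a quasi-isomorphism. -/
lemma quasiIso_of_support_empty (f : X ⟶ Y) (hX : ∀ i, Module.support Q (X.homology i).V ⊆ ∅)
    (hY : ∀ i, Module.support Q (Y.homology i).V ⊆ ∅) : QuasiIso f where
  quasiIsoAt i := by
    rw [quasiIsoAt_iff_isIso_homologyMap]
    have h1 : Subsingleton (X.homology i).V :=
      Module.support_eq_empty_iff.1 (Set.subset_empty_iff.1 (hX i))
    have h2 : Subsingleton (Y.homology i).V :=
      Module.support_eq_empty_iff.1 (Set.subset_empty_iff.1 (hY i))
    have : Mono (HomologicalComplex.homologyMap f i) :=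
      (Rep.mono_iff_injective _).2 fun a b _ => Subsingleton.elim _ _
    have : Epi (HomologicalComplex.homologyMap f i) :=
      (Rep.epi_iff_surjective _).2 fun b => ⟨0, Subsingleton.elim _ _⟩
    exact isIso_of_mono_of_epi _

end Elements

/-! ### Perfect complexes and their classes -/

section Perfect

variable {Q : Type u} [CommRing Q] {H : Type u} [Group H]
  {X Y : ChainComplex (Rep.{u} Q H) ℤ} {Z : Set (PrimeSpectrum Q)}

lemma IsPerfectOn.exactAt (h : IsPerfectOn Z X) {p : PrimeSpectrum Q} (hp : p ∉ Z) :
    ExactAt X p :=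
  (support_homology_iff Z).1 h.support p hp

lemma IsPerfectOn.of_subsingleton (h : ∀ i, Subsingleton (X.X i).V) : IsPerfectOn Z X := by
  refine ⟨⟨0, 0, fun i _ => h i⟩, fun i => ?_, fun i => ?_, (support_homology_iff Z).2 ?_⟩
  · have := h i; infer_instance
  · have := h i; infer_instance
  · intro p _ i x _
    have := h i
    have := h (i + 1)
    refine ⟨1, p.isPrime.one_notMem, 0, Subsingleton.elim _ _⟩

variable (Q H) in
/-- The zero complex. -/
def zeroComplex : ChainComplex (Rep.{u} Q H) ℤ where
  X _ := Rep.trivial Q H PUnit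
  d _ _ := 0

instance (i : ℤ) : Subsingleton ((zeroComplex Q H).X i).V :=
  inferInstanceAs (Subsingleton PUnit)

lemma isPerfectOn_zeroComplex : IsPerfectOn Z (zeroComplex Q H) :=
  .of_subsingleton inferInstance

/-- Perfect complexes with support in `Z` are closed under extensions. -/
lemma IsPerfectOn.of_shortExact {X' X'' : ChainComplex (Rep.{u} Q H) ℤ} (h' : IsPerfectOn Z X')
    (h'' : IsPerfectOn Z X'') (f : X' ⟶ X) (g : X ⟶ X'') (w : f ≫ g = 0)
    (hS : (ShortComplex.mk f g w).ShortExact) : IsPerfectOn Z X := by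
  rw [shortExact_iff] at hS
  -- Projectivity of the right end splits the sequence linearly in each degree; only the existence
  -- of the isomorphism matters, hence the `True`.
  have hlin : ∀ i, ∃ e : (X.X i).V ≃ₗ[Q] (X'.X i).V × (X''.X i).V, True := by
    intro i
    obtain ⟨h1, h2, h3⟩ := hS i
    have := h''.projective i
    obtain ⟨s, hs⟩ := Module.projective_lifting_property (g.f i).hom.toLinearMap
      LinearMap.id h2
    have hex : Function.Exact (f.f i).hom.toLinearMap (g.f i).hom.toLinearMap := by
      intro y
      refine ⟨fun hy => h3 y hy, ?_⟩
      rintro ⟨x, rfl⟩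
      exact LinearMap.congr_fun (congrArg (fun φ => (φ.f i).hom.toLinearMap) w) x
    exact ⟨(hex.splitSurjectiveEquiv h1 ⟨s, hs⟩).1, trivial⟩
  refine ⟨?_, fun i => ?_, fun i => ?_, (support_homology_iff Z).2 ?_⟩
  · obtain ⟨a, b, hab⟩ := h'.bounded
    obtain ⟨a', b', hab'⟩ := h''.bounded
    refine ⟨min a a', max b b', fun i hi => ?_⟩
    have := hab i (by omega)
    have := hab' i (by omega)
    obtain ⟨e, -⟩ := hlin i
    exact e.toEquiv.subsingleton
  · have := h'.finite i
    have := h''.finite i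
    obtain ⟨e, -⟩ := hlin i
    exact Module.Finite.equiv e.symm
  · have := h'.projective i
    have := h''.projective i
    obtain ⟨e, -⟩ := hlin i
    exact Module.Projective.of_equiv e.symm
  · intro p hp i x hx
    -- The usual chase up to scalars: after multiplication by `s` the image of `x` in `X''` bounds,
    -- and the remaining error comes from a cycle of `X'`, which bounds after multiplication by
    -- `s'`.
    obtain ⟨s, hs, y'', hy''⟩ := h''.exactAt hp i ((g.f i).hom x) (by
      rw [← hom_d, hx, map_zero])
    obtain ⟨y, rfl⟩ := (hS (i + 1)).2.1 y''
    rw [← hom_d, ← map_smul, ← sub_eq_zero, ← map_sub] at hy''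
    obtain ⟨x', hx'⟩ := (hS i).2.2 _ hy''
    have hdx' : (X'.d i (i - 1)).hom x' = 0 := by
      apply (hS (i - 1)).1
      rw [hom_d, hx', map_sub, map_smul, hx, d_d, map_zero, smul_zero, sub_zero]
    obtain ⟨s', hs', z, hz⟩ := h'.exactAt hp i x' hdx'
    refine ⟨s' * s, p.isPrime.mul_notMem hs' hs, s' • y + (f.f (i + 1)).hom z, ?_⟩
    rw [map_add, map_smul, ← hom_d, ← hz, map_smul, hx', mul_smul, smul_sub, add_sub_cancel]

lemma K0.mk_eq_add {X' X'' : ChainComplex (Rep.{u} Q H) ℤ} (h' : IsPerfectOn Z X')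
    (h : IsPerfectOn Z X) (h'' : IsPerfectOn Z X'') (f : X' ⟶ X) (g : X ⟶ X'') (w : f ≫ g = 0)
    (hS : (ShortComplex.mk f g w).ShortExact) : K0.mk X h = K0.mk X' h' + K0.mk X'' h'' := by
  unfold K0.mk
  rw [← QuotientAddGroup.mk_add, eq_comm, QuotientAddGroup.eq, neg_add_eq_sub]
  exact AddSubgroup.subset_closure (K0Rel.shortExact ⟨X', h'⟩ ⟨X, h⟩ ⟨X'', h''⟩ f g w hS)

lemma K0.mk_eq_of_quasiIso (hX : IsPerfectOn Z X) (hY : IsPerfectOn Z Y) (f : X ⟶ Y)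
    (hf : QuasiIso f) : K0.mk X hX = K0.mk Y hY := by
  unfold K0.mk
  rw [eq_comm, QuotientAddGroup.eq, neg_add_eq_sub]
  exact AddSubgroup.subset_closure (K0Rel.quasiIso ⟨X, hX⟩ ⟨Y, hY⟩ f hf)

/-- The sequence with three zero complexes gives the relation x = x + x. -/
lemma K0.mk_zeroComplex : K0.mk (zeroComplex Q H) isPerfectOn_zeroComplex = (0 : K0 Z H) := by
  have h := K0.mk_eq_add (Z := Z) (X := zeroComplex Q H) isPerfectOn_zeroComplex
    isPerfectOn_zeroComplex isPerfectOn_zeroComplex 0 0 (by simp) (by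
      rw [shortExact_iff]
      exact fun i => ⟨fun a b _ => Subsingleton.elim _ _, fun b => ⟨0, Subsingleton.elim _ _⟩,
        fun y _ => ⟨0, Subsingleton.elim _ _⟩⟩)
  simpa using h

/-- The class of an acyclic complex vanishes. -/
lemma K0.mk_eq_zero (h : IsPerfectOn Z X) (h0 : IsPerfectOn ∅ X) : K0.mk X h = 0 := by
  rw [← K0.mk_zeroComplex]
  exact K0.mk_eq_of_quasiIso _ _ 0
    (quasiIso_of_support_empty _ h0.support isPerfectOn_zeroComplex.support)

end Perfect

/-! ### Shifts and cones -/

section Cone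

variable {Q : Type u} [CommRing Q] {H : Type u} [Group H]
  {X Y : ChainComplex (Rep.{u} Q H) ℤ} {Z : Set (PrimeSpectrum Q)}

/-- The degrees are variables so that equalities such as `i - 1 + 1 = i + 1 - 1`, which arise from
the shift, can be substituted away. -/
lemma ExactAt.exists_of_eq {p : PrimeSpectrum Q} (h : ExactAt X p) {i j k : ℤ} (hi : j + 1 = i)
    (hk : j - 1 = k) (x : (X.X j).V) (hx : (X.d j k).hom x = 0) :
    ∃ s ∉ p.asIdeal, ∃ y : (X.X i).V, s • x = (X.d i j).hom y := by
  subst hi hk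
  exact h j x hx

/-- The shift of a complex. -/
def shiftComplex (X : ChainComplex (Rep.{u} Q H) ℤ) : ChainComplex (Rep.{u} Q H) ℤ where
  X i := X.X (i - 1)
  d i j := - X.d (i - 1) (j - 1)
  shape i j hij := by
    rw [X.shape, neg_zero]
    intro (h : j - 1 + 1 = i - 1)
    exact hij (by simp only [ComplexShape.down_Rel]; omega)
  d_comp_d' i j k _ _ := by simp

lemma IsPerfectOn.shift (h : IsPerfectOn Z X) : IsPerfectOn Z (shiftComplex X) := by
  refine ⟨?_, fun i => h.finite (i - 1), fun i => h.projective (i - 1),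
    (support_homology_iff Z).2 ?_⟩
  · obtain ⟨a, b, hab⟩ := h.bounded
    exact ⟨a + 1, b + 1, fun i hi => hab (i - 1) (by omega)⟩
  · intro p hp i (x : (X.X (i - 1)).V) hx
    obtain ⟨s, hs, y, hy⟩ := (h.exactAt hp).exists_of_eq (i := i + 1 - 1) (by omega) rfl x
      (neg_eq_zero.1 hx)
    refine ⟨s, hs, (-y : (X.X (i + 1 - 1)).V), hy.trans ?_⟩
    change _ = -(X.d (i + 1 - 1) (i - 1)).hom (-y)
    rw [map_neg, neg_neg]

/-- A chain map, as a map between components whose degrees are equal by hypothesis. -/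
def homOfEq (f : X ⟶ Y) {a b : ℤ} (h : a = b) : X.X a ⟶ Y.X b :=
  f.f a ≫ (Y.XIsoOfEq h).hom

lemma homOfEq_rfl (f : X ⟶ Y) (a : ℤ) : homOfEq f (rfl : a = a) = f.f a := by
  simp [homOfEq]

lemma d_homOfEq (f : X ⟶ Y) {a b a' b' : ℤ} (h : a = b) (h' : a' = b') (x : (X.X a).V) :
    (Y.d b b').hom ((homOfEq f h).hom x) = (homOfEq f h').hom ((X.d a a').hom x) := by
  subst h h'
  rw [homOfEq_rfl, homOfEq_rfl, hom_d]

/-- The mapping cone of a chain map. -/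
def coneComplex (f : X ⟶ Y) : ChainComplex (Rep.{u} Q H) ℤ where
  X i := Rep.of ((X.X (i - 1)).ρ.prod (Y.X i).ρ)
  d i j := if h : i - 1 = j then Rep.ofHom
      ⟨LinearMap.prod (-(X.d (i - 1) (j - 1)).hom.toLinearMap ∘ₗ LinearMap.fst Q _ _)
        ((homOfEq f h).hom.toLinearMap ∘ₗ LinearMap.fst Q _ _ +
          (Y.d i j).hom.toLinearMap ∘ₗ LinearMap.snd Q _ _), fun g => by
        refine LinearMap.ext fun x => Prod.ext ?_ ?_
        · change -(X.d (i - 1) (j - 1)).hom ((X.X (i - 1)).ρ g x.1) =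
            (X.X (j - 1)).ρ g (-(X.d (i - 1) (j - 1)).hom x.1)
          rw [Rep.hom_comm_apply, map_neg]
        · change (homOfEq f h).hom ((X.X (i - 1)).ρ g x.1) + (Y.d i j).hom ((Y.X i).ρ g x.2) =
            (Y.X j).ρ g ((homOfEq f h).hom x.1 + (Y.d i j).hom x.2)
          rw [Rep.hom_comm_apply, Rep.hom_comm_apply, map_add]⟩
    else 0
  shape i j hij := dif_neg fun h => hij (by simp only [ComplexShape.down_Rel]; omega)
  d_comp_d' i j k hij hjk := by
    have h1 : j + 1 = i := hij
    have h2 : k + 1 = j := hjk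
    rw [dif_pos (by omega), dif_pos (by omega)]
    apply Rep.hom_ext
    apply Representation.IntertwiningMap.ext
    refine LinearMap.ext fun x => Prod.ext ?_ ?_
    · change -(X.d (j - 1) (k - 1)).hom (-(X.d (i - 1) (j - 1)).hom x.1) = 0
      rw [map_neg, d_d, neg_zero, neg_zero]
    · change (homOfEq f _).hom (-(X.d (i - 1) (j - 1)).hom x.1) +
        (Y.d j k).hom ((homOfEq f _).hom x.1 + (Y.d i j).hom x.2) = 0
      rw [map_add, d_d, add_zero, d_homOfEq f _ (by omega : j - 1 = k), map_neg, neg_add_cancel]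

lemma coneComplex_d (f : X ⟶ Y) {i j : ℤ} (h : i - 1 = j) (x : (X.X (i - 1)).V)
    (y : (Y.X i).V) : ((coneComplex f).d i j).hom ((x, y) : (X.X (i - 1)).V × (Y.X i).V) =
      ((-(X.d (i - 1) (j - 1)).hom x, (homOfEq f h).hom x + (Y.d i j).hom y) :
        (X.X (j - 1)).V × (Y.X j).V) :=
  congrArg (fun φ : (coneComplex f).X i ⟶ (coneComplex f).X j =>
    φ.hom ((x, y) : (X.X (i - 1)).V × (Y.X i).V)) (dif_pos h)

/-- The inclusion of the target into the cone. -/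
def coneInr (f : X ⟶ Y) : Y ⟶ coneComplex f where
  f i := Rep.ofHom ⟨LinearMap.inr Q (X.X (i - 1)).V (Y.X i).V, fun g => by
    refine LinearMap.ext fun y => Prod.ext ?_ rfl
    exact (map_zero ((X.X (i - 1)).ρ g)).symm⟩
  comm' i j hij := by
    have h : j + 1 = i := hij
    apply Rep.hom_ext
    apply Representation.IntertwiningMap.ext
    refine LinearMap.ext fun y => ?_
    refine (coneComplex_d f (by omega : i - 1 = j) 0 y).trans (Prod.ext ?_ ?_)
    · change -(X.d (i - 1) (j - 1)).hom 0 = 0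
      rw [map_zero, neg_zero]
    · change (homOfEq f _).hom 0 + (Y.d i j).hom y = (Y.d i j).hom y
      rw [map_zero, zero_add]

/-- The projection of the cone to the shift of the source. -/
def coneFst (f : X ⟶ Y) : coneComplex f ⟶ shiftComplex X where
  f i := Rep.ofHom ⟨LinearMap.fst Q (X.X (i - 1)).V (Y.X i).V, fun g => rfl⟩
  comm' i j hij := by
    have h : j + 1 = i := hij
    apply Rep.hom_ext
    apply Representation.IntertwiningMap.ext
    refine LinearMap.ext fun y => ?_
    exact (congrArg Prod.fst (coneComplex_d f (by omega : i - 1 = j) y.1 y.2)).symm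

lemma coneInr_coneFst (f : X ⟶ Y) : coneInr f ≫ coneFst f = 0 := rfl

lemma shortExact_cone (f : X ⟶ Y) :
    (ShortComplex.mk (coneInr f) (coneFst f) (coneInr_coneFst f)).ShortExact := by
  rw [shortExact_iff]
  refine fun i => ⟨?_, ?_, ?_⟩
  · exact LinearMap.inr_injective
  · exact LinearMap.fst_surjective
  · intro y hy
    exact ⟨y.2, Prod.ext hy.symm rfl⟩

lemma IsPerfectOn.cone (hX : IsPerfectOn Z X) (hY : IsPerfectOn Z Y) (f : X ⟶ Y) :
    IsPerfectOn Z (coneComplex f) :=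
  hY.of_shortExact hX.shift _ _ _ (shortExact_cone f)

/-- For a cycle `(x, y)` the element `x` is a cycle whose image is the boundary of `-y`, so `x = d
x₁` by injectivity on homology. Then `f x₁ + y` is a cycle, by surjectivity equal to `f x₂ + d y'`
with `x₂` a cycle, and `(x₂ - x₁, y')` has boundary `(x, y)`. No scalar is needed, so `1` serves at
every prime. -/
lemma IsPerfectOn.cone_empty (hX : IsPerfectOn Z X) (hY : IsPerfectOn Z Y) (f : X ⟶ Y)
    (hf : QuasiIso f) : IsPerfectOn ∅ (coneComplex f) := by
  have h := hX.cone hY f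
  refine ⟨h.bounded, h.finite, h.projective, (support_homology_iff _).2 ?_⟩
  rintro p - i ⟨x, y⟩ hxy
  refine ⟨1, p.isPrime.one_notMem, ?_⟩
  rw [coneComplex_d f rfl] at hxy
  have hx : (X.d (i - 1) (i - 1 - 1)).hom x = 0 := neg_eq_zero.1 (congrArg Prod.fst hxy)
  have hy : (homOfEq f (rfl : i - 1 = i - 1)).hom x + (Y.d i (i - 1)).hom y = 0 :=
    congrArg Prod.snd hxy
  rw [homOfEq_rfl] at hy
  obtain ⟨j, rfl⟩ : ∃ j, i = j + 1 := ⟨i - 1, by omega⟩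
  -- The degrees `a` and `b` agree with `j` and `j + 1` only up to a proof; as variables they can be
  -- substituted.
  have key : ∀ (a b : ℤ) (ha : j = a) (hb : j + 1 = b) (x : (X.X a).V),
      (X.d a (a - 1)).hom x = 0 → (f.f a).hom x + (Y.d (j + 1) a).hom y = 0 →
      ∃ (x' : (X.X b).V) (y' : (Y.X (j + 1 + 1)).V), x = -(X.d b a).hom x' ∧
        y = (homOfEq f hb.symm).hom x' + (Y.d (j + 1 + 1) (j + 1)).hom y' := by
    rintro _ _ rfl rfl x hx hy
    obtain ⟨x₁, rfl⟩ := exists_of_mono_homologyMap f j x hx (-y) (by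
      rw [map_neg]; exact eq_neg_of_add_eq_zero_left hy)
    rw [hom_d, ← map_add] at hy
    have hy2 : (Y.d (j + 1) (j + 1 - 1)).hom ((f.f (j + 1)).hom x₁ + y) = 0 := by
      have : ∀ k, j = k → (Y.d (j + 1) k).hom ((f.f (j + 1)).hom x₁ + y) = 0 := by
        rintro _ rfl; exact hy
      exact this _ (by omega)
    obtain ⟨x₂, y', hx₂, hy'⟩ := exists_of_epi_homologyMap f (j + 1) _ hy2
    refine ⟨x₂ - x₁, y', ?_, ?_⟩
    · have : (X.d (j + 1) j).hom x₂ = 0 := by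
        have : ∀ k, k = j → (X.d (j + 1) k).hom x₂ = 0 → (X.d (j + 1) j).hom x₂ = 0 := by
          rintro _ rfl h; exact h
        exact this _ (by omega) hx₂
      rw [map_sub, this, zero_sub, neg_neg]
    · rw [homOfEq_rfl, map_sub, sub_add_eq_add_sub, ← hy', add_sub_cancel_left]
  obtain ⟨x', y', h1, h2⟩ := key _ (j + 1 + 1 - 1) (by omega) (by omega) x hx hy
  refine ⟨((x', y') : (X.X (j + 1 + 1 - 1)).V × (Y.X (j + 1 + 1)).V), ?_⟩
  refine ((one_smul Q _).trans (Prod.ext h1 h2)).trans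
    (coneComplex_d f (by omega : j + 1 + 1 - 1 = j + 1) x' y').symm

end Cone

/-! ### Functions on the Grothendieck group -/

section Factor

open Limits

variable {Q : Type u} [CommRing Q] {H : Type u} [Group H] {Z : Set (PrimeSpectrum Q)}

/-- The objects `X'`, `X`, `X''` fit into a short exact sequence `0 → X' → X → X'' → 0`. -/
def IsExtension (X' X X'' : ChainComplex (Rep.{u} Q H) ℤ) : Prop :=
  ∃ (f : X' ⟶ X) (g : X ⟶ X'') (w : f ≫ g = 0), (ShortComplex.mk f g w).ShortExact

lemma isExtension_biprod (X Y : ChainComplex (Rep.{u} Q H) ℤ) : IsExtension X (X ⊞ Y) Y :=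
  ⟨biprod.inl, biprod.snd, biprod.inl_snd,
    (ShortComplex.Splitting.mk (S := ShortComplex.mk _ _ biprod.inl_snd)
      biprod.fst biprod.inr (by simp) (by simp) (by simp [biprod.total])).shortExact⟩

lemma isExtension_biprod_swap (X Y : ChainComplex (Rep.{u} Q H) ℤ) : IsExtension Y (X ⊞ Y) X :=
  ⟨biprod.inr, biprod.fst, biprod.inr_fst,
    (ShortComplex.Splitting.mk (S := ShortComplex.mk _ _ biprod.inr_fst)
      biprod.snd biprod.inl (by simp) (by simp)
      (by simp [add_comm, ← biprod.total])).shortExact⟩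

/-- This gives `(X ⊞ Y) ⊞ W` the same ends as `X ⊞ (Y ⊞ W)`, which is all that associativity in the
quotient requires. -/
lemma isExtension_biprod_assoc (X Y W : ChainComplex (Rep.{u} Q H) ℤ) :
    IsExtension X ((X ⊞ Y) ⊞ W) (Y ⊞ W) :=
  have w : (biprod.inl ≫ biprod.inl : X ⟶ (X ⊞ Y) ⊞ W) ≫ biprod.map biprod.snd (𝟙 W) = 0 := by
    simp
  ⟨_, _, w, (ShortComplex.Splitting.mk (S := ShortComplex.mk _ _ w)
      (biprod.fst ≫ biprod.fst) (biprod.map biprod.inr (𝟙 W)) (by simp)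
      (biprod.hom_ext' _ _ (by simp) (by simp))
      (biprod.hom_ext' _ _ (biprod.hom_ext' _ _ (by simp) (by simp)) (by simp))).shortExact⟩

lemma isExtension_self_zero (X : ChainComplex (Rep.{u} Q H) ℤ) :
    IsExtension (zeroComplex Q H) X X :=
  ⟨0, 𝟙 X, by simp, by
    rw [shortExact_iff]
    exact fun i => ⟨fun a b _ => Subsingleton.elim _ _, fun y => ⟨y, rfl⟩,
      fun y hy => ⟨0, (map_zero _).trans hy.symm⟩⟩⟩

lemma IsPerfectOn.of_isExtension {X' X X'' : ChainComplex (Rep.{u} Q H) ℤ}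
    (h : IsExtension X' X X'') (h' : IsPerfectOn Z X') (h'' : IsPerfectOn Z X'') :
    IsPerfectOn Z X :=
  let ⟨f, g, w, hS⟩ := h
  h'.of_shortExact h'' f g w hS

lemma IsPerfectOn.biprod {X Y : ChainComplex (Rep.{u} Q H) ℤ} (hX : IsPerfectOn Z X)
    (hY : IsPerfectOn Z Y) : IsPerfectOn Z (X ⊞ Y) :=
  .of_isExtension (isExtension_biprod X Y) hX hY

/-- A function on perfect complexes descends to the Grothendieck group, if its value on an
extension depends only on its values on the two ends, and if its value on an acyclic complex is
the value on the zero complex. -/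
theorem exists_K0_factorization {S : Type v} (c : Perf Z H → S)
    (hc : ∀ X' X X'' Y' Y Y'' : Perf Z H, IsExtension X'.obj X.obj X''.obj →
      IsExtension Y'.obj Y.obj Y''.obj → c X' = c Y' → c X'' = c Y'' → c X = c Y)
    (h0 : ∀ X : Perf Z H, IsPerfectOn ∅ X.obj →
      c X = c ⟨zeroComplex Q H, isPerfectOn_zeroComplex⟩) :
    ∃ t : K0 Z H → S, ∀ (X : ChainComplex (Rep.{u} Q H) ℤ) (hX : IsPerfectOn Z X),
      t (K0.mk X hX) = c ⟨X, hX⟩ := by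
  -- `A` is the set of values of `c`, presented as a quotient; the group structure is built here,
  -- since `S` carries none.
  let A := Quotient (Setoid.ker c)
  let cl : Perf Z H → A := fun X => Quotient.mk _ X
  let sum : Perf Z H → Perf Z H → Perf Z H := fun X Y =>
    ⟨X.obj ⊞ Y.obj, X.property.biprod Y.property⟩
  let zero : Perf Z H := ⟨zeroComplex Q H, isPerfectOn_zeroComplex⟩
  have eqc : ∀ {X Y : Perf Z H}, c X = c Y → cl X = cl Y := fun h => Quotient.sound h
  -- The hypothesis on extensions is exactly what makes the direct sum well defined on values of
  -- `c`.
  let add : A → A → A := Quotient.map₂ sum fun X X' h Y Y' h' =>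
    hc _ _ _ _ _ _ (isExtension_biprod _ _) (isExtension_biprod _ _) h h'
  have ext : ∀ X' X X'' : Perf Z H, IsExtension X'.obj X.obj X''.obj →
      cl X = add (cl X') (cl X'') := fun X' X X'' h =>
    eqc (hc _ _ _ _ _ _ h (isExtension_biprod X'.obj X''.obj) rfl rfl)
  have acyc : ∀ X : Perf Z H, IsPerfectOn ∅ X.obj → cl X = cl zero := fun X h => eqc (h0 X h)
  have zadd : ∀ a : A, add (cl zero) a = a := by
    rintro ⟨X⟩
    exact (ext _ X _ (isExtension_self_zero X.obj)).symm
  have acomm : ∀ a b : A, add a b = add b a := by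
    rintro ⟨X⟩ ⟨Y⟩
    exact ext _ (sum X Y) _ (isExtension_biprod_swap X.obj Y.obj)
  have assoc : ∀ a b e : A, add (add a b) e = add a (add b e) := by
    rintro ⟨X⟩ ⟨Y⟩ ⟨W⟩
    exact ext _ (sum (sum X Y) W) (sum Y W) (isExtension_biprod_assoc X.obj Y.obj W.obj)
  let sh : Perf Z H → Perf Z H := fun X => ⟨shiftComplex X.obj, X.property.shift⟩
  -- The cone of `f` is an extension of the shift of `X` by `Y`, and it is acyclic if `f` is a
  -- quasi-isomorphism.
  have shadd : ∀ {X Y : Perf Z H} (f : X.obj ⟶ Y.obj), QuasiIso f →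
      add (cl Y) (cl (sh X)) = cl zero := fun {X Y} f hf => by
    rw [← ext Y ⟨coneComplex f, X.property.cone Y.property f⟩ (sh X)
      ⟨_, _, _, shortExact_cone f⟩]
    exact acyc _ (X.property.cone_empty Y.property f hf)
  -- The case of the identity: the shift is a negative.
  have hneg : ∀ a : A, ∃ b, add b a = cl zero := by
    rintro ⟨X⟩
    exact ⟨cl (sh X), (acomm _ _).trans (shadd (𝟙 X.obj) inferInstance)⟩
  choose neg hneg using hneg
  let _ : Add A := ⟨add⟩
  let _ : Zero A := ⟨cl zero⟩
  let _ : Neg A := ⟨neg⟩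
  let _ : AddGroup A := AddGroup.ofLeftAxioms assoc zadd hneg
  let _ : AddCommGroup A := { add_comm := acomm }
  let φ : FreeAbelianGroup (Perf Z H) →+ A := FreeAbelianGroup.lift cl
  have hφ : AddSubgroup.closure {r | K0Rel Z H r} ≤ φ.ker := by
    rw [AddSubgroup.closure_le]
    rintro r (⟨X', X, X'', f, g, w, h⟩ | ⟨X, Y, f, h⟩)
    · change φ _ = 0
      rw [map_sub, map_add, FreeAbelianGroup.lift_apply_of, FreeAbelianGroup.lift_apply_of,
        FreeAbelianGroup.lift_apply_of, sub_eq_zero]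
      exact ext X' X X'' ⟨f, g, w, h⟩
    · change φ _ = 0
      rw [map_sub, FreeAbelianGroup.lift_apply_of, FreeAbelianGroup.lift_apply_of, sub_eq_zero]
      -- Both `Y` and `X` are inverse to the shift of `X`, hence equal in `A`.
      have h1 : cl Y + cl (sh X) = 0 := shadd f h
      have h2 : cl X + cl (sh X) = 0 := shadd (𝟙 X.obj) inferInstance
      exact add_right_cancel (h2.trans h1.symm)
  refine ⟨fun a => Quotient.lift c (fun _ _ h => h) (QuotientAddGroup.lift _ φ hφ a),
    fun X hX => ?_⟩
  change Quotient.lift c (fun _ _ h => h) (φ (FreeAbelianGroup.of _)) = _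
  rw [FreeAbelianGroup.lift_apply_of]
  rfl

end Factor

/-! ### Contractions up to a scalar -/

section Contraction

/-- One scalar for each of finitely many generators suffices, and the product of these scalars
avoids `p` because `p` is prime. -/
lemma exists_notMem_forall_smul_mem {Q : Type*} [CommRing Q] {M : Type*} [AddCommGroup M]
    [Module Q M] (p : PrimeSpectrum Q) {N : Submodule Q M} (hN : N.FG) (R : Submodule Q M)
    (h : ∀ x ∈ N, ∃ s ∉ p.asIdeal, s • x ∈ R) : ∃ s ∉ p.asIdeal, ∀ x ∈ N, s • x ∈ R := by
  induction N, hN using Submodule.fg_induction with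
  | singleton x =>
    obtain ⟨s, hs, hx⟩ := h x (Submodule.mem_span_singleton_self x)
    refine ⟨s, hs, fun y hy => ?_⟩
    obtain ⟨a, rfl⟩ := Submodule.mem_span_singleton.1 hy
    rw [smul_comm]
    exact R.smul_mem a hx
  | sup M₁ M₂ _ _ h₁ h₂ =>
    obtain ⟨s, hs, h1⟩ := h₁ fun x hx => h x (Submodule.mem_sup_left hx)
    obtain ⟨t, ht, h2⟩ := h₂ fun x hx => h x (Submodule.mem_sup_right hx)
    refine ⟨s * t, p.isPrime.mul_notMem hs ht, fun x hx => ?_⟩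
    obtain ⟨y, hy, z, hz, rfl⟩ := Submodule.mem_sup.1 hx
    rw [smul_add]
    refine add_mem ?_ ?_
    · rw [mul_comm, mul_smul]
      exact R.smul_mem t (h1 y hy)
    · rw [mul_smul]
      exact R.smul_mem s (h2 z hz)

variable {Q : Type u} [CommRing Q] {H : Type u} [Group H] {X : ChainComplex (Rep.{u} Q H) ℤ}

lemma totD_homog_of_eq {i j : ℤ} (h : j + 1 = i) (x : (X.X i).V) :
    totD X (homog X i x) = homog X j ((X.d i j).hom x) := by
  obtain rfl : j = i - 1 := by omega
  exact totD_homog X i x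

/-- The projection to the component of degree `i`. -/
abbrev comp (X : ChainComplex (Rep.{u} Q H) ℤ) (i : ℤ) : Tot X →ₗ[Q] (X.X i).V :=
  DirectSum.component Q ℤ _ i

lemma comp_homog (i : ℤ) (x : (X.X i).V) : comp X i (homog X i x) = x :=
  DirectSum.component.lof_self Q ..

lemma comp_homog_of_ne {i j : ℤ} (h : j ≠ i) (x : (X.X j).V) : comp X i (homog X j x) = 0 :=
  (DirectSum.component.of Q ..).trans (dif_neg h)

/-- An endomorphism of the total space that raises degrees by one. -/
def RaisesDegree (h : Tot X →ₗ[Q] Tot X) : Prop :=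
  ∀ (i : ℤ) (x : (X.X i).V), ∃ y, h (homog X i x) = homog X (i + 1) y

/-- The scalar `s` is null-homotopic on `X`. -/
def IsContractedBy (X : ChainComplex (Rep.{u} Q H) ℤ) (s : Q) : Prop :=
  ∃ h : Tot X →ₗ[Q] Tot X, RaisesDegree h ∧ ∀ t, totD X (h t) + h (totD X t) = s • t

/-- An operator of odd degree anticommutes with the grading involution; the cancellations in tensor
products rest on this. -/
lemma totSgn_of_raisesDegree {h : Tot X →ₗ[Q] Tot X} (hh : RaisesDegree h) (t : Tot X) :
    totSgn X (h t) = - h (totSgn X t) := by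
  have : totSgn X ∘ₗ h = - (h ∘ₗ totSgn X) := by
    apply DirectSum.linearMap_ext
    intro i
    ext x
    simp only [LinearMap.comp_apply, LinearMap.neg_apply]
    obtain ⟨y, hy⟩ := hh i x
    rw [totSgn_homog, map_zsmul, map_zsmul, hy, totSgn_homog, map_zsmul, Int.negOnePow_succ,
      Units.val_neg, neg_smul]
  exact LinearMap.congr_fun this t

/-- The homotopy is built from the bottom degree upwards, with a new scalar outside `p` at each
step. Its defect takes values in cycles; these bound after multiplication by a scalar, which can be
chosen uniformly as the image is finitely generated, and projectivity lifts the result through the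
differential. Boundedness makes the process finite. -/
theorem IsPerfectOn.exists_isContractedBy [IsNoetherianRing Q] {Z : Set (PrimeSpectrum Q)}
    (hX : IsPerfectOn Z X) {p : PrimeSpectrum Q} (hp : p ∉ Z) :
    ∃ s ∉ p.asIdeal, IsContractedBy X s := by
  obtain ⟨a, b, hab⟩ := hX.bounded
  -- Here `k` counts the degrees, from the lower bound `a` on, in which the homotopy identity
  -- already holds.
  have step : ∀ k : ℕ, ∃ s ∉ p.asIdeal, ∃ h : Tot X →ₗ[Q] Tot X, RaisesDegree h ∧
      ∀ i < a + k, ∀ x : (X.X i).V,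
        totD X (h (homog X i x)) + h (totD X (homog X i x)) = s • homog X i x := by
    intro k
    induction k with
    | zero =>
      refine ⟨1, p.isPrime.one_notMem, 0, fun i x => ⟨0, by simp⟩, fun i hi x => ?_⟩
      have := hab i (Or.inl (by simpa using hi))
      rw [Subsingleton.elim x 0]
      simp
    | succ k ih =>
      obtain ⟨s, hs, h, hh, hs'⟩ := ih
      set i : ℤ := a + k with hi
      -- The defect `s - dh - hd` in degree `i`, the first degree not yet treated.
      let g : (X.X i).V →ₗ[Q] (X.X i).V :=
        comp X i ∘ₗ (s • LinearMap.id - totD X ∘ₗ h - h ∘ₗ totD X) ∘ₗ homog X i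
      have hg : ∀ x, homog X i (g x) =
          s • homog X i x - totD X (h (homog X i x)) - h (totD X (homog X i x)) := by
        intro x
        obtain ⟨y, hy⟩ := hh i x
        obtain ⟨z, hz⟩ := hh (i - 1) ((X.d i (i - 1)).hom x)
        obtain ⟨z', hz'⟩ : ∃ z', homog X (i - 1 + 1) z = homog X i z' := by
          have : ∀ j (_ : j = i) (z : (X.X j).V), ∃ z', homog X j z = homog X i z' := by
            rintro _ rfl z; exact ⟨z, rfl⟩
          exact this _ (by omega) z
        change homog X i (comp X i (s • homog X i x - totD X (h (homog X i x)) -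
          h (totD X (homog X i x)))) = _
        rw [hy, totD_homog_of_eq rfl, totD_homog, hz, hz', ← map_smul, ← map_sub, ← map_sub,
          comp_homog]
      -- The identity in degree `i - 1`, applied to `d x`, reads `d h d x = s d x`; hence `d` kills
      -- the defect.
      have hdg : ∀ x, (X.d i (i - 1)).hom (g x) = 0 := by
        intro x
        have h1 : totD X (homog X i (g x)) = 0 := by
          have h2 := hs' (i - 1) (by omega) ((X.d i (i - 1)).hom x)
          rw [← totD_homog, totD_totD, map_zero, add_zero] at h2
          rw [hg, map_sub, map_sub, totD_totD, map_smul, sub_zero, h2, sub_self]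
        rw [totD_homog] at h1
        have h3 := congrArg (comp X (i - 1)) h1
        rwa [comp_homog, map_zero] at h3
      have := hX.finite i
      have := hX.projective i
      let D : (X.X (i + 1)).V →ₗ[Q] (X.X i).V := (X.d (i + 1) i).hom.toLinearMap
      obtain ⟨r, hr, hr'⟩ := exists_notMem_forall_smul_mem p (N := g.range)
        (IsNoetherian.noetherian _) D.range (by
          rintro _ ⟨x, rfl⟩
          obtain ⟨r, hr, y, hy⟩ := hX.exactAt hp i (g x) (hdg x)
          exact ⟨r, hr, y, hy.symm⟩)
      let g' : (X.X i).V →ₗ[Q] D.range :=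
        (r • g).codRestrict D.range fun x => hr' _ ⟨x, rfl⟩
      obtain ⟨κ, hκ⟩ := Module.projective_lifting_property D.rangeRestrict g'
        D.surjective_rangeRestrict
      have hκ' : ∀ x, D (κ x) = r • g x := fun x =>
        congrArg Subtype.val (LinearMap.congr_fun hκ x)
      -- Multiplication by `r` preserves the identity below degree `i`, now with the scalar `r * s`;
      -- the lift `κ` of `r • g` repairs degree `i`.
      refine ⟨r * s, p.isPrime.mul_notMem hr hs,
        r • h + homog X (i + 1) ∘ₗ κ ∘ₗ comp X i, fun j x => ?_, fun j hj x => ?_⟩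
      · obtain ⟨y, hy⟩ := hh j x
        rcases eq_or_ne j i with rfl | hji
        · refine ⟨r • y + κ x, ?_⟩
          simp only [LinearMap.add_apply, LinearMap.smul_apply, LinearMap.comp_apply, hy,
            comp_homog, map_add, map_smul]
        · refine ⟨r • y, ?_⟩
          simp only [LinearMap.add_apply, LinearMap.smul_apply, LinearMap.comp_apply, hy,
            comp_homog_of_ne hji, map_smul, map_zero, add_zero]
      -- The differential of an element of degree at most `i` lies below degree `i`, where the
      -- correction vanishes.
      · have hlow : comp X i (totD X (homog X j x)) = 0 := by
          rw [totD_homog, comp_homog_of_ne]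
          push_cast at hj
          omega
        simp only [LinearMap.add_apply, LinearMap.smul_apply, LinearMap.comp_apply, hlow,
          map_add, map_smul, map_zero, add_zero]
        rcases eq_or_ne j i with rfl | hji
        · rw [comp_homog, totD_homog_of_eq rfl]
          change _ + homog X i (D (κ x)) + _ = _
          rw [hκ', map_smul, hg, smul_sub, smul_sub, mul_smul]
          abel
        · rw [comp_homog_of_ne hji, map_zero, map_zero, map_zero, add_zero, ← smul_add,
            hs' j (by push_cast at hj; omega), mul_smul]
  -- This many steps reach beyond `b`, where the components vanish; if `b + 1 < a`, truncation to
  -- zero steps is still enough.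
  obtain ⟨s, hs, h, hh, hs'⟩ := step (b + 1 - a).toNat
  refine ⟨s, hs, h, hh, fun t => ?_⟩
  have : totD X ∘ₗ h + h ∘ₗ totD X = s • LinearMap.id := by
    apply DirectSum.linearMap_ext
    intro i
    ext1 x
    rcases lt_or_ge i (a + (b + 1 - a).toNat) with hi | hi
    · exact hs' i hi x
    · have := hab i (Or.inr (by omega))
      rw [Subsingleton.elim x 0, map_zero, map_zero]
  exact LinearMap.congr_fun this t

end Contraction

/-! ### Finiteness of total spaces -/

section Finiteness

/-- The product is a retract of the tensor product of the free modules `M i →₀ R`, which has a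
basis. -/
instance projective_piTensorProduct {R : Type*} [CommRing R] {ι : Type*} [Finite ι]
    {M : ι → Type*} [∀ i, AddCommGroup (M i)] [∀ i, Module R (M i)]
    [∀ i, Module.Projective R (M i)] : Module.Projective R (PiTensorProduct R M) := by
  choose s hs using fun i => Module.projective_def'.1 (inferInstance : Module.Projective R (M i))
  have : Module.Free R (PiTensorProduct R fun i => M i →₀ R) :=
    Module.Free.of_basis (Basis.piTensorProduct fun i => Finsupp.basisSingleOne)
  refine Module.Projective.of_split (PiTensorProduct.map s)
    (PiTensorProduct.map fun i => Finsupp.linearCombination R id) ?_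
  rw [← PiTensorProduct.map_comp]
  simp only [hs]
  exact PiTensorProduct.map_id

variable {Q : Type u} [CommRing Q] {H : Type u} [Group H] {X : ChainComplex (Rep.{u} Q H) ℤ}
  {Z : Set (PrimeSpectrum Q)}

/-- By boundedness a finite product of components already surjects onto the total space. -/
lemma IsPerfectOn.finite_tot (h : IsPerfectOn Z X) : Module.Finite Q (Tot X) := by
  obtain ⟨a, b, hab⟩ := h.bounded
  have hfin := h.finite
  let F : ((i : Finset.Icc a b) → (X.X i).V) →ₗ[Q] Tot X :=
    ∑ i : Finset.Icc a b, homog X i ∘ₗ LinearMap.proj i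
  refine Module.Finite.of_surjective F fun t => ?_
  induction t using DirectSum.induction_on with
  | zero => exact ⟨0, map_zero F⟩
  | of i x =>
    by_cases hi : i ∈ Finset.Icc a b
    · refine ⟨Pi.single ⟨i, hi⟩ x, ?_⟩
      simp only [F, LinearMap.sum_apply, LinearMap.comp_apply, LinearMap.proj_apply]
      rw [Finset.sum_eq_single ⟨i, hi⟩]
      · rw [Pi.single_eq_same]; rfl
      · intro j _ hj
        rw [Pi.single_eq_of_ne hj, map_zero]
      · simp
    · have := hab i (by rw [Finset.mem_Icc] at hi; omega)
      refine ⟨0, ?_⟩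
      rw [Subsingleton.elim x 0, map_zero, map_zero]
  | add x y hx hy =>
    obtain ⟨x', rfl⟩ := hx
    obtain ⟨y', rfl⟩ := hy
    exact ⟨x' + y', map_add F _ _⟩

lemma IsPerfectOn.projective_tot (h : IsPerfectOn Z X) : Module.Projective Q (Tot X) := by
  have := h.projective
  infer_instance

/-! ### A criterion for perfection of a complex cut out of a graded module -/

section OfGraded

variable {V : Type u} [AddCommGroup V] [Module Q V] {ρ : Representation Q H V} {d : V →ₗ[Q] V}
  {P : ℤ → Submodule Q V} {hρ : ∀ h m, ∀ x ∈ P m, ρ h x ∈ P m}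
  {hd : ∀ m, ∀ x ∈ P m, d x ∈ P (m - 1)} {hdd : ∀ x, d (d x) = 0}
  {hdρ : ∀ h x, d (ρ h x) = ρ h (d x)}

lemma ofGraded_d {i j : ℤ} (h : j + 1 = i) (x : P i) :
    (P j).subtype (((ofGraded ρ d P hρ hd hdd hdρ).d i j).hom x) = d x :=
  congrArg (fun φ : (ofGraded ρ d P hρ hd hdd hdρ).X i ⟶ (ofGraded ρ d P hρ hd hdd hdρ).X j =>
    (P j).subtype (φ.hom x)) (dif_pos h)

/-- Each `P m` is a retract of the finite projective module `V`. A homotopy for a scalar `s` outside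
`p` gives `s • x = d (h x)` on cycles, hence exactness at `p`. -/
lemma isPerfectOn_ofGraded [Module.Finite Q V] [Module.Projective Q V] (π : ∀ m, V →ₗ[Q] P m)
    (hπ : ∀ m (x : P m), π m x = x) (hb : ∃ a b : ℤ, ∀ m, m < a ∨ b < m → ∀ x ∈ P m, x = 0)
    (hh : ∀ p ∉ Z, ∃ s ∉ p.asIdeal, ∃ h : V →ₗ[Q] V, (∀ m, ∀ x ∈ P m, h x ∈ P (m + 1)) ∧
      ∀ x, d (h x) + h (d x) = s • x) : IsPerfectOn Z (ofGraded ρ d P hρ hd hdd hdρ) := by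
  refine ⟨?_, fun i => ?_, fun i => ?_, (support_homology_iff Z).2 ?_⟩
  · obtain ⟨a, b, hab⟩ := hb
    exact ⟨a, b, fun i hi => ⟨fun x y => Subtype.ext
      ((hab i hi x.1 x.2).trans (hab i hi y.1 y.2).symm)⟩⟩
  · exact Module.Finite.of_surjective (π i) fun x => ⟨(P i).subtype x, hπ i x⟩
  · exact Module.Projective.of_split (P i).subtype (π i) (LinearMap.ext (hπ i))
  · intro p hp i (x : P i) hx
    obtain ⟨s, hs, h, hh, hs'⟩ := hh p hp
    have hx' : d x = 0 := by
      rw [← ofGraded_d (hρ := hρ) (hd := hd) (hdd := hdd) (hdρ := hdρ) (by omega : i - 1 + 1 = i)]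
      exact congrArg Subtype.val hx
    refine ⟨s, hs, (⟨h x, hh i x x.2⟩ : P (i + 1)), Subtype.ext ?_⟩
    refine Eq.trans ?_ (ofGraded_d rfl _).symm
    change s • (x : V) = _
    rw [← hs', hx', map_zero, add_zero]

end OfGraded

end Finiteness

/-! ### Tensor powers of perfect complexes -/

section TensorPower

variable {Q : Type u} [CommRing Q] {G : Type u} [Group G]
  (X : ChainComplex (Rep.{u} Q G) ℤ) (n : ℕ)

/-- The inclusion of the part of degree `m` into the total space of the tensor power. -/
def powLof (m : ℤ) : powDeg X n m →ₗ[Q] Tot (tensorPower X n) := homog (tensorPower X n) m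

/-- The decomposition of a tensor into its homogeneous parts. -/
def powDec : TotPow X n →ₗ[Q] Tot (tensorPower X n) :=
  PiTensorProduct.lift (MultilinearMap.fromDFinsuppEquiv (fun _ => ℤ) Q fun p =>
    (powLof X n (∑ k, p k)).compMultilinearMap
      (((PiTensorProduct.tprod Q).compLinearMap fun k => homog X (p k)).codRestrict
        (powDeg X n (∑ k, p k)) fun x => Submodule.subset_span ⟨p, x, rfl, rfl⟩))

/-- The sum of the homogeneous parts. -/
def powSum : Tot (tensorPower X n) →ₗ[Q] TotPow X n :=
  DirectSum.toModule Q ℤ _ fun m => (powDeg X n m).subtype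

variable {X n}

lemma powSum_powLof (m : ℤ) (t : powDeg X n m) : powSum X n (powLof X n m t) = t :=
  DirectSum.toModule_lof ..

lemma powDec_tprod (f : Fin n → ℤ) (x : ∀ k, (X.X (f k)).V) :
    powDec X n (PiTensorProduct.tprod Q fun k => homog X (f k) (x k)) =
      powLof X n (∑ k, f k) ⟨PiTensorProduct.tprod Q fun k => homog X (f k) (x k),
        Submodule.subset_span ⟨f, x, rfl, rfl⟩⟩ := by
  unfold powDec
  rw [PiTensorProduct.lift.tprod]
  exact MultilinearMap.fromDFinsuppEquiv_single ..

/-- With `powSum_powDec` this shows that the tensor power is the internal direct sum of its parts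
`powDeg`, so that each of them is a direct summand. -/
lemma powDec_coe (m : ℤ) (t : powDeg X n m) : powDec X n t = powLof X n m t := by
  obtain ⟨t, ht⟩ := t
  induction ht using Submodule.span_induction with
  | mem t ht =>
    obtain ⟨f, x, rfl, rfl⟩ := ht
    exact powDec_tprod f x
  | zero =>
    refine (map_zero _).trans (map_zero _).symm
  | add a b ha hb h1 h2 =>
    refine (map_add _ _ _).trans ((congrArg₂ _ h1 h2).trans (map_add _ _ _).symm)
  | smul r a ha h =>
    refine (map_smul _ _ _).trans ((congrArg _ h).trans (map_smul _ _ _).symm)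

lemma powSum_powDec (t : TotPow X n) : powSum X n (powDec X n t) = t := by
  have : powSum X n ∘ₗ powDec X n = LinearMap.id := by
    apply totPow_ext
    intro f x
    rw [LinearMap.comp_apply, powDec_tprod, powSum_powLof]
    rfl
  exact LinearMap.congr_fun this t

lemma powDec_powSum (t : Tot (tensorPower X n)) : powDec X n (powSum X n t) = t := by
  have : powDec X n ∘ₗ powSum X n = LinearMap.id := by
    apply DirectSum.linearMap_ext
    intro m
    refine LinearMap.ext fun x => ?_
    exact (congrArg (powDec X n) (powSum_powLof m x)).trans (powDec_coe m x)
  exact LinearMap.congr_fun this t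

/-- The homotopy acts on the first factor. The summand of the differential on that factor yields
`s`; every other summand applies the grading involution there, which anticommutes with `h`, so its
two contributions cancel. -/
lemma powDAt_contraction {h : Tot X →ₗ[Q] Tot X} (hh : RaisesDegree h) {s : Q}
    (hs : ∀ t, totD X (h t) + h (totD X t) = s • t) (t : TotPow X (n + 1)) :
    powD X (n + 1) (PiTensorProduct.map (fun j => if j = 0 then h else LinearMap.id) t) +
      PiTensorProduct.map (fun j => if j = 0 then h else LinearMap.id) (powD X (n + 1) t) =
        s • t := by
  have key : powD X (n + 1) ∘ₗ PiTensorProduct.map (fun j => if j = 0 then h else LinearMap.id) +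
      PiTensorProduct.map (fun j => if j = 0 then h else LinearMap.id) ∘ₗ powD X (n + 1) =
        s • LinearMap.id := by
    refine PiTensorProduct.ext (MultilinearMap.ext fun x => ?_)
    simp only [LinearMap.compMultilinearMap_apply, LinearMap.add_apply, LinearMap.comp_apply,
      PiTensorProduct.map_tprod, LinearMap.smul_apply, LinearMap.id_apply, powD,
      LinearMap.sum_apply, map_sum, powDAt]
    rw [← Finset.sum_add_distrib, Fin.sum_univ_succ, Finset.sum_eq_zero, add_zero]
    · have h1 : (fun j => (if j < 0 then totSgn X else if j = 0 then totD X else LinearMap.id)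
          ((if j = 0 then h else LinearMap.id) (x j))) =
          Function.update x 0 (totD X (h (x 0))) := by
        funext j
        rcases eq_or_ne j 0 with rfl | hj
        · simp
        · simp [hj]
      have h2 : (fun j => (if j = 0 then h else LinearMap.id)
          ((if j < 0 then totSgn X else if j = 0 then totD X else LinearMap.id) (x j))) =
          Function.update x 0 (h (totD X (x 0))) := by
        funext j
        rcases eq_or_ne j 0 with rfl | hj
        · simp
        · simp [hj]
      rw [h1, h2, ← MultilinearMap.map_update_add, hs, MultilinearMap.map_update_smul,
        Function.update_eq_self]
    · intro k _
      let w : Fin (n + 1) → Tot X := fun j => (if j = 0 then h else LinearMap.id)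
        ((if j < k.succ then totSgn X else if j = k.succ then totD X else LinearMap.id) (x j))
      have h1 : (fun j => (if j < k.succ then totSgn X else if j = k.succ then totD X else
          LinearMap.id) ((if j = 0 then h else LinearMap.id) (x j))) =
          Function.update w 0 ((-1 : Q) • w 0) := by
        funext j
        rcases eq_or_ne j 0 with rfl | hj
        · simp [w, totSgn_of_raisesDegree hh]
        · simp [hj, w]
      rw [h1, MultilinearMap.map_update_smul, Function.update_eq_self, neg_one_smul,
        neg_add_cancel]
  exact LinearMap.congr_fun key t

lemma map_raisesDegree_mem {h : Tot X →ₗ[Q] Tot X} (hh : RaisesDegree h) (m : ℤ) :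
    ∀ t ∈ powDeg X (n + 1) m, PiTensorProduct.map
      (fun j => if j = 0 then h else LinearMap.id) t ∈ powDeg X (n + 1) (m + 1) := by
  intro t ht
  induction ht using Submodule.span_induction with
  | mem t ht =>
    obtain ⟨f, x, hf, rfl⟩ := ht
    have : ∀ j, ∃ y : (X.X (Function.update f 0 (f 0 + 1) j)).V,
        (if j = 0 then h else LinearMap.id) (homog X (f j) (x j)) =
          homog X (Function.update f 0 (f 0 + 1) j) y := by
      intro j
      by_cases hj : j = 0
      · subst hj
        rw [Function.update_self, if_pos rfl]
        exact hh _ _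
      · rw [Function.update_of_ne hj, if_neg hj]
        exact ⟨_, rfl⟩
    choose y hy using this
    refine Submodule.subset_span ⟨_, y, ?_, ?_⟩
    · rw [Finset.sum_update_of_mem (Finset.mem_univ _), ← hf,
        ← Finset.add_sum_erase _ _ (Finset.mem_univ 0), Finset.sdiff_singleton_eq_erase]
      ring
    · rw [PiTensorProduct.map_tprod]
      simp only [hy]
  | zero => simp
  | add a b _ _ ha hb => rw [map_add]; exact add_mem ha hb
  | smul r a _ ha => rw [map_smul]; exact Submodule.smul_mem _ _ ha

/-- A total degree outside `[n * a, n * b]` forces some factor to have its degree outside `[a, b]`.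
-/
lemma powDeg_eq_zero {a b : ℤ} (hab : ∀ i, i < a ∨ b < i → Subsingleton (X.X i).V) {m : ℤ}
    (hm : m < n * a ∨ n * b < m) : ∀ t ∈ powDeg X n m, t = 0 := by
  intro t ht
  induction ht using Submodule.span_induction with
  | mem t ht =>
    obtain ⟨f, x, hf, rfl⟩ := ht
    obtain ⟨k, hk⟩ : ∃ k, f k < a ∨ b < f k := by
      by_contra! hcon
      have h1 : ∑ _k : Fin n, a ≤ ∑ k, f k := Finset.sum_le_sum fun k _ => (hcon k).1
      have h2 : ∑ k, f k ≤ ∑ _k : Fin n, b := Finset.sum_le_sum fun k _ => (hcon k).2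
      simp only [Finset.sum_const, Finset.card_univ, Fintype.card_fin, nsmul_eq_mul] at h1 h2
      omega
    have := hab _ hk
    refine MultilinearMap.map_coord_zero _ k ?_
    rw [Subsingleton.elim (x k) 0, map_zero]
  | zero => rfl
  | add a b _ _ ha hb => rw [ha, hb, add_zero]
  | smul r a _ ha => rw [ha, smul_zero]

/-- The support of the homology of a tensor power. -/
def powSupport (Z : Set (PrimeSpectrum Q)) (n : ℕ) : Set (PrimeSpectrum Q) :=
  if n = 0 then Set.univ else Z

lemma powSupport_of_pos {Z : Set (PrimeSpectrum Q)} (hn : 1 ≤ n) : powSupport Z n = Z :=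
  if_neg (by omega)

/-- At a prime outside `Z` the contraction of `X` is applied to the first factor. With no factors
there is nothing to contract, hence the whole spectrum in `powSupport` for `n = 0`. -/
theorem IsPerfectOn.tensorPower [IsNoetherianRing Q] {Z : Set (PrimeSpectrum Q)}
    (hX : IsPerfectOn Z X) : IsPerfectOn (powSupport Z n) (tensorPower X n) := by
  have := hX.finite_tot
  have := hX.projective_tot
  refine isPerfectOn_ofGraded
    (fun m => comp (PowerOp.tensorPower X n) m ∘ₗ powDec X n) (fun m t => ?_) ?_ ?_
  · exact (congrArg (comp (PowerOp.tensorPower X n) m) (powDec_coe m t)).trans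
      (comp_homog (X := PowerOp.tensorPower X n) m t)
  · obtain ⟨a, b, hab⟩ := hX.bounded
    exact ⟨n * a, n * b, fun m hm => powDeg_eq_zero hab hm⟩
  · intro p hp
    obtain _ | n := n
    · exact absurd (Set.mem_univ p) hp
    obtain ⟨s, hs, h, hh, hs'⟩ := hX.exists_isContractedBy (p := p) hp
    exact ⟨s, hs, _, map_raisesDegree_mem hh, powDAt_contraction hh hs'⟩

end TensorPower

/-! ### Tensor products of perfect complexes -/

section Tensor

variable {Q : Type u} [CommRing Q] {H : Type u} [Group H]
  (X Y : ChainComplex (Rep.{u} Q H) ℤ)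

/-- The inclusion of the part of degree `m` into the total space of the tensor product. -/
def tensorLof (m : ℤ) : tensorDeg X Y m →ₗ[Q] Tot (tensorComplex X Y) :=
  homog (tensorComplex X Y) m

/-- The decomposition of a tensor into its homogeneous parts. -/
def tensorDec : Tot X ⊗[Q] Tot Y →ₗ[Q] Tot (tensorComplex X Y) :=
  DirectSum.toModule Q (ℤ × ℤ) _ (fun ij => tensorLof X Y (ij.1 + ij.2) ∘ₗ
    (TensorProduct.map (homog X ij.1) (homog Y ij.2)).codRestrict (tensorDeg X Y (ij.1 + ij.2))
      fun t => by
        induction t using TensorProduct.induction_on with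
        | zero => simp
        | tmul x y => exact Submodule.subset_span ⟨_, _, x, y, rfl, rfl⟩
        | add a b ha hb => rw [map_add]; exact add_mem ha hb) ∘ₗ
  (TensorProduct.directSum Q Q (fun i => (X.X i).V) (fun j => (Y.X j).V)).toLinearMap

variable {X Y}

lemma tensorDec_tmul (i j : ℤ) (x : (X.X i).V) (y : (Y.X j).V) :
    tensorDec X Y (homog X i x ⊗ₜ homog Y j y) = tensorLof X Y (i + j)
      ⟨homog X i x ⊗ₜ homog Y j y, Submodule.subset_span ⟨_, _, x, y, rfl, rfl⟩⟩ := by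
  unfold tensorDec
  rw [LinearMap.comp_apply, LinearEquiv.coe_coe]
  refine (congrArg _ (TensorProduct.directSum_lof_tmul_lof ..)).trans ?_
  exact DirectSum.toModule_lof ..

lemma tensorDec_coe (m : ℤ) (t : tensorDeg X Y m) : tensorDec X Y t = tensorLof X Y m t := by
  obtain ⟨t, ht⟩ := t
  induction ht using Submodule.span_induction with
  | mem t ht =>
    obtain ⟨i, j, x, y, rfl, rfl⟩ := ht
    exact tensorDec_tmul i j x y
  | zero =>
    refine (map_zero _).trans (map_zero _).symm
  | add a b ha hb h1 h2 =>
    refine (map_add _ _ _).trans ((congrArg₂ _ h1 h2).trans (map_add _ _ _).symm)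
  | smul r a ha h =>
    refine (map_smul _ _ _).trans ((congrArg _ h).trans (map_smul _ _ _).symm)

/-- A prime outside `Z` misses one of the two supports, and a homotopy `h` on that factor is enough:
`h ⊗ 1` on the first, or `ε ⊗ h` on the second, with `ε` the grading involution. -/
theorem IsPerfectOn.tensor [IsNoetherianRing Q] {Z Z₁ Z₂ : Set (PrimeSpectrum Q)}
    (hX : IsPerfectOn Z₁ X) (hY : IsPerfectOn Z₂ Y) (hZ : Z₁ ∩ Z₂ ⊆ Z) :
    IsPerfectOn Z (tensorComplex X Y) := by
  have := hX.finite_tot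
  have := hX.projective_tot
  have := hY.finite_tot
  have := hY.projective_tot
  refine isPerfectOn_ofGraded
    (fun m => comp (tensorComplex X Y) m ∘ₗ tensorDec X Y) (fun m t => ?_) ?_ ?_
  · exact (congrArg (comp (tensorComplex X Y) m) (tensorDec_coe m t)).trans
      (comp_homog (X := tensorComplex X Y) m t)
  · obtain ⟨a, b, hab⟩ := hX.bounded
    obtain ⟨a', b', hab'⟩ := hY.bounded
    refine ⟨a + a', b + b', fun m hm t ht => ?_⟩
    induction ht using Submodule.span_induction with
    | mem t ht =>
      obtain ⟨i, j, x, y, hij, rfl⟩ := ht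
      rcases em (i < a ∨ b < i) with hi | hi
      · have := hab i hi
        rw [Subsingleton.elim x 0, map_zero, TensorProduct.zero_tmul]
      · have := hab' j (by omega)
        rw [Subsingleton.elim y 0, map_zero, TensorProduct.tmul_zero]
    | zero => rfl
    | add a b _ _ ha hb => rw [ha, hb, add_zero]
    | smul r a _ ha => rw [ha, smul_zero]
  · intro p hp
    rcases em (p ∈ Z₁) with hp1 | hp1
    · have hp2 : p ∉ Z₂ := fun h => hp (hZ ⟨hp1, h⟩)
      obtain ⟨s, hs, h, hh, hs'⟩ := hY.exists_isContractedBy hp2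
      refine ⟨s, hs, TensorProduct.map (totSgn X) h, fun m t ht => ?_, fun t => ?_⟩
      · induction ht using Submodule.span_induction with
        | mem t ht =>
          obtain ⟨i, j, x, y, hij, rfl⟩ := ht
          obtain ⟨z, hz⟩ := hh j y
          rw [TensorProduct.map_tmul, totSgn_homog, hz]
          exact Submodule.subset_span ⟨_, _, _, _, by omega, rfl⟩
        | zero => simp
        | add a b _ _ ha hb => rw [map_add]; exact add_mem ha hb
        | smul r a _ ha => rw [map_smul]; exact Submodule.smul_mem _ _ ha
      · induction t using TensorProduct.induction_on with
        | zero => simp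
        | add a b ha hb => rw [map_add, map_add, map_add, map_add, smul_add, ← ha, ← hb]; abel
        | tmul x y =>
          simp only [tensorD, LinearMap.add_apply, TensorProduct.map_tmul, LinearMap.id_apply,
            map_add, totD_totSgn, totSgn_totSgn, TensorProduct.neg_tmul]
          rw [← TensorProduct.tmul_smul, ← hs', TensorProduct.tmul_add]
          abel
    · obtain ⟨s, hs, h, hh, hs'⟩ := hX.exists_isContractedBy hp1
      refine ⟨s, hs, TensorProduct.map h LinearMap.id, fun m t ht => ?_, fun t => ?_⟩
      · induction ht using Submodule.span_induction with
        | mem t ht =>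
          obtain ⟨i, j, x, y, hij, rfl⟩ := ht
          obtain ⟨z, hz⟩ := hh i x
          rw [TensorProduct.map_tmul, hz]
          exact Submodule.subset_span ⟨_, _, z, y, by omega, rfl⟩
        | zero => simp
        | add a b _ _ ha hb => rw [map_add]; exact add_mem ha hb
        | smul r a _ ha => rw [map_smul]; exact Submodule.smul_mem _ _ ha
      · induction t using TensorProduct.induction_on with
        | zero => simp
        | add a b ha hb => rw [map_add, map_add, map_add, map_add, smul_add, ← ha, ← hb]; abel
        | tmul x y =>
          simp only [tensorD, LinearMap.add_apply, TensorProduct.map_tmul, LinearMap.id_apply,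
            map_add, totSgn_of_raisesDegree hh, TensorProduct.neg_tmul]
          rw [TensorProduct.smul_tmul', ← hs', TensorProduct.add_tmul]
          abel

/-- The underlying modules and differentials do not change; exactness at primes avoids comparing
homology objects in two categories. -/
lemma IsPerfectOn.res {K : Type u} [Group K] {Z : Set (PrimeSpectrum Q)} (hX : IsPerfectOn Z X)
    (φ : K →* H) : IsPerfectOn Z (resComplex φ X) :=
  ⟨hX.bounded, hX.finite, hX.projective,
    (support_homology_iff Z).2 fun _ hp => hX.exactAt hp⟩

end Tensor

/-! ### Induction along an injective homomorphism of finite groups -/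

section IndV

open Representation

variable {Q : Type u} [CommRing Q] {H K : Type u} [Group H] [Group K] (φ : H →* K)
  {V W : Type u} [AddCommGroup V] [Module Q V] [AddCommGroup W] [Module Q W]
  (ρ : Representation Q H V) (τ : Representation Q H W)

open Classical in
/-- The endomorphism `ρ h` for `k = φ h`, and `0` if `k` is not in the range of `φ`. -/
def indCoeff (k : K) : V →ₗ[Q] V := if h : ∃ x, φ x = k then ρ h.choose else 0

variable {φ} in
lemma indCoeff_map (hφ : Function.Injective φ) (x : H) : indCoeff φ ρ (φ x) = ρ x := by
  have h : ∃ y, φ y = φ x := ⟨x, rfl⟩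
  rw [indCoeff, dif_pos h, hφ h.choose_spec]

lemma indCoeff_of_notMem {k : K} (hk : k ∉ φ.range) : indCoeff φ ρ k = 0 := by
  rw [indCoeff, dif_neg]
  rwa [MonoidHom.mem_range] at hk

variable {φ} in
lemma indCoeff_mul_map (hφ : Function.Injective φ) (k : K) (x : H) (v : V) :
    indCoeff φ ρ (k * φ x) v = indCoeff φ ρ k (ρ x v) := by
  by_cases hk : k ∈ φ.range
  · obtain ⟨y, rfl⟩ := hk
    rw [← map_mul, indCoeff_map ρ hφ, indCoeff_map ρ hφ, map_mul]
    rfl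
  · rw [indCoeff_of_notMem φ ρ hk, indCoeff_of_notMem]
    · rfl
    · rwa [Subgroup.mul_mem_cancel_right _ (MonoidHom.mem_range.2 ⟨x, rfl⟩)]

variable {φ} (hφ : Function.Injective φ)

/-- The coordinate of an induced representation at an element of the group. -/
def indEval (k : K) : IndV φ ρ →ₗ[Q] V :=
  Coinvariants.lift _ (TensorProduct.lift <|
    (Finsupp.lift _ _ _ fun k' => indCoeff φ ρ (k * k'⁻¹)) ∘ₗ
      (MonoidAlgebra.coeffLinearEquiv Q).toLinearMap) fun x => by
    ext k' v
    simp only [LinearMap.coe_comp, Function.comp_apply, MonoidAlgebra.lsingle_apply]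
    simp [ofMulAction_single, mul_inv_rev, ← mul_assoc, ← map_inv, indCoeff_mul_map ρ hφ]

lemma indEval_mk (k k' : K) (v : V) :
    indEval ρ hφ k (IndV.mk φ ρ k' v) = indCoeff φ ρ (k * k'⁻¹) v := by
  simp [indEval]

/-- The relation defining the coinvariants: an index matters only up to left multiplication by the
range of `φ`. -/
lemma indV_mk_map (x : H) (k : K) (v : V) :
    IndV.mk φ ρ (φ x * k) (ρ x v) = IndV.mk φ ρ k v :=
  (Coinvariants.mk_eq_iff _).2 (by
    simpa using! Coinvariants.sub_mem_ker
      (ρ := Representation.tprod ((leftRegular Q K).comp φ) ρ) x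
      (MonoidAlgebra.single k (1 : Q) ⊗ₜ[Q] v))

variable [Finite K]

/-- An induced representation is a direct sum of copies, one for each coset. -/
def indEquiv : IndV φ ρ ≃ₗ[Q] (K ⧸ φ.range → V) :=
  letI : Fintype (K ⧸ φ.range) := Fintype.ofFinite _
  -- As indices are identified under left multiplication, the inverses of representatives of left
  -- cosets provide the coordinates.
  LinearEquiv.ofLinearMap (LinearMap.pi fun c => indEval ρ hφ c.out⁻¹)
    (∑ c, IndV.mk φ ρ c.out⁻¹ ∘ₗ LinearMap.proj c)
    (by
      classical
      refine LinearMap.ext fun v => funext fun c => ?_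
      simp only [LinearMap.comp_apply, LinearMap.pi_apply, LinearMap.sum_apply, map_sum,
        LinearMap.proj_apply, LinearMap.id_apply]
      rw [Finset.sum_eq_single c]
      · refine (indEval_mk ρ hφ _ _ _).trans ?_
        rw [mul_inv_cancel, ← map_one φ, indCoeff_map ρ hφ, map_one]
        rfl
      · intro c' _ hc
        refine (indEval_mk ρ hφ _ _ _).trans ?_
        rw [inv_inv, indCoeff_of_notMem]
        · rfl
        · intro h
          apply hc
          rw [← QuotientGroup.out_eq' c, ← QuotientGroup.out_eq' c', eq_comm, QuotientGroup.eq]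
          simpa using h
      · simp)
    (by
      refine IndV.hom_ext _ _ fun k => LinearMap.ext fun v => ?_
      change (∑ c : K ⧸ φ.range, IndV.mk φ ρ c.out⁻¹ ∘ₗ LinearMap.proj c)
        (fun c => indEval ρ hφ c.out⁻¹ (IndV.mk φ ρ k v)) = IndV.mk φ ρ k v
      simp only [LinearMap.sum_apply]
      rw [Finset.sum_eq_single (QuotientGroup.mk k⁻¹ : K ⧸ φ.range)]
      · obtain ⟨x, hx⟩ : (QuotientGroup.mk k⁻¹ : K ⧸ φ.range).out⁻¹ * k⁻¹ ∈ φ.range := by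
          rw [← QuotientGroup.eq, QuotientGroup.out_eq']
        change IndV.mk φ ρ _ (indEval ρ hφ _ (IndV.mk φ ρ k v)) = _
        rw [indEval_mk, ← hx, indCoeff_map ρ hφ, ← indV_mk_map ρ x k v, hx,
          inv_mul_cancel_right]
      · intro c _ hc
        change IndV.mk φ ρ _ (indEval ρ hφ _ (IndV.mk φ ρ k v)) = _
        rw [indEval_mk, indCoeff_of_notMem]
        · exact map_zero _
        · intro h
          apply hc
          rw [← QuotientGroup.out_eq' c, QuotientGroup.eq]
          exact h
      · simp)

lemma eq_zero_of_indEval_eq_zero (x : IndV φ ρ) (h : ∀ k, indEval ρ hφ k x = 0) : x = 0 :=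
  (indEquiv ρ hφ).map_eq_zero_iff.1 (funext fun _ => h _)

end IndV

/-! ### Induced complexes -/

section IndComplex

open Representation

variable {Q : Type u} [CommRing Q] {H K : Type u} [Group H] [Group K] {φ : H →* K}

lemma indMap_mk {A B : Rep.{u} Q H} (f : A ⟶ B) (k : K) (v : A.V) :
    (Rep.indMap φ f).hom (IndV.mk φ A.ρ k v) = IndV.mk φ B.ρ k (f.hom v) := rfl

/-- Induced maps act coordinatewise, because equivariant maps commute with `indCoeff`; exactness and
support can therefore be checked on coordinates. -/
lemma indEval_indMap (hφ : Function.Injective φ) {A B : Rep.{u} Q H} (f : A ⟶ B) (k : K)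
    (x : IndV φ A.ρ) :
    indEval B.ρ hφ k ((Rep.indMap φ f).hom x) = f.hom (indEval A.ρ hφ k x) := by
  have : indEval B.ρ hφ k ∘ₗ (Rep.indMap φ f).hom.toLinearMap =
      f.hom.toLinearMap ∘ₗ indEval A.ρ hφ k := by
    refine IndV.hom_ext _ _ fun k' => LinearMap.ext fun v => ?_
    change indEval B.ρ hφ k ((Rep.indMap φ f).hom (IndV.mk φ A.ρ k' v)) =
      f.hom (indEval A.ρ hφ k (IndV.mk φ A.ρ k' v))
    rw [indMap_mk, indEval_mk, indEval_mk]
    by_cases hk : k * k'⁻¹ ∈ φ.range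
    · obtain ⟨y, hy⟩ := hk
      rw [← hy, indCoeff_map _ hφ, indCoeff_map _ hφ, Rep.hom_comm_apply]
    · rw [indCoeff_of_notMem _ _ hk, indCoeff_of_notMem _ _ hk]
      exact (map_zero f.hom).symm
  exact LinearMap.congr_fun this x

lemma indEquiv_indMap [Finite K] (hφ : Function.Injective φ) {A B : Rep.{u} Q H}
    (f : A ⟶ B) (x : IndV φ A.ρ) (c : K ⧸ φ.range) :
    indEquiv B.ρ hφ ((Rep.indMap φ f).hom x) c = f.hom (indEquiv A.ρ hφ x c) :=
  indEval_indMap hφ f _ x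

variable {X Y : ChainComplex (Rep.{u} Q H) ℤ} {Z : Set (PrimeSpectrum Q)}

/-- As a complex of modules, the induced complex is a finite power of `X`, with one copy for each
coset. -/
theorem IsPerfectOn.ind [Finite K] (hφ : Function.Injective φ) (hX : IsPerfectOn Z X) :
    IsPerfectOn Z (indComplex φ X) := by
  refine ⟨?_, fun i => ?_, fun i => ?_, (support_homology_iff Z).2 ?_⟩
  · obtain ⟨a, b, hab⟩ := hX.bounded
    refine ⟨a, b, fun i hi => ?_⟩
    have := hab i hi
    exact (indEquiv (X.X i).ρ hφ).toEquiv.subsingleton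
  · have := hX.finite i
    exact Module.Finite.equiv (indEquiv (X.X i).ρ hφ).symm
  · classical
    have := hX.projective i
    have : Fintype (K ⧸ φ.range) := Fintype.ofFinite _
    have : Module.Projective Q (K ⧸ φ.range → (X.X i).V) :=
      Module.Projective.of_equiv
        (DirectSum.linearEquivFunOnFintype Q (K ⧸ φ.range) fun _ => (X.X i).V)
    exact Module.Projective.of_equiv (indEquiv (X.X i).ρ hφ).symm
  · intro p hp i (x : IndV φ (X.X i).ρ) hx
    have hx' : ∀ c, (X.d i (i - 1)).hom (indEquiv _ hφ x c) = 0 := fun c => by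
      rw [← indEquiv_indMap]
      exact congrFun ((congrArg (indEquiv _ hφ) hx).trans (map_zero _)) c
    choose s hs y hy using fun c => hX.exactAt hp i _ (hx' c)
    have : Fintype (K ⧸ φ.range) := Fintype.ofFinite _
    classical
    -- The product of the scalars of all coordinates is a common one; coordinate `c` absorbs the
    -- remaining factors.
    refine ⟨∏ c, s c, fun h => ?_, (indEquiv _ hφ).symm fun c =>
      (∏ c' ∈ Finset.univ.erase c, s c') • y c, ?_⟩
    · obtain ⟨c, -, hc⟩ := (p.isPrime.prod_mem_iff).1 h
      exact hs c hc
    · apply (indEquiv (X.X i).ρ hφ).injective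
      funext c
      refine Eq.trans ?_ (indEquiv_indMap hφ (X.d (i + 1) i) _ c).symm
      rw [LinearEquiv.apply_symm_apply, map_smul, ← hy, smul_smul,
        Finset.prod_erase_mul _ _ (Finset.mem_univ c)]
      exact congrFun ((indEquiv (X.X i).ρ hφ).map_smul (∏ c, s c) x) c

lemma IsExtension.ind [Finite K] (hφ : Function.Injective φ)
    {X' X'' : ChainComplex (Rep.{u} Q H) ℤ} (h : IsExtension X' X X'') :
    IsExtension (indComplex φ X') (indComplex φ X) (indComplex φ X'') := by
  obtain ⟨f, g, w, hS⟩ := h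
  rw [shortExact_iff] at hS
  refine ⟨((Rep.indFunctor.{u} Q φ).mapHomologicalComplex _).map f,
    ((Rep.indFunctor.{u} Q φ).mapHomologicalComplex _).map g, ?_, ?_⟩
  · exact (((Rep.indFunctor.{u} Q φ).mapHomologicalComplex _).map_comp f g).symm.trans
      ((congrArg _ w).trans (Functor.map_zero _ _ _))
  refine (shortExact_iff _ _ _).2 fun i => ?_
  obtain ⟨h1, h2, h3⟩ := hS i
  refine ⟨?_, ?_, ?_⟩
  · rw [injective_iff_map_eq_zero]
    intro (x : IndV φ (X'.X i).ρ) hx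
    apply (indEquiv _ hφ).map_eq_zero_iff.1
    funext c
    apply h1
    rw [Pi.zero_apply, map_zero, ← indEquiv_indMap]
    exact congrFun ((congrArg (indEquiv _ hφ) hx).trans (map_zero _)) c
  · intro (y : IndV φ (X''.X i).ρ)
    choose x hx using fun c => h2 (indEquiv _ hφ y c)
    refine ⟨(indEquiv _ hφ).symm x, (indEquiv _ hφ).injective (funext fun c => ?_)⟩
    refine (indEquiv_indMap hφ (g.f i) _ c).trans ?_
    rw [LinearEquiv.apply_symm_apply, hx]
  · intro (y : IndV φ (X.X i).ρ) hy
    choose x hx using fun c => h3 (indEquiv _ hφ y c) (by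
      rw [← indEquiv_indMap]
      exact congrFun ((congrArg (indEquiv _ hφ) hy).trans (map_zero _)) c)
    refine ⟨(indEquiv _ hφ).symm x, (indEquiv _ hφ).injective (funext fun c => ?_)⟩
    refine (indEquiv_indMap hφ (f.f i) _ c).trans ?_
    rw [LinearEquiv.apply_symm_apply, hx]

lemma IsExtension.res {X' X X'' : ChainComplex (Rep.{u} Q K) ℤ} (h : IsExtension X' X X'')
    (φ : H →* K) : IsExtension (resComplex φ X') (resComplex φ X) (resComplex φ X'') := by
  obtain ⟨f, g, w, hS⟩ := h
  refine ⟨((Rep.resFunctor φ).mapHomologicalComplex _).map f,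
    ((Rep.resFunctor φ).mapHomologicalComplex _).map g, ?_, ?_⟩
  · exact (((Rep.resFunctor φ).mapHomologicalComplex _).map_comp f g).symm.trans
      ((congrArg _ w).trans (Functor.map_zero _ _ _))
  rw [shortExact_iff] at hS
  exact (shortExact_iff _ _ _).2 hS

/-! ### Maps out of an induced complex -/

section Desc

variable {A : Rep.{u} Q H} {B : Rep.{u} Q K} (μ : A ⟶ Rep.res φ B)

/-- The map out of an induced representation that extends a given one. -/
abbrev indDesc : Rep.ind φ A ⟶ B := (Rep.indResHomEquiv φ A B).symm μ

lemma indDesc_mk (k : K) (v : A.V) :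
    (indDesc μ).hom (IndV.mk φ A.ρ k v) = B.ρ k⁻¹ (μ.hom v) := by
  simp [indDesc, Rep.indResHomEquiv]

/-- By hypothesis `σ`, applied to the translate by `k` of the image of an element, returns the
coordinate of that element at `k`. An element of the kernel thus has only zero coordinates. -/
lemma indDesc_injective [Finite K] (hφ : Function.Injective φ) (σ : B.V →ₗ[Q] A.V)
    (hσ : ∀ k v, σ (B.ρ k (μ.hom v)) = indCoeff φ A.ρ k v) :
    Function.Injective (indDesc μ).hom := by
  rw [injective_iff_map_eq_zero]
  intro (x : IndV φ A.ρ) hx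
  refine eq_zero_of_indEval_eq_zero A.ρ hφ x fun k => ?_
  have : indEval A.ρ hφ k = σ ∘ₗ B.ρ k ∘ₗ (indDesc μ).hom.toLinearMap := by
    refine IndV.hom_ext _ _ fun k' => LinearMap.ext fun v => ?_
    change indEval A.ρ hφ k (IndV.mk φ A.ρ k' v) =
      σ (B.ρ k ((indDesc μ).hom (IndV.mk φ A.ρ k' v)))
    rw [indEval_mk, indDesc_mk, ← hσ, map_mul]
    rfl
  rw [this]
  change σ (B.ρ k ((indDesc μ).hom x)) = 0
  rw [hx, map_zero, map_zero]

end Desc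

end IndComplex

/-! ### Graded maps between total spaces -/

section TotMap

variable {Q : Type u} [CommRing Q] {H : Type u} [Group H]
  {X X' X'' Y W : ChainComplex (Rep.{u} Q H) ℤ}

/-- The map of total spaces given by linear maps in all degrees. -/
def totMap (φ : ∀ i, (X.X i).V →ₗ[Q] (Y.X i).V) : Tot X →ₗ[Q] Tot Y := DirectSum.lmap φ

@[simp] lemma totMap_homog (φ : ∀ i, (X.X i).V →ₗ[Q] (Y.X i).V) (i : ℤ) (x : (X.X i).V) :
    totMap φ (homog X i x) = homog Y i (φ i x) :=
  DirectSum.lmap_lof ..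

lemma totMap_totMap (φ : ∀ i, (X.X i).V →ₗ[Q] (Y.X i).V) (ψ : ∀ i, (Y.X i).V →ₗ[Q] (W.X i).V)
    (x : Tot X) : totMap ψ (totMap φ x) = totMap (fun i => ψ i ∘ₗ φ i) x := by
  have : totMap ψ ∘ₗ totMap φ = totMap (fun i => ψ i ∘ₗ φ i) := by
    apply DirectSum.linearMap_ext
    intro i
    ext1 x
    simp
  exact LinearMap.congr_fun this x

lemma totMap_id (x : Tot X) : totMap (fun _ => LinearMap.id) x = x := by
  have : totMap (fun _ => LinearMap.id) = (LinearMap.id : Tot X →ₗ[Q] Tot X) := by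
    apply DirectSum.linearMap_ext
    intro i
    ext1 x
    simp
  exact LinearMap.congr_fun this x

lemma totSgn_totMap (φ : ∀ i, (X.X i).V →ₗ[Q] (Y.X i).V) (x : Tot X) :
    totSgn Y (totMap φ x) = totMap φ (totSgn X x) := by
  have : totSgn Y ∘ₗ totMap φ = totMap φ ∘ₗ totSgn X := by
    apply DirectSum.linearMap_ext
    intro i
    ext1 x
    simp
  exact LinearMap.congr_fun this x

/-- The components of a chain map, as linear maps. -/
abbrev linMaps (f : X ⟶ Y) (i : ℤ) : (X.X i).V →ₗ[Q] (Y.X i).V := (f.f i).hom.toLinearMap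

lemma totD_totMap (f : X ⟶ Y) (x : Tot X) :
    totD Y (totMap (linMaps f) x) = totMap (linMaps f) (totD X x) := by
  have : totD Y ∘ₗ totMap (linMaps f) = totMap (linMaps f) ∘ₗ totD X := by
    apply DirectSum.linearMap_ext
    intro i
    ext1 x
    rw [LinearMap.comp_apply, LinearMap.comp_apply, LinearMap.comp_apply, LinearMap.comp_apply,
      totMap_homog, totD_homog, totD_homog, totMap_homog]
    exact congrArg _ (hom_d f i (i - 1) x).symm
  exact LinearMap.congr_fun this x

lemma totRho_totMap (f : X ⟶ Y) (h : H) (x : Tot X) :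
    totRho Y h (totMap (linMaps f) x) = totMap (linMaps f) (totRho X h x) := by
  have : totRho Y h ∘ₗ totMap (linMaps f) = totMap (linMaps f) ∘ₗ totRho X h := by
    apply DirectSum.linearMap_ext
    intro i
    ext1 x
    rw [LinearMap.comp_apply, LinearMap.comp_apply, LinearMap.comp_apply, LinearMap.comp_apply,
      totMap_homog, totRho_homog, totRho_homog, totMap_homog]
    exact congrArg _ (Rep.hom_comm_apply (f.f i) h x).symm
  exact LinearMap.congr_fun this x

/-- A splitting of a short exact sequence of complexes as a sequence of graded modules. -/
structure GradedSplitting (f : X' ⟶ X) (g : X ⟶ X'') where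
  /-- The retraction. -/
  r : ∀ i, (X.X i).V →ₗ[Q] (X'.X i).V
  /-- The section. -/
  s : ∀ i, (X''.X i).V →ₗ[Q] (X.X i).V
  r_f : ∀ i x, r i ((f.f i).hom x) = x
  g_f : ∀ i x, (g.f i).hom ((f.f i).hom x) = 0
  g_s : ∀ i x, (g.f i).hom (s i x) = x
  f_r_add : ∀ i x, (f.f i).hom (r i x) + s i ((g.f i).hom x) = x

/-- Projectivity of `X''` gives the section, and `x - s (g x)` pulls back along the injective `f` to
the retraction. Neither is asked to respect the differential or the action. -/
lemma nonempty_gradedSplitting (f : X' ⟶ X) (g : X ⟶ X'') (w : f ≫ g = 0)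
    (hS : (ShortComplex.mk f g w).ShortExact) (hX'' : ∀ i, Module.Projective Q (X''.X i).V) :
    Nonempty (GradedSplitting f g) := by
  rw [shortExact_iff] at hS
  have key : ∀ i, ∃ (r : (X.X i).V →ₗ[Q] (X'.X i).V) (s : (X''.X i).V →ₗ[Q] (X.X i).V),
      (∀ x, r ((f.f i).hom x) = x) ∧ (∀ x, (g.f i).hom ((f.f i).hom x) = 0) ∧
      (∀ x, (g.f i).hom (s x) = x) ∧
      (∀ x, (f.f i).hom (r x) + s ((g.f i).hom x) = x) := by
    intro i
    obtain ⟨h1, h2, h3⟩ := hS i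
    have hgf : ∀ x, (g.f i).hom ((f.f i).hom x) = 0 := fun x =>
      LinearMap.congr_fun (congrArg (fun φ => (φ.f i).hom.toLinearMap) w) x
    obtain ⟨s, hs⟩ := Module.projective_lifting_property (g.f i).hom.toLinearMap
      LinearMap.id h2
    have hs' : ∀ x, (g.f i).hom (s x) = x := LinearMap.congr_fun hs
    let F := LinearEquiv.ofInjective (f.f i).hom.toLinearMap h1
    let e : (X.X i).V →ₗ[Q] (f.f i).hom.toLinearMap.range :=
      (LinearMap.id - s ∘ₗ (g.f i).hom.toLinearMap).codRestrict _ fun x => by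
        obtain ⟨y, hy⟩ := h3 (x - s ((g.f i).hom x)) (by rw [map_sub, hs', sub_self])
        exact ⟨y, hy⟩
    have hr : ∀ x, (f.f i).hom ((F.symm.toLinearMap ∘ₗ e) x) = x - s ((g.f i).hom x) := fun x =>
      congrArg Subtype.val (F.apply_symm_apply (e x))
    refine ⟨F.symm.toLinearMap ∘ₗ e, s, fun x => h1 ?_, hgf, hs', fun x => ?_⟩
    · rw [hr, hgf, map_zero, sub_zero]
    · rw [hr, sub_add_cancel]
  choose r s h1 h2 h3 h4 using key
  exact ⟨⟨r, s, h1, h2, h3, h4⟩⟩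

namespace GradedSplitting

variable {f : X' ⟶ X} {g : X ⟶ X''}

lemma totMap_g_f (S : GradedSplitting f g) (x : Tot X') :
    totMap (linMaps g) (totMap (linMaps f) x) = 0 := by
  have : totMap (linMaps g) ∘ₗ totMap (linMaps f) = 0 := by
    apply DirectSum.linearMap_ext
    intro i
    ext1 x
    rw [LinearMap.comp_apply, LinearMap.comp_apply, totMap_homog, totMap_homog]
    exact (congrArg _ (S.g_f i x)).trans (map_zero _)
  exact LinearMap.congr_fun this x

variable (S : GradedSplitting f g)

lemma totMap_r_f (x : Tot X') : totMap S.r (totMap (linMaps f) x) = x := by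
  rw [totMap_totMap]
  have : (fun i => S.r i ∘ₗ linMaps f i) = fun _ => LinearMap.id :=
    funext fun i => LinearMap.ext (S.r_f i)
  rw [this, totMap_id]

lemma totMap_g_s (x : Tot X'') : totMap (linMaps g) (totMap S.s x) = x := by
  rw [totMap_totMap]
  have : (fun i => linMaps g i ∘ₗ S.s i) = fun _ => LinearMap.id :=
    funext fun i => LinearMap.ext (S.g_s i)
  rw [this, totMap_id]

lemma totMap_f_r_add (x : Tot X) :
    totMap (linMaps f) (totMap S.r x) + totMap S.s (totMap (linMaps g) x) = x := by
  have : totMap (linMaps f) ∘ₗ totMap S.r + totMap S.s ∘ₗ totMap (linMaps g) =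
      LinearMap.id := by
    apply DirectSum.linearMap_ext
    intro i
    ext1 x
    simp only [LinearMap.comp_apply, LinearMap.add_apply, totMap_homog]
    rw [← map_add]
    exact congrArg _ (S.f_r_add i x)
  exact LinearMap.congr_fun this x

end GradedSplitting

end TotMap

/-! ### Exactness of the tensor product -/

section OfGradedHom

variable {Q : Type u} [CommRing Q] {H : Type u} [Group H]
  {V : Type u} [AddCommGroup V] [Module Q V] {ρ : Representation Q H V} {d : V →ₗ[Q] V}
  {P : ℤ → Submodule Q V} {hρ : ∀ h m, ∀ x ∈ P m, ρ h x ∈ P m}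
  {hd : ∀ m, ∀ x ∈ P m, d x ∈ P (m - 1)} {hdd : ∀ x, d (d x) = 0}
  {hdρ : ∀ h x, d (ρ h x) = ρ h (d x)}
  {V' : Type u} [AddCommGroup V'] [Module Q V'] {ρ' : Representation Q H V'} {d' : V' →ₗ[Q] V'}
  {P' : ℤ → Submodule Q V'} {hρ' : ∀ h m, ∀ x ∈ P' m, ρ' h x ∈ P' m}
  {hd' : ∀ m, ∀ x ∈ P' m, d' x ∈ P' (m - 1)} {hdd' : ∀ x, d' (d' x) = 0}
  {hdρ' : ∀ h x, d' (ρ' h x) = ρ' h (d' x)}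

/-- The chain map given by a linear map that respects all the data. -/
def ofGradedHom (F : V →ₗ[Q] V') (hP : ∀ m, ∀ x ∈ P m, F x ∈ P' m)
    (hFρ : ∀ h x, F (ρ h x) = ρ' h (F x)) (hFd : ∀ x, F (d x) = d' (F x)) :
    ofGraded ρ d P hρ hd hdd hdρ ⟶ ofGraded ρ' d' P' hρ' hd' hdd' hdρ' where
  f m := Rep.ofHom ⟨F.restrict (p := P m) (q := P' m) (hP m), fun h => by
    refine LinearMap.ext fun x => Subtype.ext (hFρ h x)⟩
  comm' i j hij := by
    have h : j + 1 = i := hij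
    apply Rep.hom_ext
    apply Representation.IntertwiningMap.ext
    refine LinearMap.ext fun (x : P i) => Subtype.ext ?_
    refine (ofGraded_d h (F.restrict (hP i) x)).trans ?_
    exact (hFd x).symm.trans (congrArg F (ofGraded_d h x)).symm

end OfGradedHom

/-! ### Exactness in the first factor -/

section TensorExact

variable {Q : Type u} [CommRing Q] {H : Type u} [Group H]
  {X X' X'' : ChainComplex (Rep.{u} Q H) ℤ} (Y : ChainComplex (Rep.{u} Q H) ℤ)

lemma rTensor_totMap_mem (φ : ∀ i, (X.X i).V →ₗ[Q] (X'.X i).V) (m : ℤ) :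
    ∀ t ∈ tensorDeg X Y m, (totMap φ).rTensor (Tot Y) t ∈ tensorDeg X' Y m := by
  intro t ht
  induction ht using Submodule.span_induction with
  | mem t ht =>
    obtain ⟨i, j, x, y, hij, rfl⟩ := ht
    rw [LinearMap.rTensor_tmul, totMap_homog]
    exact Submodule.subset_span ⟨_, _, _, _, hij, rfl⟩
  | zero => simp
  | add a b _ _ ha hb => rw [map_add]; exact add_mem ha hb
  | smul r a _ ha => rw [map_smul]; exact Submodule.smul_mem _ _ ha

/-- The functoriality of the tensor product in the first factor. -/
def tensorMap (f : X ⟶ X') : tensorComplex X Y ⟶ tensorComplex X' Y :=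
  ofGradedHom ((totMap (linMaps f)).rTensor (Tot Y)) (rTensor_totMap_mem Y _)
    (fun h t => by
      induction t using TensorProduct.induction_on with
      | zero => simp
      | add a b ha hb => simp only [map_add, ha, hb]
      | tmul x y => simp [totRho_totMap])
    (fun t => by
      induction t using TensorProduct.induction_on with
      | zero => simp
      | add a b ha hb => simp only [map_add, ha, hb]
      | tmul x y => simp [tensorD, totD_totMap, totSgn_totMap])

/-- A graded splitting survives tensoring with any `Y`, so flatness of `Y` plays no role. -/
lemma IsExtension.tensor (h : IsExtension X' X X'')
    (hX'' : ∀ i, Module.Projective Q (X''.X i).V) :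
    IsExtension (tensorComplex X' Y) (tensorComplex X Y) (tensorComplex X'' Y) := by
  obtain ⟨f, g, w, hS⟩ := h
  obtain ⟨S⟩ := nonempty_gradedSplitting f g w hS hX''
  have hrf : ∀ t, (totMap S.r).rTensor (Tot Y) ((totMap (linMaps f)).rTensor (Tot Y) t) = t := by
    intro t
    induction t using TensorProduct.induction_on with
    | zero => simp
    | add a b ha hb => simp only [map_add, ha, hb]
    | tmul x y => simp [S.totMap_r_f]
  have hgf : ∀ t, (totMap (linMaps g)).rTensor (Tot Y)
      ((totMap (linMaps f)).rTensor (Tot Y) t) = 0 := by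
    intro t
    induction t using TensorProduct.induction_on with
    | zero => simp
    | add a b ha hb => simp only [map_add, ha, hb, add_zero]
    | tmul x y => simp [S.totMap_g_f]
  have hgs : ∀ t, (totMap (linMaps g)).rTensor (Tot Y) ((totMap S.s).rTensor (Tot Y) t) = t := by
    intro t
    induction t using TensorProduct.induction_on with
    | zero => simp
    | add a b ha hb => simp only [map_add, ha, hb]
    | tmul x y => simp [S.totMap_g_s]
  have hadd : ∀ t, (totMap (linMaps f)).rTensor (Tot Y) ((totMap S.r).rTensor (Tot Y) t) +
      (totMap S.s).rTensor (Tot Y) ((totMap (linMaps g)).rTensor (Tot Y) t) = t := by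
    intro t
    induction t using TensorProduct.induction_on with
    | zero => simp
    | add a b ha hb =>
      simp only [map_add]
      conv_rhs => rw [← ha, ← hb]
      abel
    | tmul x y => simp [← TensorProduct.add_tmul, S.totMap_f_r_add]
  refine ⟨tensorMap Y f, tensorMap Y g, ?_, ?_⟩
  · ext i : 1
    apply Rep.hom_ext
    apply Representation.IntertwiningMap.ext
    exact LinearMap.ext fun (x : tensorDeg X' Y i) => Subtype.ext (hgf x)
  · refine (shortExact_iff _ _ _).2 fun i => ⟨?_, ?_, ?_⟩
    · intro (x : tensorDeg X' Y i) (y : tensorDeg X' Y i) hxy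
      refine Subtype.ext ?_
      rw [← hrf x, ← hrf y]
      exact congrArg _ (congrArg Subtype.val hxy)
    · intro (y : tensorDeg X'' Y i)
      exact ⟨(⟨_, rTensor_totMap_mem Y S.s i y y.2⟩ : tensorDeg X Y i), Subtype.ext (hgs y)⟩
    · intro (y : tensorDeg X Y i) hy
      refine ⟨(⟨_, rTensor_totMap_mem Y S.r i y y.2⟩ : tensorDeg X' Y i), Subtype.ext ?_⟩
      refine Eq.trans ?_ (hadd y)
      have : (totMap (linMaps g)).rTensor (Tot Y) y.1 = 0 := congrArg Subtype.val hy
      rw [this, map_zero, add_zero]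
      rfl

end TensorExact

/-! ### The filtration of a tensor power given by a submodule -/

section Filtration

variable {Q : Type u} [CommRing Q] {V : Type u} [AddCommGroup V] [Module Q V]

/-- The span of the tensors with at least `j` factors in `R`. -/
def filt (R : Submodule Q V) (n j : ℕ) : Submodule Q (PiTensorProduct Q fun _ : Fin n => V) :=
  Submodule.span Q {t | ∃ (A : Finset (Fin n)) (x : Fin n → V), j ≤ A.card ∧ (∀ k ∈ A, x k ∈ R) ∧
    t = PiTensorProduct.tprod Q x}

variable {R : Submodule Q V} {n j : ℕ}

lemma tprod_mem_filt {A : Finset (Fin n)} {x : Fin n → V} (hA : j ≤ A.card)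
    (hx : ∀ k ∈ A, x k ∈ R) : PiTensorProduct.tprod Q x ∈ filt R n j :=
  Submodule.subset_span ⟨A, x, hA, hx, rfl⟩

lemma filt_antitone : Antitone (filt R n) := fun _ _ h =>
  Submodule.span_mono fun _ ⟨A, x, hA, hx, ht⟩ => ⟨A, x, h.trans hA, hx, ht⟩

lemma filt_zero : filt R n 0 = ⊤ := by
  rw [eq_top_iff, ← PiTensorProduct.span_tprod_eq_top, Submodule.span_le]
  rintro _ ⟨x, rfl⟩
  exact tprod_mem_filt (A := ∅) (by simp) (by simp)

lemma filt_eq_bot (h : n < j) : filt R n j = ⊥ := by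
  rw [filt, Submodule.span_eq_bot]
  rintro _ ⟨A, x, hA, -, -⟩
  have := A.card_le_univ
  rw [Fintype.card_fin] at this
  omega

lemma map_mem_filt (L : Fin n → V →ₗ[Q] V) (hL : ∀ k, ∀ x ∈ R, L k x ∈ R) :
    ∀ t ∈ filt R n j, PiTensorProduct.map L t ∈ filt R n j := by
  intro t ht
  induction ht using Submodule.span_induction with
  | mem t ht =>
    obtain ⟨A, x, hA, hx, rfl⟩ := ht
    rw [PiTensorProduct.map_tprod]
    exact tprod_mem_filt hA fun k hk => hL k _ (hx k hk)
  | zero => simp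
  | add a b _ _ ha hb => rw [map_add]; exact add_mem ha hb
  | smul r a _ ha => rw [map_smul]; exact Submodule.smul_mem _ _ ha

lemma reindex_mem_filt (σ : Equiv.Perm (Fin n)) :
    ∀ t ∈ filt R n j, PiTensorProduct.reindex Q (fun _ => V) σ t ∈ filt R n j := by
  intro t ht
  induction ht using Submodule.span_induction with
  | mem t ht =>
    obtain ⟨A, x, hA, hx, rfl⟩ := ht
    rw [PiTensorProduct.reindex_tprod]
    refine tprod_mem_filt (A := A.map σ.toEmbedding) (by simpa using hA) fun k hk => ?_
    obtain ⟨k', hk', rfl⟩ := Finset.mem_map.1 hk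
    simpa using hx k' hk'
  | zero => simp
  | add a b _ _ ha hb => rw [map_add]; exact add_mem ha hb
  | smul r a _ ha => rw [map_smul]; exact Submodule.smul_mem _ _ ha

/-- Two tensors whose factors agree modulo `R`, and of which `j` factors are equal and in `R`,
agree modulo the next step of the filtration. -/
lemma tprod_sub_tprod_mem_filt {A : Finset (Fin n)} {x y : Fin n → V} (hA : j ≤ A.card)
    (hx : ∀ k ∈ A, x k = y k) (hy : ∀ k ∈ A, y k ∈ R) (hxy : ∀ k, x k - y k ∈ R) :
    PiTensorProduct.tprod Q x - PiTensorProduct.tprod Q y ∈ filt R n (j + 1) := by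
  classical
  -- The factors outside `A` are exchanged one at a time; each exchange costs a tensor with the
  -- factor `x k - y k` in `R`, in addition to those at `A`.
  have key : ∀ B : Finset (Fin n), Disjoint A B →
      PiTensorProduct.tprod Q (B.piecewise x y) - PiTensorProduct.tprod Q y ∈
        filt R n (j + 1) := by
    intro B
    induction B using Finset.induction_on with
    | empty => simp
    | insert k B hk ih =>
      intro hB
      rw [Finset.disjoint_insert_right] at hB
      have h1 : PiTensorProduct.tprod Q ((insert k B).piecewise x y) =
          PiTensorProduct.tprod Q (B.piecewise x y) +
            PiTensorProduct.tprod Q (Function.update (B.piecewise x y) k (x k - y k)) := by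
        rw [Finset.piecewise_insert]
        have h2 : x k = B.piecewise x y k + (x k - y k) := by
          rw [Finset.piecewise_eq_of_notMem _ _ _ hk]
          abel
        conv_lhs => rw [h2]
        rw [MultilinearMap.map_update_add, Function.update_eq_self]
      rw [h1, add_sub_right_comm]
      refine add_mem (ih hB.2) (tprod_mem_filt (A := insert k A) ?_ fun l hl => ?_)
      · rw [Finset.card_insert_of_notMem hB.1]
        omega
      · rcases eq_or_ne l k with rfl | hlk
        · rw [Function.update_self]
          exact hxy l
        · have hlA := Finset.mem_of_mem_insert_of_ne hl hlk
          rw [Function.update_of_ne hlk,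
            Finset.piecewise_eq_of_notMem _ _ _ (Finset.disjoint_left.1 hB.2 hlA)]
          exact hy l hlA
  convert key Aᶜ disjoint_compl_right using 3
  funext k
  by_cases hk : k ∈ A
  · rw [Finset.piecewise_eq_of_notMem _ _ _ (by simpa using hk), hx k hk]
  · rw [Finset.piecewise_eq_of_mem _ _ _ (by simpa using hk)]

end Filtration

/-! ### Concatenation of tensors -/

section Concat

variable (Q : Type u) [CommRing Q] (V : Type u) [AddCommGroup V] [Module Q V] {n : ℕ}
  (i : Fin (n + 1))

/-- The concatenation of a tensor with `i` factors and one with `n - i` factors. -/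
def concat :
    (PiTensorProduct Q fun _ : Fin i => V) ⊗[Q] (PiTensorProduct Q fun _ : Fin (n - i) => V)
    ≃ₗ[Q] PiTensorProduct Q fun _ : Fin n => V :=
  PiTensorProduct.tmulEquiv Q V ≪≫ₗ PiTensorProduct.reindex Q (fun _ => V) (splitEquiv i)

variable {Q V} {i}

lemma concat_tprod (x : Fin i → V) (y : Fin (n - i) → V) :
    concat Q V i (PiTensorProduct.tprod Q x ⊗ₜ PiTensorProduct.tprod Q y) =
      PiTensorProduct.tprod Q fun k => Sum.elim x y ((splitEquiv i).symm k) := by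
  rw [concat, LinearEquiv.trans_apply, PiTensorProduct.tmulEquiv_apply,
    PiTensorProduct.reindex_tprod]

lemma concat_symm_tprod (x : Fin n → V) :
    (concat Q V i).symm (PiTensorProduct.tprod Q x) =
      (PiTensorProduct.tprod Q fun k => x (splitEquiv i (.inl k))) ⊗ₜ
        PiTensorProduct.tprod Q fun k => x (splitEquiv i (.inr k)) := by
  rw [LinearEquiv.symm_apply_eq, concat_tprod]
  congr 1
  funext k
  obtain ⟨l, rfl⟩ := (splitEquiv i).surjective k
  rw [Equiv.symm_apply_apply]
  cases l <;> rfl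

lemma map_concat (L : Fin n → V →ₗ[Q] V)
    (t : (PiTensorProduct Q fun _ : Fin i => V) ⊗[Q] (PiTensorProduct Q fun _ : Fin (n - i) => V)) :
    PiTensorProduct.map L (concat Q V i t) = concat Q V i (TensorProduct.map
      (PiTensorProduct.map fun k => L (splitEquiv i (.inl k)))
      (PiTensorProduct.map fun k => L (splitEquiv i (.inr k))) t) := by
  have : PiTensorProduct.map L ∘ₗ (concat Q V i).toLinearMap =
      (concat Q V i).toLinearMap ∘ₗ TensorProduct.map
        (PiTensorProduct.map fun k => L (splitEquiv i (.inl k)))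
        (PiTensorProduct.map fun k => L (splitEquiv i (.inr k))) := by
    refine TensorProduct.ext (PiTensorProduct.ext (MultilinearMap.ext fun x =>
      PiTensorProduct.ext (MultilinearMap.ext fun y => ?_)))
    change PiTensorProduct.map L (concat Q V i (PiTensorProduct.tprod Q x ⊗ₜ
      PiTensorProduct.tprod Q y)) = concat Q V i (TensorProduct.map
        (PiTensorProduct.map fun k => L (splitEquiv i (.inl k)))
        (PiTensorProduct.map fun k => L (splitEquiv i (.inr k)))
        (PiTensorProduct.tprod Q x ⊗ₜ PiTensorProduct.tprod Q y))
    rw [TensorProduct.map_tmul, PiTensorProduct.map_tprod, PiTensorProduct.map_tprod, concat_tprod,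
      concat_tprod, PiTensorProduct.map_tprod]
    congr 1
    funext k
    obtain ⟨l, rfl⟩ := (splitEquiv i).surjective k
    rw [Equiv.symm_apply_apply]
    cases l <;> rfl
  exact LinearMap.congr_fun this t

lemma splitEquiv_inl_val (k : Fin i) : (splitEquiv i (.inl k) : ℕ) = k := by
  simp [splitEquiv]

lemma splitEquiv_inr_val (k : Fin (n - i)) : (splitEquiv i (.inr k) : ℕ) = i + k := by
  simp [splitEquiv]

lemma splitEquiv_inl_lt_inl (k l : Fin i) :
    splitEquiv i (.inl k) < splitEquiv i (.inl l) ↔ k < l := by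
  rw [Fin.lt_def, Fin.lt_def, splitEquiv_inl_val, splitEquiv_inl_val]

lemma splitEquiv_inr_lt_inr (k l : Fin (n - i)) :
    splitEquiv i (.inr k) < splitEquiv i (.inr l) ↔ k < l := by
  rw [Fin.lt_def, Fin.lt_def, splitEquiv_inr_val, splitEquiv_inr_val]
  omega

lemma splitEquiv_inl_lt_inr (k : Fin i) (l : Fin (n - i)) :
    splitEquiv i (.inl k) < splitEquiv i (.inr l) := by
  rw [Fin.lt_def, splitEquiv_inl_val, splitEquiv_inr_val]
  omega

/-- Two tensors with equal first `i` factors, all in `R`, and the others congruent modulo `R`. -/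
lemma concat_sub_concat_mem_filt {R : Submodule Q V} {x : Fin i → V} {y y' : Fin (n - i) → V}
    (hx : ∀ k, x k ∈ R) (hy : ∀ k, y k - y' k ∈ R) :
    concat Q V i (PiTensorProduct.tprod Q x ⊗ₜ PiTensorProduct.tprod Q y) -
      concat Q V i (PiTensorProduct.tprod Q x ⊗ₜ PiTensorProduct.tprod Q y') ∈
        filt R n (i + 1) := by
  rw [concat_tprod, concat_tprod]
  refine tprod_sub_tprod_mem_filt
    (A := Finset.univ.map (Function.Embedding.inl.trans (splitEquiv i).toEmbedding))
    (by simp) ?_ ?_ ?_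
  · intro k hk
    obtain ⟨l, -, rfl⟩ := Finset.mem_map.1 hk
    simp
  · intro k hk
    obtain ⟨l, -, rfl⟩ := Finset.mem_map.1 hk
    simpa using hx l
  · intro k
    obtain ⟨l | l, rfl⟩ := (splitEquiv i).surjective k
    · simp
    · simpa using hy l

end Concat

/-! ### Young subgroups -/

section Young

variable {n : ℕ} {i : Fin (n + 1)}

lemma youngHom_inl (σ : Equiv.Perm (Fin i)) (τ : Equiv.Perm (Fin (n - i))) (k : Fin i) :
    youngHom i (σ, τ) (splitEquiv i (.inl k)) = splitEquiv i (.inl (σ k)) := by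
  simp [youngHom, Equiv.permCongr_apply, Equiv.permCongrHom]

lemma youngHom_inr (σ : Equiv.Perm (Fin i)) (τ : Equiv.Perm (Fin (n - i))) (k : Fin (n - i)) :
    youngHom i (σ, τ) (splitEquiv i (.inr k)) = splitEquiv i (.inr (τ k)) := by
  simp [youngHom, Equiv.permCongr_apply, Equiv.permCongrHom]

lemma youngHom_injective : Function.Injective (youngHom i) := by
  intro a b h
  have h' := fun k => Equiv.congr_fun h k
  refine Prod.ext (Equiv.ext fun k => ?_) (Equiv.ext fun k => ?_)
  · have := h' (splitEquiv i (.inl k))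
    rw [youngHom_inl, youngHom_inl] at this
    exact Sum.inl_injective ((splitEquiv i).injective this)
  · have := h' (splitEquiv i (.inr k))
    rw [youngHom_inr, youngHom_inr] at this
    exact Sum.inr_injective ((splitEquiv i).injective this)

/-- Otherwise `σ` would map the finite first block into itself, hence onto itself, and so preserve
both blocks. -/
lemma exists_inl_eq_inr {σ : Equiv.Perm (Fin n)} (hσ : σ ∉ (youngHom i).range) :
    ∃ k l, σ (splitEquiv i (.inl k)) = splitEquiv i (.inr l) := by
  by_contra! hcon
  apply hσ
  have h : Set.MapsTo ((splitEquiv i).symm.permCongr σ)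
      (Set.range Sum.inl) (Set.range Sum.inl) := by
    rintro _ ⟨k, rfl⟩
    rw [Equiv.permCongr_apply, Equiv.symm_symm]
    rcases hl : (splitEquiv i).symm (σ (splitEquiv i (.inl k))) with l | l
    · exact ⟨l, rfl⟩
    · rw [Equiv.symm_apply_eq] at hl
      exact absurd hl (hcon k l)
  obtain ⟨a, ha⟩ := Equiv.Perm.mem_sumCongrHom_range_of_perm_mapsTo_inl h
  refine ⟨a, ?_⟩
  change (splitEquiv i).permCongr (Equiv.Perm.sumCongrHom _ _ a) = σ
  rw [ha]
  ext
  simp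

/-- A bijection from the first block to `A` extends to all points; it serves to move chosen factors
to the front. -/
lemma exists_perm_of_card {A : Finset (Fin n)} (hA : A.card = i) :
    ∃ π : Equiv.Perm (Fin n), ∀ k, π (splitEquiv i (.inl k)) ∈ A := by
  let B : Finset (Fin n) :=
    Finset.univ.map (Function.Embedding.inl.trans (splitEquiv i).toEmbedding)
  have hB : B.card = A.card := by simp [B, hA]
  let e := Finset.equivOfCardEq hB
  refine ⟨Equiv.extendSubtype (p := fun x => x ∈ B) (q := fun x => x ∈ A) e, fun k => ?_⟩
  exact Equiv.extendSubtype_mem e _ (by simp [B])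

/-- A permutation preserving the blocks has no inversion between them. -/
lemma koszulSign_youngHom (σ : Equiv.Perm (Fin i)) (τ : Equiv.Perm (Fin (n - i)))
    (f : Fin n → ℤ) : koszulSign (youngHom i (σ, τ)) f =
      koszulSign σ (fun k => f (splitEquiv i (.inl k))) *
        koszulSign τ (fun k => f (splitEquiv i (.inr k))) := by
  unfold koszulSign
  rw [← Equiv.prod_comp (splitEquiv i), Fintype.prod_sum_type]
  congr 1
  · refine Finset.prod_congr rfl fun k _ => ?_
    rw [← Equiv.prod_comp (splitEquiv i), Fintype.prod_sum_type]
    simp [youngHom_inl, youngHom_inr, splitEquiv_inl_lt_inl, (splitEquiv_inl_lt_inr _ _).not_gt]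
  · refine Finset.prod_congr rfl fun k _ => ?_
    rw [← Equiv.prod_comp (splitEquiv i), Fintype.prod_sum_type]
    simp [youngHom_inl, youngHom_inr, splitEquiv_inr_lt_inr, (splitEquiv_inl_lt_inr _ _).not_gt]

end Young

/-! ### Quotients of graded complexes and induced complexes -/

section IndDesc

open Representation

variable {Q : Type u} [CommRing Q] {H K : Type u} [Group H] [Group K] {φ : H →* K}

/-- The chain map out of an induced complex that extends a given one. -/
def indDescComplex {A : ChainComplex (Rep.{u} Q H) ℤ} {B : ChainComplex (Rep.{u} Q K) ℤ}
    (ν : A ⟶ resComplex φ B) : indComplex φ A ⟶ B where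
  f m := indDesc (ν.f m)
  comm' i j _ := by
    apply Rep.hom_ext
    apply IntertwiningMap.ext
    refine IndV.hom_ext _ _ fun k => LinearMap.ext fun v => ?_
    refine (congrArg (B.d i j).hom (indDesc_mk (B := B.X i) (ν.f i) k v)).trans ?_
    refine Eq.trans ?_ (indDesc_mk (B := B.X j) (ν.f j) k ((A.d i j).hom v)).symm
    refine (Rep.hom_comm_apply (B.d i j) k⁻¹ _).trans ?_
    exact congrArg ((B.X j).ρ k⁻¹) (hom_d ν i j v).symm

variable {V : Type u} [AddCommGroup V] [Module Q V] {ρ : Representation Q H V} {d : V →ₗ[Q] V}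
  {P : ℤ → Submodule Q V} {hρ : ∀ h m, ∀ x ∈ P m, ρ h x ∈ P m}
  {hd : ∀ m, ∀ x ∈ P m, d x ∈ P (m - 1)} {hdd : ∀ x, d (d x) = 0}
  {hdρ : ∀ h x, d (ρ h x) = ρ h (d x)}
  {V' : Type u} [AddCommGroup V'] [Module Q V'] {ρ' : Representation Q K V'} {d' : V' →ₗ[Q] V'}
  {P' : ℤ → Submodule Q V'} {hρ' : ∀ h m, ∀ x ∈ P' m, ρ' h x ∈ P' m}
  {hd' : ∀ m, ∀ x ∈ P' m, d' x ∈ P' (m - 1)} {hdd' : ∀ x, d' (d' x) = 0}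
  {hdρ' : ∀ h x, d' (ρ' h x) = ρ' h (d' x)}

/-- The chain map to a restricted complex given by a linear map that respects all the data. -/
def ofGradedResHom (F : V →ₗ[Q] V') (hP : ∀ m, ∀ x ∈ P m, F x ∈ P' m)
    (hFρ : ∀ h x, F (ρ h x) = ρ' (φ h) (F x)) (hFd : ∀ x, F (d x) = d' (F x)) :
    ofGraded ρ d P hρ hd hdd hdρ ⟶ resComplex φ (ofGraded ρ' d' P' hρ' hd' hdd' hdρ') where
  f m := Rep.ofHom ⟨F.restrict (p := P m) (q := P' m) (hP m), fun h => by
    refine LinearMap.ext fun x => Subtype.ext (hFρ h x)⟩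
  comm' i j hij := by
    have h : j + 1 = i := hij
    apply Rep.hom_ext
    apply Representation.IntertwiningMap.ext
    refine LinearMap.ext fun (x : P i) => Subtype.ext ?_
    refine (ofGraded_d h (F.restrict (hP i) x)).trans ?_
    exact (hFd x).symm.trans (congrArg F (ofGraded_d h x)).symm

end IndDesc

/-! ### Quotients of a graded complex by invariant submodules -/

section Quotient

variable {Q : Type u} [CommRing Q] {K : Type u} [Group K]
  {V : Type u} [AddCommGroup V] [Module Q V] (ρ : Representation Q K V) (d : V →ₗ[Q] V)
  (P : ℤ → Submodule Q V) (hρ : ∀ h m, ∀ x ∈ P m, ρ h x ∈ P m)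
  (hd : ∀ m, ∀ x ∈ P m, d x ∈ P (m - 1)) (hdd : ∀ x, d (d x) = 0)
  (hdρ : ∀ h x, d (ρ h x) = ρ h (d x))

/-- The complex cut out of the quotient of a graded space by an invariant submodule. -/
def quotComplex (F : Submodule Q V) (hFρ : ∀ h, ∀ x ∈ F, ρ h x ∈ F) (hFd : ∀ x ∈ F, d x ∈ F) :
    ChainComplex (Rep.{u} Q K) ℤ :=
  ofGraded (ρ.quotient F hFρ) (F.mapQ F d hFd) (fun m => (P m).map F.mkQ)
    (by
      rintro h m _ ⟨x, hx, rfl⟩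
      exact ⟨ρ h x, hρ h m x hx, rfl⟩)
    (by
      rintro m _ ⟨x, hx, rfl⟩
      exact ⟨d x, hd m x hx, rfl⟩)
    (by
      intro x
      obtain ⟨x, rfl⟩ := F.mkQ_surjective x
      exact congrArg F.mkQ (hdd x))
    (by
      intro h x
      obtain ⟨x, rfl⟩ := F.mkQ_surjective x
      exact congrArg F.mkQ (hdρ h x))

variable {F F' : Submodule Q V} {hFρ : ∀ h, ∀ x ∈ F, ρ h x ∈ F} {hFd : ∀ x ∈ F, d x ∈ F}
  {hFρ' : ∀ h, ∀ x ∈ F', ρ h x ∈ F'} {hFd' : ∀ x ∈ F', d x ∈ F'}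

/-- The projection from the quotient by a submodule to the one by a larger submodule. -/
def quotProj (hF : F ≤ F') : quotComplex ρ d P hρ hd hdd hdρ F hFρ hFd ⟶
    quotComplex ρ d P hρ hd hdd hdρ F' hFρ' hFd' :=
  ofGradedHom (F.mapQ F' LinearMap.id hF)
    (by
      rintro m _ ⟨x, hx, rfl⟩
      exact ⟨x, hx, rfl⟩)
    (by
      intro h x
      obtain ⟨x, rfl⟩ := F.mkQ_surjective x
      rfl)
    (by
      intro x
      obtain ⟨x, rfl⟩ := F.mkQ_surjective x
      rfl)

/-- The projection to the complex cut out of a quotient. -/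
def toQuot : ofGraded ρ d P hρ hd hdd hdρ ⟶ quotComplex ρ d P hρ hd hdd hdρ F hFρ hFd :=
  ofGradedHom F.mkQ (fun _ x hx => ⟨x, hx, rfl⟩) (fun _ _ => rfl) (fun _ => rfl)

end Quotient

/-! ### A layer of an invariant filtration -/

section Layer

open Representation

variable {Q : Type u} [CommRing Q] {H K : Type u} [Group H] [Group K] {φ : H →* K}
  {W : Type u} [AddCommGroup W] [Module Q W] {ρ : Representation Q H W}
  {V : Type u} [AddCommGroup V] [Module Q V] {ρ' : Representation Q K V}
  {F F' : Submodule Q V} {μ : W →ₗ[Q] V} {ς : V →ₗ[Q] W}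

/-- An element of the span of the translates of the image of `μ` is the sum, over the cosets, of
its coordinates. -/
lemma sub_sum_coset_mem [Fintype (K ⧸ φ.range)] (hφ : Function.Injective φ)
    (hFρ : ∀ k, ∀ x ∈ F, ρ' k x ∈ F)
    (hςF : ∀ x ∈ F, ς x = 0) (hμρ : ∀ h x, μ (ρ h x) - ρ' (φ h) (μ x) ∈ F)
    (hςμ : ∀ k x, ς (ρ' k (μ x)) = indCoeff φ ρ k x)
    (hF' : F' ≤ F ⊔ ⨆ k, μ.range.map (ρ' k)) (x : V) (hx : x ∈ F') :
    x - ∑ c : K ⧸ φ.range, ρ' c.out (μ (ς (ρ' c.out⁻¹ x))) ∈ F := by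
  -- As the difference is linear in `x`, the claim may be checked on `F` and on each translate
  -- separately.
  let D : V →ₗ[Q] V := LinearMap.id -
    ∑ c : K ⧸ φ.range, ρ' c.out ∘ₗ μ ∘ₗ ς ∘ₗ ρ' c.out⁻¹
  have hD : ∀ x, D x = x - ∑ c : K ⧸ φ.range, ρ' c.out (μ (ς (ρ' c.out⁻¹ x))) := by
    intro x
    simp [D]
  suffices h : F' ≤ F.comap D by
    rw [← hD]
    exact h hx
  refine hF'.trans (sup_le ?_ (iSup_le fun k => ?_))
  · intro y hy
    have h0 : ∀ c : K ⧸ φ.range, ρ' c.out (μ (ς (ρ' c.out⁻¹ y))) = 0 := fun c => by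
      rw [hςF _ (hFρ _ _ hy), map_zero, map_zero]
    rw [Submodule.mem_comap, hD, Finset.sum_eq_zero fun c _ => h0 c, sub_zero]
    exact hy
  · rintro _ ⟨_, ⟨w, rfl⟩, rfl⟩
    -- On the translate by `k` only the coset of `k` contributes; it returns the element up to the
    -- failure of `μ` to be equivariant, which lies in `F`.
    rw [Submodule.mem_comap, hD, Finset.sum_eq_single (QuotientGroup.mk k : K ⧸ φ.range)]
    · obtain ⟨h, hh⟩ : (QuotientGroup.mk k : K ⧸ φ.range).out⁻¹ * k ∈ φ.range := by
        rw [← QuotientGroup.eq, QuotientGroup.out_eq']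
      generalize (QuotientGroup.mk k : K ⧸ φ.range).out = c at hh
      obtain rfl : k = c * φ h := by rw [hh, mul_inv_cancel_left]
      have h1 : ρ' c⁻¹ (ρ' (c * φ h) (μ w)) = ρ' (φ h) (μ w) := by
        rw [← Module.End.mul_apply, ← map_mul, inv_mul_cancel_left]
      rw [h1, hςμ, indCoeff_map ρ hφ, map_mul, Module.End.mul_apply, ← map_sub]
      refine hFρ _ _ ?_
      rw [← neg_sub]
      exact neg_mem (hμρ h w)
    · intro c _ hc
      have h1 : ρ' c.out⁻¹ (ρ' k (μ w)) = ρ' (c.out⁻¹ * k) (μ w) := by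
        rw [map_mul, Module.End.mul_apply]
      rw [h1, hςμ, indCoeff_of_notMem]
      · simp
      · intro h
        apply hc
        rw [← QuotientGroup.out_eq' c, QuotientGroup.eq]
        exact h
    · simp

variable {d : W →ₗ[Q] W}
  {P : ℤ → Submodule Q W} {hρ : ∀ h m, ∀ x ∈ P m, ρ h x ∈ P m}
  {hd : ∀ m, ∀ x ∈ P m, d x ∈ P (m - 1)} {hdd : ∀ x, d (d x) = 0}
  {hdρ : ∀ h x, d (ρ h x) = ρ h (d x)}
  {d' : V →ₗ[Q] V}
  {P' : ℤ → Submodule Q V} {hρ' : ∀ h m, ∀ x ∈ P' m, ρ' h x ∈ P' m}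
  {hd' : ∀ m, ∀ x ∈ P' m, d' x ∈ P' (m - 1)} {hdd' : ∀ x, d' (d' x) = 0}
  {hdρ' : ∀ h x, d' (ρ' h x) = ρ' h (d' x)}
  {hFρ : ∀ h, ∀ x ∈ F, ρ' h x ∈ F} {hFd : ∀ x ∈ F, d' x ∈ F}
  {hFρ' : ∀ h, ∀ x ∈ F', ρ' h x ∈ F'} {hFd' : ∀ x ∈ F', d' x ∈ F'}

lemma coe_indCoeff_ofGraded (hφ : Function.Injective φ) (m : ℤ) (k : K) (x : P m) :
    (P m).subtype (indCoeff φ ((ofGraded ρ d P hρ hd hdd hdρ).X m).ρ k x) = indCoeff φ ρ k x := by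
  by_cases hk : k ∈ φ.range
  · obtain ⟨h, rfl⟩ := hk
    refine (congrArg (fun L : P m →ₗ[Q] P m => (P m).subtype (L x))
      (indCoeff_map ((ofGraded ρ d P hρ hd hdd hdρ).X m).ρ hφ h)).trans ?_
    rw [indCoeff_map ρ hφ]
    rfl
  · refine (congrArg (fun L : P m →ₗ[Q] P m => (P m).subtype (L x))
      (indCoeff_of_notMem φ ((ofGraded ρ d P hρ hd hdd hdρ).X m).ρ hk)).trans ?_
    rw [indCoeff_of_notMem φ ρ hk]
    rfl

/-- A layer of an invariant filtration of a graded complex is an induced complex. -/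
theorem isExtension_ind_quotComplex [Finite K] (hφ : Function.Injective φ) (hF : F ≤ F')
    (hμP : ∀ m, ∀ x ∈ P m, μ x ∈ P' m) (hςP : ∀ m, ∀ x ∈ P' m, ς x ∈ P m)
    (hςF : ∀ x ∈ F, ς x = 0) (hμF : ∀ x, μ x ∈ F')
    (hμρ : ∀ h x, μ (ρ h x) - ρ' (φ h) (μ x) ∈ F) (hμd : ∀ x, μ (d x) - d' (μ x) ∈ F)
    (hςμ : ∀ k x, ς (ρ' k (μ x)) = indCoeff φ ρ k x)
    (hF' : F' ≤ F ⊔ ⨆ k, μ.range.map (ρ' k)) :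
    IsExtension (indComplex φ (ofGraded ρ d P hρ hd hdd hdρ))
      (quotComplex ρ' d' P' hρ' hd' hdd' hdρ' F hFρ hFd)
      (quotComplex ρ' d' P' hρ' hd' hdd' hdρ' F' hFρ' hFd') := by
  -- Since `μ` is equivariant and compatible with the differentials only modulo `F`, the chain map
  -- has to end in the quotient.
  let ν : ofGraded ρ d P hρ hd hdd hdρ ⟶
      resComplex φ (quotComplex ρ' d' P' hρ' hd' hdd' hdρ' F hFρ hFd) :=
    ofGradedResHom (F.mkQ ∘ₗ μ) (fun m x hx => ⟨μ x, hμP m x hx, rfl⟩)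
      (fun h x => (Submodule.Quotient.eq F).2 (hμρ h x))
      (fun x => (Submodule.Quotient.eq F).2 (hμd x))
  refine ⟨indDescComplex ν, quotProj _ _ _ _ _ _ _ hF, ?_, ?_⟩
  · ext m : 1
    apply Rep.hom_ext
    apply IntertwiningMap.ext
    refine IndV.hom_ext _ _ fun k => LinearMap.ext fun v => Subtype.ext ?_
    refine (congrArg (fun y => (((quotProj ρ' d' P' hρ' hd' hdd' hdρ' (hFρ := hFρ) (hFd := hFd)
      (hFρ' := hFρ') (hFd' := hFd') hF).f m).hom y).1) (indDesc_mk (B :=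
      (quotComplex ρ' d' P' hρ' hd' hdd' hdρ' F hFρ hFd).X m) (ν.f m) k v)).trans ?_
    exact (Submodule.Quotient.mk_eq_zero F').2 (hFρ' k⁻¹ _ (hμF _))
  · have : Fintype (K ⧸ φ.range) := Fintype.ofFinite _
    refine (shortExact_iff _ _ _).2 fun m => ⟨?_, ?_, ?_⟩
    -- The map `ς` vanishes on `F`, so it descends to the quotient and reads off coordinates there.
    · refine indDesc_injective (B := (quotComplex ρ' d' P' hρ' hd' hdd' hdρ' F hFρ hFd).X m)
        (ν.f m) hφ ((F.liftQ ς hςF).restrict (p := (P' m).map F.mkQ) (q := P m) ?_) ?_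
      · rintro _ ⟨x, hx, rfl⟩
        exact hςP m x hx
      · intro k v
        refine Subtype.ext ?_
        exact (hςμ k _).trans (coe_indCoeff_ofGraded hφ m k v).symm
    · rintro ⟨_, x, hx, rfl⟩
      exact ⟨⟨F.mkQ x, x, hx, rfl⟩, rfl⟩
    · rintro ⟨_, x, hx, rfl⟩ h0
      have hxF : x ∈ F' := (Submodule.Quotient.mk_eq_zero F').1 (congrArg Subtype.val h0)
      -- The coordinates of `x` from `sub_sum_coset_mem`; they stay in degree `m`, as `ς` and the
      -- action preserve degrees.
      let y : K ⧸ φ.range → P m := fun c => ⟨ς (ρ' c.out⁻¹ x), hςP m _ (hρ' _ m x hx)⟩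
      refine ⟨∑ c : K ⧸ φ.range, IndV.mk φ ((ofGraded ρ d P hρ hd hdd hdρ).X m).ρ c.out⁻¹ (y c),
        ?_⟩
      refine (map_sum _ _ _).trans ?_
      refine (Finset.sum_congr rfl fun c _ => indDesc_mk (B :=
        (quotComplex ρ' d' P' hρ' hd' hdd' hdρ' F hFρ hFd).X m) (ν.f m) c.out⁻¹ (y c)).trans ?_
      refine Subtype.ext ?_
      refine (map_sum ((P' m).map F.mkQ).subtype _ _).trans ?_
      have h1 := sub_sum_coset_mem hφ hFρ hςF hμρ hςμ hF' x hxF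
      refine Eq.trans ?_ ((Submodule.Quotient.eq F).2 h1).symm
      refine Eq.trans ?_ (map_sum F.mkQ _ _).symm
      refine Finset.sum_congr rfl fun c _ => ?_
      rw [inv_inv]
      rfl

end Layer

/-! ### The layers of the filtration of a tensor power -/

section Join

variable {Q : Type u} [CommRing Q] {V' V V'' : Type u} [AddCommGroup V'] [Module Q V']
  [AddCommGroup V] [Module Q V] [AddCommGroup V''] [Module Q V''] {n : ℕ}

/-- The map `(⨂ⁱ V') ⊗ (⨂ⁿ⁻ⁱ V'') → ⨂ⁿ V` given by maps `V' → V` and `V'' → V`. -/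
def joinMap (F : V' →ₗ[Q] V) (s : V'' →ₗ[Q] V) (i : Fin (n + 1)) :
    (PiTensorProduct Q fun _ : Fin i => V') ⊗[Q] (PiTensorProduct Q fun _ : Fin (n - i) => V'')
      →ₗ[Q] PiTensorProduct Q fun _ : Fin n => V :=
  (concat Q V i).toLinearMap ∘ₗ TensorProduct.map (PiTensorProduct.map fun _ => F)
    (PiTensorProduct.map fun _ => s)

/-- The map `⨂ⁿ V → (⨂ⁱ V') ⊗ (⨂ⁿ⁻ⁱ V'')` given by maps `V → V'` and `V → V''`. -/
def splitMap (r : V →ₗ[Q] V') (g : V →ₗ[Q] V'') (i : Fin (n + 1)) :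
    (PiTensorProduct Q fun _ : Fin n => V) →ₗ[Q]
      (PiTensorProduct Q fun _ : Fin i => V') ⊗[Q] (PiTensorProduct Q fun _ : Fin (n - i) => V'') :=
  TensorProduct.map (PiTensorProduct.map fun _ => r) (PiTensorProduct.map fun _ => g) ∘ₗ
    (concat Q V i).symm.toLinearMap

/-- Two linear maps agree, if they agree on the products of pure tensors. -/
lemma tprod_tmul_tprod_ext {i j : ℕ} {N : Type*} [AddCommGroup N] [Module Q N]
    {a b : (PiTensorProduct Q fun _ : Fin i => V') ⊗[Q] (PiTensorProduct Q fun _ : Fin j => V'')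
      →ₗ[Q] N}
    (h : ∀ x y, a (PiTensorProduct.tprod Q x ⊗ₜ PiTensorProduct.tprod Q y) =
      b (PiTensorProduct.tprod Q x ⊗ₜ PiTensorProduct.tprod Q y)) : a = b :=
  TensorProduct.ext (PiTensorProduct.ext (MultilinearMap.ext fun x =>
    PiTensorProduct.ext (MultilinearMap.ext fun y => h x y)))

/-- A linear map takes values in a submodule, if it does so on the products of pure tensors. -/
lemma mem_of_tprod_tmul_tprod {i j : ℕ} {N : Type*} [AddCommGroup N] [Module Q N]
    (a : (PiTensorProduct Q fun _ : Fin i => V') ⊗[Q] (PiTensorProduct Q fun _ : Fin j => V'')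
      →ₗ[Q] N) {M : Submodule Q N}
    (h : ∀ x y, a (PiTensorProduct.tprod Q x ⊗ₜ PiTensorProduct.tprod Q y) ∈ M) (t) : a t ∈ M := by
  rw [← Submodule.Quotient.mk_eq_zero]
  have : M.mkQ ∘ₗ a = 0 := tprod_tmul_tprod_ext fun x y =>
    (Submodule.Quotient.mk_eq_zero M).2 (h x y)
  exact LinearMap.congr_fun this t

variable (F : V' →ₗ[Q] V) (s : V'' →ₗ[Q] V) (r : V →ₗ[Q] V') (g : V →ₗ[Q] V'') (i : Fin (n + 1))

lemma joinMap_tprod (x : Fin i → V') (y : Fin (n - i) → V'') :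
    joinMap F s i (PiTensorProduct.tprod Q x ⊗ₜ PiTensorProduct.tprod Q y) =
      concat Q V i (PiTensorProduct.tprod Q (fun k => F (x k)) ⊗ₜ
        PiTensorProduct.tprod Q fun k => s (y k)) := by
  rw [joinMap, LinearMap.comp_apply, TensorProduct.map_tmul, PiTensorProduct.map_tprod,
    PiTensorProduct.map_tprod]
  rfl

lemma splitMap_tprod (x : Fin n → V) :
    splitMap r g i (PiTensorProduct.tprod Q x) =
      (PiTensorProduct.tprod Q fun k => r (x (splitEquiv i (.inl k)))) ⊗ₜ
        PiTensorProduct.tprod Q fun k => g (x (splitEquiv i (.inr k))) := by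
  rw [splitMap, LinearMap.comp_apply, LinearEquiv.coe_coe, concat_symm_tprod,
    TensorProduct.map_tmul, PiTensorProduct.map_tprod, PiTensorProduct.map_tprod]

variable {F s r g i}

lemma splitMap_joinMap (hrF : ∀ x, r (F x) = x) (hgs : ∀ x, g (s x) = x) (t) :
    splitMap r g i (joinMap F s i t) = t := by
  have : splitMap r g i ∘ₗ joinMap F s i = LinearMap.id := tprod_tmul_tprod_ext fun x y => by
    rw [LinearMap.comp_apply, joinMap_tprod, concat_tprod, splitMap_tprod]
    simp [hrF, hgs]
  exact LinearMap.congr_fun this t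

lemma splitMap_tprod_eq_zero {x : Fin n → V} (k : Fin (n - i))
    (hx : g (x (splitEquiv i (.inr k))) = 0) :
    splitMap r g i (PiTensorProduct.tprod Q x) = 0 := by
  rw [splitMap_tprod, MultilinearMap.map_coord_zero (PiTensorProduct.tprod Q)
    (m := fun k => g (x (splitEquiv i (.inr k)))) k hx, TensorProduct.tmul_zero]

lemma joinMap_mem_filt (t) : joinMap F s i t ∈ filt F.range n i := by
  refine mem_of_tprod_tmul_tprod _ (fun x y => ?_) t
  rw [joinMap_tprod, concat_tprod]
  refine tprod_mem_filt
    (A := Finset.univ.map (Function.Embedding.inl.trans (splitEquiv i).toEmbedding))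
    (by simp) ?_
  intro k hk
  obtain ⟨l, -, rfl⟩ := Finset.mem_map.1 hk
  simp

/-- Of more than `i` factors in the image of `F`, one occupies one of the last `n - i` positions,
where `g` kills it. -/
lemma splitMap_eq_zero (hgF : ∀ x, g (F x) = 0) :
    ∀ t ∈ filt F.range n (i + 1), splitMap r g i t = 0 := by
  intro t ht
  induction ht using Submodule.span_induction with
  | mem t ht =>
    obtain ⟨A, x, hA, hx, rfl⟩ := ht
    obtain ⟨k, hk⟩ : ∃ k, splitEquiv i (.inr k) ∈ A := by
      by_contra! hcon
      have hsub : A ⊆ Finset.univ.map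
          (Function.Embedding.inl.trans (splitEquiv i).toEmbedding) := by
        intro k hk
        obtain ⟨l | l, rfl⟩ := (splitEquiv i).surjective k
        · simp
        · exact absurd hk (hcon l)
      have := Finset.card_le_card hsub
      simp at this
      omega
    obtain ⟨y, hy⟩ := hx _ hk
    exact splitMap_tprod_eq_zero k (by rw [← hy, hgF])
  | zero => exact map_zero _
  | add a b _ _ ha hb => rw [map_add, ha, hb, add_zero]
  | smul c a _ ha => rw [map_smul, ha, smul_zero]

/-- On the first block `F` intertwines `L'` and `L` exactly. On the second, `L (s y) - s (L'' y)`
equals `F (r (L (s y)))`, so the discrepancy consists of tensors with one more factor in the image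
of `F`. -/
lemma map_joinMap_sub_mem (hadd : ∀ x, F (r x) + s (g x) = x) (L : Fin n → V →ₗ[Q] V)
    (L' : Fin i → V' →ₗ[Q] V') (L'' : Fin (n - i) → V'' →ₗ[Q] V'')
    (h' : ∀ k x, L (splitEquiv i (.inl k)) (F x) = F (L' k x))
    (h'' : ∀ k x, g (L (splitEquiv i (.inr k)) (s x)) = L'' k x) (t) :
    PiTensorProduct.map L (joinMap F s i t) - joinMap F s i
      (TensorProduct.map (PiTensorProduct.map L') (PiTensorProduct.map L'') t) ∈
        filt F.range n (i + 1) := by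
  refine mem_of_tprod_tmul_tprod (PiTensorProduct.map L ∘ₗ joinMap F s i - joinMap F s i ∘ₗ
    TensorProduct.map (PiTensorProduct.map L') (PiTensorProduct.map L'')) (fun x y => ?_) t
  rw [LinearMap.sub_apply, LinearMap.comp_apply, LinearMap.comp_apply, TensorProduct.map_tmul,
    PiTensorProduct.map_tprod, PiTensorProduct.map_tprod, joinMap_tprod, joinMap_tprod, map_concat,
    TensorProduct.map_tmul, PiTensorProduct.map_tprod, PiTensorProduct.map_tprod]
  simp only [h']
  refine concat_sub_concat_mem_filt (fun k => ⟨_, rfl⟩) fun k => ?_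
  refine ⟨r (L (splitEquiv i (.inr k)) (s (y k))), ?_⟩
  rw [eq_sub_iff_add_eq, ← h'', hadd]

/-- Replacing a factor `x` of the second block by `s (g x)` changes it by `F (r x)`, which costs
only terms in the next step of the filtration. -/
lemma tprod_mem_sup_range_joinMap (hadd : ∀ x, F (r x) + s (g x) = x) {x : Fin n → V}
    (hx : ∀ k, x (splitEquiv i (.inl k)) ∈ F.range) :
    PiTensorProduct.tprod Q x ∈ filt F.range n (i + 1) ⊔ (joinMap F s i).range := by
  choose y hy using hx
  have h1 : concat Q V i (PiTensorProduct.tprod Q (fun k => F (y k)) ⊗ₜ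
      PiTensorProduct.tprod Q fun k => x (splitEquiv i (.inr k))) - joinMap F s i
        (PiTensorProduct.tprod Q y ⊗ₜ PiTensorProduct.tprod Q fun k =>
          g (x (splitEquiv i (.inr k)))) ∈ filt F.range n (i + 1) := by
    rw [joinMap_tprod]
    refine concat_sub_concat_mem_filt (fun k => ⟨_, rfl⟩) fun k => ?_
    refine ⟨r (x (splitEquiv i (.inr k))), ?_⟩
    rw [eq_sub_iff_add_eq, hadd]
  have h2 : concat Q V i (PiTensorProduct.tprod Q (fun k => F (y k)) ⊗ₜ
      PiTensorProduct.tprod Q fun k => x (splitEquiv i (.inr k))) = PiTensorProduct.tprod Q x := by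
    simp only [hy]
    rw [← concat_symm_tprod, LinearEquiv.apply_symm_apply]
  rw [h2] at h1
  exact Submodule.mem_sup.2 ⟨_, h1, _, ⟨_, rfl⟩, sub_add_cancel _ _⟩

end Join

/-! ### The filtration of a tensor power by factors in the image of a chain map -/

section PowLayer

variable {Q : Type u} [CommRing Q] {G : Type u} [Group G]
  {X' X X'' : ChainComplex (Rep.{u} Q G) ℤ} {n : ℕ}

lemma powPerm_tprod_of_mem (σ : Equiv.Perm (Fin n)) (f : Fin n → ℤ) {x : Fin n → Tot X}
    (hx : ∀ k, x k ∈ (homog X (f k)).range) :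
    powPerm X n σ (PiTensorProduct.tprod Q x) =
      ((koszulSign σ f : ℤˣ) : ℤ) • PiTensorProduct.tprod Q fun k => x (σ.symm k) := by
  choose y hy using hx
  obtain rfl : (fun k => homog X (f k) (y k)) = x := funext hy
  exact powPerm_tprod σ f y

lemma tprod_mem_powDeg (f : Fin n → ℤ) {x : Fin n → Tot X}
    (hx : ∀ k, x k ∈ (homog X (f k)).range) :
    PiTensorProduct.tprod Q x ∈ powDeg X n (∑ k, f k) := by
  choose y hy using hx
  obtain rfl : (fun k => homog X (f k) (y k)) = x := funext hy
  exact Submodule.subset_span ⟨f, y, rfl, rfl⟩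

/-- For factors that need not be homogeneous; it suits arguments in which only the new position of
each factor matters, not the sign. -/
lemma powPerm_tprod_eq_sum (σ : Equiv.Perm (Fin n)) (x : Fin n → Tot X) :
    powPerm X n σ (PiTensorProduct.tprod Q x) = ∑ p : Fin n → Fin 2,
      (((koszulSign σ fun k => ((p k : ℕ) : ℤ) : ℤˣ) : ℤ) : Q) • PiTensorProduct.tprod Q
        fun k => totParity X (p (σ.symm k)) (x (σ.symm k)) := by
  unfold powPerm
  rw [LinearMap.sum_apply]
  refine Finset.sum_congr rfl fun p _ => ?_
  rw [LinearMap.smul_apply, LinearMap.comp_apply, PiTensorProduct.map_tprod, LinearEquiv.coe_coe,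
    PiTensorProduct.reindex_tprod]

lemma totParity_totMap (φ : ∀ i, (X'.X i).V →ₗ[Q] (X.X i).V) (e : Fin 2) (x : Tot X') :
    totParity X e (totMap φ x) = totMap φ (totParity X' e x) := by
  have : totParity X e ∘ₗ totMap φ = totMap φ ∘ₗ totParity X' e := by
    apply DirectSum.linearMap_ext
    intro i
    ext1 x
    rw [LinearMap.comp_apply, LinearMap.comp_apply, LinearMap.comp_apply, LinearMap.comp_apply,
      totMap_homog, totParity_homog, totParity_homog]
    split_ifs
    · rw [totMap_homog]
    · rw [map_zero]
  exact LinearMap.congr_fun this x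

section Invariance

variable {R : Submodule Q (Tot X)} {j : ℕ}

lemma powPerm_mem_filt (hR : ∀ e, ∀ x ∈ R, totParity X e x ∈ R) (σ : Equiv.Perm (Fin n)) :
    ∀ t ∈ filt R n j, powPerm X n σ t ∈ filt R n j := by
  intro t ht
  unfold powPerm
  rw [LinearMap.sum_apply]
  exact sum_mem fun p _ => Submodule.smul_mem _ _
    (reindex_mem_filt σ _ (map_mem_filt _ (fun k => hR (p k)) t ht))

lemma powDiag_mem_filt (a : G) (hR : ∀ x ∈ R, totRho X a x ∈ R) :
    ∀ t ∈ filt R n j, powDiag X n a t ∈ filt R n j :=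
  map_mem_filt _ fun _ => hR

lemma powD_mem_filt (hR : ∀ x ∈ R, totSgn X x ∈ R) (hR' : ∀ x ∈ R, totD X x ∈ R) :
    ∀ t ∈ filt R n j, powD X n t ∈ filt R n j := by
  intro t ht
  unfold powD
  rw [LinearMap.sum_apply]
  refine sum_mem fun k _ => map_mem_filt _ (fun l x hx => ?_) t ht
  split_ifs
  · exact hR x hx
  · exact hR' x hx
  · exact hx

end Invariance

variable (f : X' ⟶ X)

/-- The filtration of the tensor power of `X` by the number of factors in the image of `f`. -/
abbrev powFilt (n j : ℕ) : Submodule Q (TotPow X n) := filt (totMap (linMaps f)).range n j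

lemma powRho_mem_powFilt (j : ℕ) (a : G × Equiv.Perm (Fin n)) :
    ∀ t ∈ powFilt f n j, powRho X n a t ∈ powFilt f n j := by
  intro t ht
  refine powPerm_mem_filt ?_ a.2 _ (powDiag_mem_filt a.1 ?_ t ht)
  · rintro e _ ⟨x, rfl⟩
    exact ⟨_, (totParity_totMap (linMaps f) e x).symm⟩
  · rintro _ ⟨x, rfl⟩
    exact ⟨_, (totRho_totMap f a.1 x).symm⟩

lemma powD_mem_powFilt (j : ℕ) : ∀ t ∈ powFilt f n j, powD X n t ∈ powFilt f n j := by
  refine powD_mem_filt ?_ ?_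
  · rintro _ ⟨x, rfl⟩
    exact ⟨_, (totSgn_totMap (linMaps f) x).symm⟩
  · rintro _ ⟨x, rfl⟩
    exact ⟨_, (totD_totMap f x).symm⟩

/-- The quotient of the tensor power by a step of the filtration. -/
def quotPow (n j : ℕ) : ChainComplex (Rep.{u} Q (G × Equiv.Perm (Fin n))) ℤ :=
  quotComplex (powRho X n) (powD X n) (powDeg X n)
    (fun a m t ht => powPerm_mem a.2 m _ (powDiag_mem a.1 m t ht))
    powD_mem powD_powD
    (fun a t => by
      change powD X n (powPerm X n a.2 (powDiag X n a.1 t)) =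
        powPerm X n a.2 (powDiag X n a.1 (powD X n t))
      rw [powD_powPerm, powD_powDiag])
    (powFilt f n j) (powRho_mem_powFilt f j) (powD_mem_powFilt f j)

end PowLayer

/-! ### Joining and splitting tensors along a graded splitting -/

section PowLayer

variable {Q : Type u} [CommRing Q] {G : Type u} [Group G]
  {X' X X'' : ChainComplex (Rep.{u} Q G) ℤ} {n : ℕ} {f : X' ⟶ X} {g : X ⟶ X''}
  (S : GradedSplitting f g) (i : Fin (n + 1))

/-- The differential `x ⊗ y ↦ d x ⊗ y + (-1)^|x| x ⊗ d y` on a product of two tensor powers. -/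
def powTensorD (X' X'' : ChainComplex (Rep.{u} Q G) ℤ) (i j : ℕ) :
    TotPow X' i ⊗[Q] TotPow X'' j →ₗ[Q] TotPow X' i ⊗[Q] TotPow X'' j :=
  TensorProduct.map (powD X' i) LinearMap.id +
    TensorProduct.map (PiTensorProduct.map fun _ => totSgn X') (powD X'' j)

lemma powRho_apply (a : G × Equiv.Perm (Fin n)) (t : TotPow X n) :
    powRho X n a t = powPerm X n a.2 (powDiag X n a.1 t) := rfl

lemma powRho_one_perm (σ : Equiv.Perm (Fin n)) : powRho X n (1, σ) = powPerm X n σ := by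
  change powPerm X n σ ∘ₗ powDiag X n 1 = _
  rw [powDiag_one, LinearMap.comp_id]

lemma zsmul_tmul_zsmul {M N : Type*} [AddCommGroup M] [Module Q M] [AddCommGroup N] [Module Q N]
    (a b : ℤ) (x : M) (y : N) : (a • x) ⊗ₜ[Q] (b • y) = (a * b) • (x ⊗ₜ[Q] y) := by
  rw [← Int.cast_smul_eq_zsmul Q a, ← Int.cast_smul_eq_zsmul Q b,
    ← Int.cast_smul_eq_zsmul Q (a * b), TensorProduct.smul_tmul_smul, Int.cast_mul]

namespace GradedSplitting

/-- The map `T^i(X') ⊗ T^(n-i)(X'') → T^n(X)` given by `f` and the section. -/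
abbrev join : TotPow X' i ⊗[Q] TotPow X'' (n - i) →ₗ[Q] TotPow X n :=
  joinMap (totMap (linMaps f)) (totMap S.s) i

/-- The map `T^n(X) → T^i(X') ⊗ T^(n-i)(X'')` given by the retraction and `g`. -/
abbrev split : TotPow X n →ₗ[Q] TotPow X' i ⊗[Q] TotPow X'' (n - i) :=
  splitMap (totMap S.r) (totMap (linMaps g)) i

lemma split_join (t) : S.split i (S.join i t) = t := splitMap_joinMap S.totMap_r_f S.totMap_g_s t

lemma split_eq_zero : ∀ t ∈ powFilt f n (i + 1), S.split i t = 0 := splitMap_eq_zero S.totMap_g_f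

/-- A summand of the differential on the first block commutes with `f`. On the second block it
commutes with the section up to the image of `f`, and the grading involution on the whole first
block is the sign in `powTensorD`. -/
lemma powD_join_sub_mem (t) : powD X n (S.join i t) - S.join i
    (powTensorD X' X'' i (n - i) t) ∈ powFilt f n (i + 1) := by
  have h1 : ∀ k : Fin i, powDAt X n (splitEquiv i (.inl k)) (S.join i t) - S.join i
      (TensorProduct.map (powDAt X' i k) LinearMap.id t) ∈ powFilt f n (i + 1) := by
    intro k
    rw [← PiTensorProduct.map_id]
    refine map_joinMap_sub_mem S.totMap_f_r_add _ _ _ (fun l x => ?_) (fun l x => ?_) t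
    · simp only [splitEquiv_inl_lt_inl, (splitEquiv i).injective.eq_iff, Sum.inl.injEq]
      split_ifs
      · exact totSgn_totMap _ x
      · exact totD_totMap f x
      · rfl
    · rw [if_neg (splitEquiv_inl_lt_inr k l).not_gt, if_neg (splitEquiv_inl_lt_inr k l).ne']
      exact S.totMap_g_s x
  have h2 : ∀ k : Fin (n - i), powDAt X n (splitEquiv i (.inr k)) (S.join i t) - S.join i
      (TensorProduct.map (PiTensorProduct.map fun _ => totSgn X') (powDAt X'' (n - i) k) t) ∈
        powFilt f n (i + 1) := by
    intro k
    refine map_joinMap_sub_mem S.totMap_f_r_add _ _ _ (fun l x => ?_) (fun l x => ?_) t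
    · rw [if_pos (splitEquiv_inl_lt_inr l k)]
      exact totSgn_totMap _ x
    · simp only [splitEquiv_inr_lt_inr, (splitEquiv i).injective.eq_iff, Sum.inr.injEq]
      split_ifs
      · exact (totSgn_totMap (linMaps g) _).symm.trans (congrArg _ (S.totMap_g_s x))
      · exact (totD_totMap g _).symm.trans (congrArg _ (S.totMap_g_s x))
      · exact S.totMap_g_s x
  have h3 : powD X n = ∑ k, powDAt X n (splitEquiv i (.inl k)) +
      ∑ k, powDAt X n (splitEquiv i (.inr k)) := by
    unfold powD
    rw [← Equiv.sum_comp (splitEquiv i), Fintype.sum_sum_type]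
  have h4 : powTensorD X' X'' i (n - i) =
      ∑ k, TensorProduct.map (powDAt X' i k) LinearMap.id + ∑ k, TensorProduct.map
        (PiTensorProduct.map fun _ => totSgn X') (powDAt X'' (n - i) k) := by
    refine congrArg₂ (· + ·) ?_ ?_
    · exact map_sum ((TensorProduct.mapBilinear (RingHom.id Q) _ _ _ _).flip
        (LinearMap.id : TotPow X'' (n - i) →ₗ[Q] TotPow X'' (n - i))) (powDAt X' i) Finset.univ
    · exact map_sum (TensorProduct.mapBilinear (RingHom.id Q) _ _ _ _ _) (powDAt X'' (n - i))
        Finset.univ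
  rw [h3, h4, LinearMap.add_apply, LinearMap.add_apply, LinearMap.sum_apply, LinearMap.sum_apply,
    LinearMap.sum_apply, LinearMap.sum_apply, map_add, map_sum, map_sum, add_sub_add_comm,
    ← Finset.sum_sub_distrib, ← Finset.sum_sub_distrib]
  exact add_mem (sum_mem fun k _ => h1 k) (sum_mem fun k _ => h2 k)

lemma powDiag_join_sub_mem (a : G) (t) : powDiag X n a (S.join i t) - S.join i
    (TensorProduct.map (powDiag X' i a) (powDiag X'' (n - i) a) t) ∈ powFilt f n (i + 1) := by
  refine map_joinMap_sub_mem S.totMap_f_r_add _ _ _ (fun l x => ?_) (fun l x => ?_) t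
  · exact totRho_totMap f a x
  · exact (totRho_totMap g a _).symm.trans (congrArg _ (S.totMap_g_s x))

/-- The values on products of tensors of homogeneous elements determine a linear map. -/
lemma _root_.PowerOp.totPow_tmul_ext {i j : ℕ} {N : Type*} [AddCommGroup N] [Module Q N]
    {a b : TotPow X' i ⊗[Q] TotPow X'' j →ₗ[Q] N}
    (h : ∀ (p : Fin i → ℤ) (q : Fin j → ℤ) (x : Fin i → Tot X') (y : Fin j → Tot X''),
      (∀ k, x k ∈ (homog X' (p k)).range) → (∀ k, y k ∈ (homog X'' (q k)).range) →
      a (PiTensorProduct.tprod Q x ⊗ₜ PiTensorProduct.tprod Q y) =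
        b (PiTensorProduct.tprod Q x ⊗ₜ PiTensorProduct.tprod Q y)) : a = b :=
  TensorProduct.ext (totPow_ext fun p x => totPow_ext fun q y =>
    h p q _ _ (fun k => ⟨x k, rfl⟩) fun k => ⟨y k, rfl⟩)

lemma _root_.PowerOp.totMap_mem_range {X Y : ChainComplex (Rep.{u} Q G) ℤ}
    (φ : ∀ i, (X.X i).V →ₗ[Q] (Y.X i).V) {m : ℤ} {x : Tot X} (hx : x ∈ (homog X m).range) :
    totMap φ x ∈ (homog Y m).range := by
  obtain ⟨x, rfl⟩ := hx
  exact ⟨φ m x, (totMap_homog φ m x).symm⟩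

/-- The tensor `f(x₁) ⊗ ⋯ ⊗ f(xᵢ) ⊗ s(y₁) ⊗ ⋯` of homogeneous elements has homogeneous factors. -/
lemma join_tprod_factors {p : Fin i → ℤ} {q : Fin (n - i) → ℤ} {x : Fin i → Tot X'}
    {y : Fin (n - i) → Tot X''} (hx : ∀ k, x k ∈ (homog X' (p k)).range)
    (hy : ∀ k, y k ∈ (homog X'' (q k)).range) (k : Fin n) :
    Sum.elim (fun k => totMap (linMaps f) (x k)) (fun k => totMap S.s (y k))
      ((splitEquiv i).symm k) ∈ (homog X (Sum.elim p q ((splitEquiv i).symm k))).range := by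
  rcases (splitEquiv i).symm k with l | l
  · exact totMap_mem_range _ (hx l)
  · exact totMap_mem_range _ (hy l)

/-- Permuting factors is compatible with `f` and the section since both preserve degrees, so this
equality is exact; the signs agree by `koszulSign_youngHom`. -/
lemma powPerm_join (σ : Equiv.Perm (Fin i)) (τ : Equiv.Perm (Fin (n - i))) (t) :
    powPerm X n (youngHom i (σ, τ)) (S.join i t) =
      S.join i (TensorProduct.map (powPerm X' i σ) (powPerm X'' (n - i) τ) t) := by
  have : powPerm X n (youngHom i (σ, τ)) ∘ₗ S.join i =
      S.join i ∘ₗ TensorProduct.map (powPerm X' i σ) (powPerm X'' (n - i) τ) := by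
    refine totPow_tmul_ext fun p q x y hx hy => ?_
    rw [LinearMap.comp_apply, LinearMap.comp_apply, TensorProduct.map_tmul,
      powPerm_tprod_of_mem σ p hx, powPerm_tprod_of_mem τ q hy, joinMap_tprod, concat_tprod,
      powPerm_tprod_of_mem _ _ (S.join_tprod_factors i hx hy), koszulSign_youngHom,
      zsmul_tmul_zsmul, map_zsmul, joinMap_tprod, concat_tprod]
    simp only [Equiv.symm_apply_apply, Sum.elim_inl, Sum.elim_inr, Units.val_mul]
    congr 2
    funext k
    obtain ⟨k, rfl⟩ := (youngHom i (σ, τ)).surjective k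
    obtain ⟨l | l, rfl⟩ := (splitEquiv i).surjective k
    · rw [Equiv.symm_apply_apply, youngHom_inl]
      simp
    · rw [Equiv.symm_apply_apply, youngHom_inr]
      simp
  exact LinearMap.congr_fun this t

/-- Modulo the next step of the filtration, `join` is equivariant for `G × (Σᵢ × Σₙ₋ᵢ)`. -/
lemma powRho_join_sub_mem (a : G × (Equiv.Perm (Fin i) × Equiv.Perm (Fin (n - i)))) (t) :
    powRho X n ((MonoidHom.id G).prodMap (youngHom i) a) (S.join i t) - S.join i
      (TensorProduct.map (powRho X' i (a.1, a.2.1)) (powRho X'' (n - i) (a.1, a.2.2)) t) ∈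
        powFilt f n (i + 1) := by
  have h : TensorProduct.map (powRho X' i (a.1, a.2.1)) (powRho X'' (n - i) (a.1, a.2.2)) t =
      TensorProduct.map (powPerm X' i a.2.1) (powPerm X'' (n - i) a.2.2)
        (TensorProduct.map (powDiag X' i a.1) (powDiag X'' (n - i) a.1) t) := by
    rw [← LinearMap.comp_apply, ← TensorProduct.map_comp]
    rfl
  rw [h, ← powPerm_join]
  have h1 := powRho_mem_powFilt f (i + 1) (1, youngHom i a.2) _ (S.powDiag_join_sub_mem i a.1 t)
  rwa [powRho_one_perm, map_sub] at h1

/-- Such a permutation moves some factor in the image of `f` from the first block into the second,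
where `split` applies `g`. This separates the translates of the image of `join`. -/
lemma split_powRho_join_of_notMem (a : G × Equiv.Perm (Fin n)) (ha : a.2 ∉ (youngHom i).range)
    (t) : S.split i (powRho X n a (S.join i t)) = 0 := by
  obtain ⟨k, l, hkl⟩ := exists_inl_eq_inr ha
  have : S.split i ∘ₗ powRho X n a ∘ₗ S.join i = 0 := by
    refine tprod_tmul_tprod_ext (Q := Q) (V' := Tot X') (V'' := Tot X'')
      (N := TotPow X' i ⊗[Q] TotPow X'' (n - i)) fun x y => ?_
    rw [LinearMap.comp_apply, LinearMap.comp_apply, joinMap_tprod, concat_tprod]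
    rw [powRho_apply, powDiag, PiTensorProduct.map_tprod, powPerm_tprod_eq_sum, map_sum]
    refine Finset.sum_eq_zero fun p _ => ?_
    rw [map_smul, splitMap_tprod_eq_zero l, smul_zero]
    rw [← hkl, Equiv.symm_apply_apply, Equiv.symm_apply_apply, Sum.elim_inl, totRho_totMap,
      totParity_totMap]
    exact S.totMap_g_f _
  exact LinearMap.congr_fun this t

/-- A permutation brings `i` factors in the image of `f` to the front; modulo the next step, the
others may then be replaced by elements in the image of the section. -/
lemma powFilt_le : powFilt f n i ≤ powFilt f n (i + 1) ⊔
    ⨆ a, (S.join i).range.map (powRho X n a) := by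
  refine Submodule.span_le.2 ?_
  rintro _ ⟨A, x, hA, hx, rfl⟩
  obtain ⟨B, hBA, hB⟩ := Finset.exists_subset_card_eq hA
  obtain ⟨π, hπ⟩ := exists_perm_of_card hB
  have h1 : powPerm X n π⁻¹ (PiTensorProduct.tprod Q x) ∈
      powFilt f n (i + 1) ⊔ (S.join i).range := by
    rw [powPerm_tprod_eq_sum]
    refine sum_mem fun p _ => Submodule.smul_mem _ _
      (tprod_mem_sup_range_joinMap S.totMap_f_r_add fun k => ?_)
    obtain ⟨y, hy⟩ := hx _ (hBA (hπ k))
    refine ⟨totParity X' (p (π (splitEquiv i (.inl k)))) y, ?_⟩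
    rw [← totParity_totMap, hy]
    rfl
  have h2 : powRho X n (1, π) (powPerm X n π⁻¹ (PiTensorProduct.tprod Q x)) =
      PiTensorProduct.tprod Q x := by
    rw [powRho_one_perm, ← LinearMap.comp_apply, ← powPerm_mul, mul_inv_cancel,
      powPerm_one]
    rfl
  obtain ⟨y, hy, z, hz, hyz⟩ := Submodule.mem_sup.1 h1
  rw [SetLike.mem_coe, ← h2, ← hyz, map_add]
  exact add_mem (Submodule.mem_sup_left (powRho_mem_powFilt f _ _ _ hy))
    (Submodule.mem_sup_right (Submodule.mem_iSup_of_mem (1, π) ⟨z, hz, rfl⟩))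

lemma join_mem {p q : ℤ} {x : TotPow X' i} (hx : x ∈ powDeg X' i p) {y : TotPow X'' (n - i)}
    (hy : y ∈ powDeg X'' (n - i) q) : S.join i (x ⊗ₜ y) ∈ powDeg X n (p + q) := by
  induction hx using Submodule.span_induction with
  | mem t ht =>
    obtain ⟨a, x, rfl, rfl⟩ := ht
    induction hy using Submodule.span_induction with
    | mem t ht =>
      obtain ⟨b, y, rfl, rfl⟩ := ht
      have h := tprod_mem_powDeg _ (S.join_tprod_factors i (p := a) (q := b)
        (fun k => ⟨x k, rfl⟩) fun k => ⟨y k, rfl⟩)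
      rw [joinMap_tprod, concat_tprod]
      rwa [← Equiv.sum_comp (splitEquiv i), Fintype.sum_sum_type, Finset.sum_congr rfl fun k _ =>
        congrArg (Sum.elim a b) ((splitEquiv i).symm_apply_apply (.inl k)),
        Finset.sum_congr rfl fun k _ =>
        congrArg (Sum.elim a b) ((splitEquiv i).symm_apply_apply (.inr k))] at h
    | zero => simp
    | add a b _ _ ha hb => rw [TensorProduct.tmul_add, map_add]; exact add_mem ha hb
    | smul r a _ ha => rw [TensorProduct.tmul_smul, map_smul]; exact Submodule.smul_mem _ _ ha
  | zero => simp
  | add a b _ _ ha hb => rw [TensorProduct.add_tmul, map_add]; exact add_mem ha hb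
  | smul r a _ ha =>
    rw [← TensorProduct.smul_tmul', map_smul]
    exact Submodule.smul_mem _ _ ha

lemma split_mem {m : ℤ} {t : TotPow X n} (ht : t ∈ powDeg X n m) :
    S.split i t ∈ Submodule.span Q {t | ∃ (p q : ℤ) (x : powDeg X' i p)
      (y : powDeg X'' (n - i) q), p + q = m ∧ t = x.1 ⊗ₜ[Q] y.1} := by
  induction ht using Submodule.span_induction with
  | mem t ht =>
    obtain ⟨a, x, rfl, rfl⟩ := ht
    rw [splitMap_tprod]
    refine Submodule.subset_span ⟨_, _, ⟨_, tprod_mem_powDeg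
      (fun k => a (splitEquiv i (.inl k))) fun k => totMap_mem_range _ ⟨_, rfl⟩⟩,
      ⟨_, tprod_mem_powDeg
      (fun k => a (splitEquiv i (.inr k))) fun k => totMap_mem_range _ ⟨_, rfl⟩⟩, ?_, rfl⟩
    rw [← Equiv.sum_comp (splitEquiv i) a, Fintype.sum_sum_type]
  | zero => simp
  | add a b _ _ ha hb => rw [map_add]; exact add_mem ha hb
  | smul r a _ ha => rw [map_smul]; exact Submodule.smul_mem _ _ ha

end GradedSplitting

end PowLayer

/-! ### Comparison of a tensor power with the total space of its complex -/

section PowSum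

variable {Q : Type u} [CommRing Q] {G : Type u} [Group G]
  {X : ChainComplex (Rep.{u} Q G) ℤ} {n : ℕ}

/-- The signs of the factors multiply to the sign of the total degree, so the factorwise involution
is the grading involution of the tensor power. -/
lemma map_totSgn_of_mem {m : ℤ} {t : TotPow X n} (ht : t ∈ powDeg X n m) :
    PiTensorProduct.map (fun _ => totSgn X) t = (((m.negOnePow : ℤˣ) : ℤ) : Q) • t := by
  induction ht using Submodule.span_induction with
  | mem t ht =>
    obtain ⟨f, x, rfl, rfl⟩ := ht
    have h : ∀ k, totSgn X (homog X (f k) (x k)) =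
        ((((f k).negOnePow : ℤˣ) : ℤ) : Q) • homog X (f k) (x k) := fun k => by
      rw [totSgn_homog, map_zsmul, Int.cast_smul_eq_zsmul]
    have hs : ∀ s : Finset (Fin n), ∏ k ∈ s, (f k).negOnePow = (∑ k ∈ s, f k).negOnePow := by
      intro s
      induction s using Finset.induction_on with
      | empty => simp
      | insert a s ha ih => rw [Finset.prod_insert ha, Finset.sum_insert ha, ih, Int.negOnePow_add]
    rw [PiTensorProduct.map_tprod]
    simp only [h]
    rw [MultilinearMap.map_smul_univ, ← Int.cast_prod, ← Units.coe_prod, hs]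
  | zero => simp
  | add a b _ _ ha hb => rw [map_add, ha, hb, smul_add]
  | smul r a _ ha => rw [map_smul, ha, smul_comm]

lemma powSum_totD (t : Tot (tensorPower X n)) :
    powSum X n (totD (tensorPower X n) t) = powD X n (powSum X n t) := by
  have : powSum X n ∘ₗ totD (tensorPower X n) = powD X n ∘ₗ powSum X n := by
    apply DirectSum.linearMap_ext
    intro m
    refine LinearMap.ext fun (x : powDeg X n m) => ?_
    refine (congrArg (powSum X n) (totD_homog (tensorPower X n) m x)).trans ?_
    refine (powSum_powLof (m - 1) _).trans ?_
    refine (ofGraded_d (by omega) x).trans ?_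
    exact (congrArg (powD X n) (powSum_powLof m x)).symm
  exact LinearMap.congr_fun this t

lemma powSum_totSgn (t : Tot (tensorPower X n)) :
    powSum X n (totSgn (tensorPower X n) t) =
      PiTensorProduct.map (fun _ => totSgn X) (powSum X n t) := by
  have : powSum X n ∘ₗ totSgn (tensorPower X n) =
      PiTensorProduct.map (fun _ => totSgn X) ∘ₗ powSum X n := by
    apply DirectSum.linearMap_ext
    intro m
    refine LinearMap.ext fun (x : powDeg X n m) => ?_
    refine (congrArg (powSum X n) (totSgn_homog (tensorPower X n) m x)).trans ?_
    refine (powSum_powLof m _).trans ?_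
    refine Eq.trans ?_ (congrArg (PiTensorProduct.map fun _ => totSgn X) (powSum_powLof m x)).symm
    exact (Int.cast_smul_eq_zsmul Q _ x.1).symm.trans (map_totSgn_of_mem x.2).symm
  exact LinearMap.congr_fun this t

lemma powSum_totRho (a : G × Equiv.Perm (Fin n)) (t : Tot (tensorPower X n)) :
    powSum X n (totRho (tensorPower X n) a t) = powRho X n a (powSum X n t) := by
  have : powSum X n ∘ₗ (totRho (tensorPower X n) a) =
      LinearMap.comp (powRho X n a) (powSum X n) := by
    apply DirectSum.linearMap_ext
    intro m
    refine LinearMap.ext fun (x : powDeg X n m) => ?_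
    refine (congrArg (powSum X n) (totRho_homog (tensorPower X n) a m x)).trans ?_
    refine (powSum_powLof m _).trans ?_
    exact (congrArg (powRho X n a) (powSum_powLof m x)).symm
  exact LinearMap.congr_fun this t

variable {K : Type u} [Group K] (φ : K →* G × Equiv.Perm (Fin n))

variable (X) in
/-- The sum of the homogeneous parts, for the restriction of a tensor power. -/
def resPowSum : Tot (resComplex φ (tensorPower X n)) →ₗ[Q] TotPow X n := powSum X n

variable (X) in
/-- The decomposition into homogeneous parts, for the restriction of a tensor power. -/
def resPowDec : TotPow X n →ₗ[Q] Tot (resComplex φ (tensorPower X n)) := powDec X n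

lemma resPowSum_homog (m : ℤ) (x : powDeg X n m) :
    resPowSum X φ (homog (resComplex φ (tensorPower X n)) m x) = x := powSum_powLof m x

lemma resPowDec_coe (m : ℤ) (x : powDeg X n m) :
    resPowDec X φ x = homog (resComplex φ (tensorPower X n)) m x := powDec_coe m x

lemma resPowSum_resPowDec (t) : resPowSum X φ (resPowDec X φ t) = t := powSum_powDec t

lemma resPowDec_resPowSum (t) : resPowDec X φ (resPowSum X φ t) = t := powDec_powSum t

lemma resPowSum_totD (t) : resPowSum X φ (totD _ t) = powD X n (resPowSum X φ t) := powSum_totD t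

lemma resPowSum_totSgn (t) : resPowSum X φ (totSgn _ t) =
    PiTensorProduct.map (fun _ => totSgn X) (resPowSum X φ t) := powSum_totSgn t

lemma resPowSum_totRho (a : K) (t) :
    resPowSum X φ (totRho _ a t) = powRho X n (φ a) (resPowSum X φ t) := powSum_totRho (φ a) t

end PowSum

/-! ### The layers of a tensor power as induced complexes -/

section LayerExtension

variable {Q : Type u} [CommRing Q] {G : Type u} [Group G]
  {X' X X'' : ChainComplex (Rep.{u} Q G) ℤ} {n : ℕ} {f : X' ⟶ X} {g : X ⟶ X''}
  (i : Fin (n + 1))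

variable (G) in
/-- The embedding of `G × (Σᵢ × Σₙ₋ᵢ)` into `G × Σₙ`. -/
abbrev prodYoungHom :
    G × (Equiv.Perm (Fin i) × Equiv.Perm (Fin (n - i))) →* G × Equiv.Perm (Fin n) :=
  (MonoidHom.id G).prodMap (youngHom i)

lemma prodYoungHom_injective : Function.Injective (prodYoungHom G i) :=
  Function.Injective.prodMap Function.injective_id youngHom_injective

/-- The total space of `T^i(X') ⊗ T^(n-i)(X'')`. -/
abbrev TotPair (X' X'' : ChainComplex (Rep.{u} Q G) ℤ) (i : Fin (n + 1)) : Type u :=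
  Tot (resComplex ((MonoidHom.id G).prodMap (MonoidHom.fst (Equiv.Perm (Fin i))
    (Equiv.Perm (Fin (n - i))))) (tensorPower X' i)) ⊗[Q]
  Tot (resComplex ((MonoidHom.id G).prodMap (MonoidHom.snd (Equiv.Perm (Fin i))
    (Equiv.Perm (Fin (n - i))))) (tensorPower X'' (n - i)))

variable (X' X'') in
/-- The sum of the homogeneous parts. -/
def pairSum : TotPair X' X'' i →ₗ[Q] TotPow X' i ⊗[Q] TotPow X'' (n - i) :=
  TensorProduct.map (resPowSum X' _) (resPowSum X'' _)

variable (X' X'') in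
/-- The decomposition into homogeneous parts. -/
def pairDec : TotPow X' i ⊗[Q] TotPow X'' (n - i) →ₗ[Q] TotPair X' X'' i :=
  TensorProduct.map (resPowDec X' _) (resPowDec X'' _)

lemma pairSum_pairDec (t) : pairSum X' X'' i (pairDec X' X'' i t) = t := by
  unfold pairSum pairDec
  induction t using TensorProduct.induction_on with
  | zero => simp
  | add a b ha hb => rw [map_add, map_add, ha, hb]
  | tmul x y =>
    rw [TensorProduct.map_tmul, TensorProduct.map_tmul, resPowSum_resPowDec, resPowSum_resPowDec]

lemma pairDec_pairSum (t) : pairDec X' X'' i (pairSum X' X'' i t) = t := by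
  unfold pairSum pairDec
  induction t using TensorProduct.induction_on with
  | zero => simp
  | add a b ha hb => rw [map_add, map_add, ha, hb]
  | tmul x y =>
    rw [TensorProduct.map_tmul, TensorProduct.map_tmul, resPowDec_resPowSum, resPowDec_resPowSum]

lemma pairSum_tensorD (t) : pairSum X' X'' i (tensorD _ _ t) =
    powTensorD X' X'' i (n - i) (pairSum X' X'' i t) := by
  unfold pairSum powTensorD tensorD
  induction t using TensorProduct.induction_on with
  | zero => simp
  | add a b ha hb => rw [map_add, map_add, map_add, map_add, ha, hb]
  | tmul x y =>
    rw [LinearMap.add_apply, LinearMap.add_apply, map_add]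
    simp only [TensorProduct.map_tmul, resPowSum_totD, resPowSum_totSgn, LinearMap.id_apply]

lemma pairSum_tensorRho (a : G × (Equiv.Perm (Fin i) × Equiv.Perm (Fin (n - i))))
    (t : TotPair X' X'' i) : pairSum X' X'' i ((totRho _).tprod (totRho _) a t) =
      TensorProduct.map (powRho X' i (a.1, a.2.1)) (powRho X'' (n - i) (a.1, a.2.2))
        (pairSum X' X'' i t) := by
  unfold pairSum
  induction t using TensorProduct.induction_on with
  | zero => simp
  | add a b ha hb => rw [map_add, map_add, map_add, map_add, ha, hb]
  | tmul x y =>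
    rw [Representation.tprod_apply]
    simp only [TensorProduct.map_tmul, resPowSum_totRho]
    rfl

/-- The layers of the filtration of `T^n(X)` given by a short exact sequence. -/
theorem isExtension_quotPow [Finite G] (S : GradedSplitting f g) :
    IsExtension (indPowTensorPow X' X'' i) (quotPow f n (i + 1)) (quotPow f n i) := by
  have hςF : ∀ x ∈ powFilt f n (i + 1), (pairDec X' X'' i ∘ₗ S.split i) x = 0 := fun x hx => by
    rw [LinearMap.comp_apply, S.split_eq_zero i x hx, map_zero]
  have hμρ : ∀ (a : G × (Equiv.Perm (Fin i) × Equiv.Perm (Fin (n - i)))) (x : TotPair X' X'' i),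
      (S.join i ∘ₗ pairSum X' X'' i) ((totRho _).tprod (totRho _) a x) -
        powRho X n (prodYoungHom G i a) ((S.join i ∘ₗ pairSum X' X'' i) x) ∈
          powFilt f n (i + 1) := fun a x => by
    rw [LinearMap.comp_apply, LinearMap.comp_apply, pairSum_tensorRho, ← neg_sub]
    exact neg_mem (S.powRho_join_sub_mem i a _)
  -- Here `μ` and `ς` are `join` and `split`, carried over to `TotPair` by the inverse maps
  -- `pairSum` and `pairDec`.
  refine isExtension_ind_quotComplex (hd := tensorD_mem) (hdd := tensorD_tensorD)
    (hdρ := tensorD_tensorRho) (μ := S.join i ∘ₗ pairSum X' X'' i)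
    (ς := pairDec X' X'' i ∘ₗ S.split i) (prodYoungHom_injective i)
    (filt_antitone (Nat.le_succ _)) ?_ ?_ hςF (fun x => joinMap_mem_filt _) hμρ ?_ ?_ ?_
  · intro m t ht
    induction ht using Submodule.span_induction with
    | mem t ht =>
      obtain ⟨p, q, x, y, rfl, rfl⟩ := ht
      have h : pairSum X' X'' i (homog _ p x ⊗ₜ homog _ q y) =
          (x : powDeg X' i p).1 ⊗ₜ (y : powDeg X'' (n - i) q).1 :=
        congrArg₂ (· ⊗ₜ ·) (resPowSum_homog _ p x) (resPowSum_homog _ q y)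
      rw [LinearMap.comp_apply, h]
      exact S.join_mem i x.2 y.2
    | zero => rw [map_zero]; exact zero_mem _
    | add a b _ _ ha hb => rw [map_add]; exact add_mem ha hb
    | smul r a _ ha => rw [map_smul]; exact Submodule.smul_mem _ _ ha
  · intro m t ht
    have h := S.split_mem i ht
    rw [LinearMap.comp_apply]
    generalize S.split i t = t at h
    induction h using Submodule.span_induction with
    | mem t ht =>
      obtain ⟨p, q, x, y, rfl, rfl⟩ := ht
      have h : pairDec X' X'' i (x.1 ⊗ₜ y.1) = homog _ p x ⊗ₜ homog _ q y :=
        congrArg₂ (· ⊗ₜ ·) (resPowDec_coe _ p x) (resPowDec_coe _ q y)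
      rw [h]
      exact Submodule.subset_span ⟨p, q, x, y, rfl, rfl⟩
    | zero => rw [map_zero]; exact zero_mem _
    | add a b _ _ ha hb => rw [map_add]; exact add_mem ha hb
    | smul r a _ ha => rw [map_smul]; exact Submodule.smul_mem _ _ ha
  · intro x
    rw [LinearMap.comp_apply, LinearMap.comp_apply, pairSum_tensorD, ← neg_sub]
    exact neg_mem (S.powD_join_sub_mem i _)
  · intro a x
    -- On the subgroup `join` is equivariant up to terms that `split` kills, and `split` is its left
    -- inverse; off the subgroup `split` gives zero.
    by_cases ha : a ∈ (prodYoungHom G i).range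
    · obtain ⟨b, rfl⟩ := ha
      rw [indCoeff_map _ (prodYoungHom_injective i)]
      have h := hςF _ (hμρ b x)
      rw [map_sub, sub_eq_zero] at h
      rw [← h, LinearMap.comp_apply, LinearMap.comp_apply, S.split_join, pairDec_pairSum]
    · rw [indCoeff_of_notMem _ _ ha, LinearMap.comp_apply, LinearMap.comp_apply,
        S.split_powRho_join_of_notMem, map_zero]
      · rfl
      · rintro ⟨b, hb⟩
        exact ha ⟨(a.1, b), Prod.ext rfl hb⟩
  · have h : (S.join i ∘ₗ pairSum X' X'' i).range = (S.join i).range :=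
      LinearMap.range_comp_of_range_eq_top _ (LinearMap.range_eq_top.2 fun t =>
        ⟨_, pairSum_pairDec i t⟩)
    rw [h]
    exact S.powFilt_le i

end LayerExtension

/-! ### The operation on Grothendieck groups -/

section Classes

variable {Q : Type u} [CommRing Q] {H : Type u} [Group H] {Z : Set (PrimeSpectrum Q)}
  {X Y : ChainComplex (Rep.{u} Q H) ℤ}

lemma K0.mk_eq_add_of_isExtension {X' X'' : ChainComplex (Rep.{u} Q H) ℤ}
    (h : IsExtension X' X X'') (hX' : IsPerfectOn Z X') (hX : IsPerfectOn Z X)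
    (hX'' : IsPerfectOn Z X'') : K0.mk X hX = K0.mk X' hX' + K0.mk X'' hX'' :=
  let ⟨f, g, w, hS⟩ := h
  K0.mk_eq_add hX' hX hX'' f g w hS

lemma isExtension_zero_of_bijective (f : X ⟶ Y)
    (hf : ∀ m, Function.Bijective (f.f m).hom) : IsExtension X Y (zeroComplex Q H) :=
  ⟨f, 0, by simp, (shortExact_iff _ _ _).2 fun m =>
    ⟨(hf m).1, fun y => ⟨0, Subsingleton.elim _ _⟩, fun y _ => (hf m).2 y⟩⟩

lemma K0.mk_eq_of_bijective (f : X ⟶ Y) (hf : ∀ m, Function.Bijective (f.f m).hom)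
    (hX : IsPerfectOn Z X) (hY : IsPerfectOn Z Y) : K0.mk X hX = K0.mk Y hY := by
  rw [K0.mk_eq_add_of_isExtension (isExtension_zero_of_bijective f hf) hX hY
    isPerfectOn_zeroComplex, K0.mk_zeroComplex, add_zero]

/-- The class of a complex with a finite filtration is the sum of the classes of the layers. -/
lemma exists_mk_eq_sum {n : ℕ} (V : ℕ → ChainComplex (Rep.{u} Q H) ℤ)
    (I : Fin n → ChainComplex (Rep.{u} Q H) ℤ) (hI : ∀ i, IsPerfectOn Z (I i))
    (h0 : ∀ m, Subsingleton ((V 0).X m).V)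
    (hV : ∀ i : Fin n, IsExtension (I i) (V (i + 1)) (V i)) :
    ∃ h : IsPerfectOn Z (V n), K0.mk (V n) h = ∑ i, K0.mk (I i) (hI i) := by
  induction n with
  | zero =>
    -- The support is arbitrary, so it may be empty, which makes the class of `V 0` vanish.
    have h : ∀ {Z}, IsPerfectOn Z (V 0) := IsPerfectOn.of_subsingleton h0
    exact ⟨h, by rw [K0.mk_eq_zero h h, Fin.sum_univ_zero]⟩
  | succ n ih =>
    obtain ⟨h, hsum⟩ := ih (fun i => I i.castSucc) (fun i => hI i.castSucc) fun i => hV i.castSucc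
    have hl := hV (Fin.last n)
    rw [Fin.val_last] at hl
    refine ⟨.of_isExtension hl (hI _) h, ?_⟩
    rw [Fin.sum_univ_castSucc, ← hsum, K0.mk_eq_add_of_isExtension hl (hI _) _ h, add_comm]

end Classes

/-! ### Tensor powers of extensions and descent to the Grothendieck group -/

section Power

variable {Q : Type u} [CommRing Q] {G : Type u} [Group G] {Z : Set (PrimeSpectrum Q)} {n : ℕ}
  {X' X X'' : ChainComplex (Rep.{u} Q G) ℤ}

/-- The class of the tensor power of an extension. -/
theorem K0.mk_tensorPower_of_isExtension [Finite G] (h : IsExtension X' X X'')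
    (hX'' : ∀ m, Module.Projective Q (X''.X m).V)
    (hI : ∀ i : Fin (n + 1), IsPerfectOn Z (indPowTensorPow X' X'' i))
    (hT : IsPerfectOn Z (tensorPower X n)) :
    K0.mk (tensorPower X n) hT = ∑ i, K0.mk (indPowTensorPow X' X'' i) (hI i) := by
  obtain ⟨f, g, w, hS⟩ := h
  obtain ⟨S⟩ := nonempty_gradedSplitting f g w hS hX''
  obtain ⟨hV, hsum⟩ := exists_mk_eq_sum (quotPow f n) (fun i => indPowTensorPow X' X'' i) hI
    -- Step `0` of the filtration is everything, so the first quotient vanishes.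
    (fun m => by
      refine ⟨?_⟩
      rintro ⟨_, x, -, rfl⟩ ⟨_, y, -, rfl⟩
      refine Subtype.ext ((Submodule.Quotient.eq _).2 ?_)
      rw [powFilt, filt_zero]
      trivial)
    fun i => isExtension_quotPow i S
  rw [← hsum]
  -- Step `n + 1` of the filtration is zero, so the last quotient is the tensor power itself.
  refine K0.mk_eq_of_bijective (toQuot _ _ _ _ _ _ _) (fun m => ⟨?_, ?_⟩) hT hV
  · intro (x : powDeg X n m) (y : powDeg X n m) hxy
    have hxy' := (Submodule.Quotient.eq (powFilt f n (n + 1))).1 (congrArg Subtype.val hxy)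
    rw [powFilt, filt_eq_bot (Nat.lt_succ_self n), Submodule.mem_bot, sub_eq_zero] at hxy'
    exact Subtype.ext hxy'
  · rintro ⟨_, x, hx, rfl⟩
    exact ⟨⟨x, hx⟩, rfl⟩

/-- If `n` is positive, so is `i` or `n - i`, and one of the two factors is supported on `Z`. -/
lemma powSupport_inter_subset (i : Fin (n + 1)) :
    powSupport Z i ∩ powSupport Z (n - i) ⊆ powSupport Z n := by
  rintro p ⟨h1, h2⟩
  unfold powSupport at *
  split_ifs at * <;> first | trivial | omega

/-- All complexes have the same tensor power with no factors. -/
lemma K0.mk_tensorPower_zero {Y : ChainComplex (Rep.{u} Q G) ℤ}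
    (hX : IsPerfectOn Z (tensorPower X 0)) (hY : IsPerfectOn Z (tensorPower Y 0)) :
    K0.mk (tensorPower X 0) hX = K0.mk (tensorPower Y 0) hY := by
  -- Over an empty index type all families of maps coincide, so the zero maps induce mutually
  -- inverse isomorphisms.
  have hF : ∀ X Y : ChainComplex (Rep.{u} Q G) ℤ, ∃ F : tensorPower X 0 ⟶ tensorPower Y 0,
      ∀ (m : ℤ) (x : powDeg X 0 m), ((powDeg Y 0 m).subtype ((F.f m).hom x)) =
        PiTensorProduct.map (fun _ => 0) x.1 := by
    intro X Y
    refine ⟨ofGradedHom (PiTensorProduct.map fun _ => 0) ?_ ?_ ?_, fun m x => rfl⟩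
    · intro m t ht
      induction ht using Submodule.span_induction with
      | mem t ht =>
        obtain ⟨f, x, rfl, rfl⟩ := ht
        rw [PiTensorProduct.map_tprod]
        exact tprod_mem_powDeg f fun k => k.elim0
      | zero => rw [map_zero]; exact zero_mem _
      | add a b _ _ ha hb => rw [map_add]; exact add_mem ha hb
      | smul r a _ ha => rw [map_smul]; exact Submodule.smul_mem _ _ ha
    · intro a t
      have h1 : ∀ W : ChainComplex (Rep.{u} Q G) ℤ, powRho W 0 a =
          PiTensorProduct.map fun _ => LinearMap.id := fun W => by
        refine LinearMap.ext fun t => ?_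
        rw [powRho_apply, Subsingleton.elim a.2 1, powPerm_one, LinearMap.id_apply, powDiag]
        congr 2
        exact funext fun k => k.elim0
      rw [h1, h1, PiTensorProduct.map_id, PiTensorProduct.map_id]
      rfl
    · intro t
      simp [powD]
  have hinv : ∀ (X Y : ChainComplex (Rep.{u} Q G) ℤ) (t : TotPow X 0),
      PiTensorProduct.map (fun _ => (0 : Tot Y →ₗ[Q] Tot X))
        (PiTensorProduct.map (fun _ => (0 : Tot X →ₗ[Q] Tot Y)) t) = t := by
    intro X Y t
    rw [← LinearMap.comp_apply, ← PiTensorProduct.map_comp]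
    have h : (fun _ : Fin 0 => (0 : Tot Y →ₗ[Q] Tot X) ∘ₗ (0 : Tot X →ₗ[Q] Tot Y)) =
        fun _ => LinearMap.id := funext fun k => k.elim0
    rw [h, PiTensorProduct.map_id]
    rfl
  obtain ⟨F, hF1⟩ := hF X Y
  obtain ⟨F', hF2⟩ := hF Y X
  refine K0.mk_eq_of_bijective F (fun m => Function.bijective_iff_has_inverse.2
    ⟨(F'.f m).hom, fun (x : powDeg X 0 m) => Subtype.ext ?_, fun (x : powDeg Y 0 m) =>
      Subtype.ext ?_⟩) hX hY
  · refine (hF2 m ((F.f m).hom x)).trans ?_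
    exact (congrArg (PiTensorProduct.map fun _ => 0) (hF1 m x)).trans (hinv X Y x.1)
  · refine (hF1 m ((F'.f m).hom x)).trans ?_
    exact (congrArg (PiTensorProduct.map fun _ => 0) (hF2 m x)).trans (hinv Y X x.1)

/-- The complex `Q[Σₙ] ⊗ E ⊗ T^(n-i)(X'')`, where `E` is a complex with an action of `G × Σᵢ`. -/
def indTensor (X'' : ChainComplex (Rep.{u} Q G) ℤ) (i : Fin (n + 1))
    (E : ChainComplex (Rep.{u} Q (G × Equiv.Perm (Fin i))) ℤ) :
    ChainComplex (Rep.{u} Q (G × Equiv.Perm (Fin n))) ℤ :=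
  indComplex (prodYoungHom G i) (tensorComplex
    (resComplex ((MonoidHom.id G).prodMap (MonoidHom.fst _ _)) E)
    (resComplex ((MonoidHom.id G).prodMap (MonoidHom.snd _ _)) (tensorPower X'' (n - i))))

lemma IsExtension.indTensor [Finite G] {i : Fin (n + 1)}
    {E' E E'' : ChainComplex (Rep.{u} Q (G × Equiv.Perm (Fin i))) ℤ}
    (h : IsExtension E' E E'') (hE'' : ∀ m, Module.Projective Q (E''.X m).V) :
    IsExtension (indTensor X'' i E') (indTensor X'' i E) (indTensor X'' i E'') := by
  have h1 := h.res ((MonoidHom.id G).prodMap (MonoidHom.fst (Equiv.Perm (Fin i))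
    (Equiv.Perm (Fin (n - i)))))
  have h2 := h1.tensor (resComplex ((MonoidHom.id G).prodMap (MonoidHom.snd (Equiv.Perm (Fin i))
    (Equiv.Perm (Fin (n - i))))) (tensorPower X'' (n - i))) hE''
  exact h2.ind (prodYoungHom_injective i)

variable [IsNoetherianRing Q] [Finite G]

/-- The supports are left free to cover both support on `Z` and, with `Z₁` empty, the preservation
of acyclicity. -/
lemma IsPerfectOn.indTensor {Z₁ Z' : Set (PrimeSpectrum Q)} (hX'' : IsPerfectOn Z X'')
    {i : Fin (n + 1)} {E : ChainComplex (Rep.{u} Q (G × Equiv.Perm (Fin i))) ℤ}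
    (hE : IsPerfectOn Z₁ E) (hZ : Z₁ ∩ powSupport Z (n - i) ⊆ Z') :
    IsPerfectOn Z' (indTensor X'' i E) :=
  ((hE.res _).tensor (hX''.tensorPower.res _) hZ).ind (prodYoungHom_injective i)

lemma IsPerfectOn.indPowTensorPow (hX' : IsPerfectOn Z X') (hX'' : IsPerfectOn Z X'')
    (i : Fin (n + 1)) : IsPerfectOn (powSupport Z n) (indPowTensorPow X' X'' i) :=
  hX''.indTensor hX'.tensorPower (powSupport_inter_subset i)

/-- The operation `Q[Σₙ] ⊗ - ⊗ T^(n-i)(X'')` on Grothendieck groups. -/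
lemma exists_indTensor_operation (hX'' : IsPerfectOn Z X'') (i : Fin (n + 1)) :
    ∃ t : K0 (powSupport Z i) (G × Equiv.Perm (Fin i)) →
      K0 (powSupport Z n) (G × Equiv.Perm (Fin n)), ∀ E hE, t (K0.mk E hE) =
        K0.mk (indTensor X'' i E) (hX''.indTensor hE (powSupport_inter_subset i)) := by
  let c : Perf (powSupport Z i) (G × Equiv.Perm (Fin i)) →
      K0 (powSupport Z n) (G × Equiv.Perm (Fin n)) := fun E =>
    K0.mk (indTensor X'' i E.obj) (hX''.indTensor E.property (powSupport_inter_subset i))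
  have hadd : ∀ E' E E'' : Perf (powSupport Z i) (G × Equiv.Perm (Fin i)),
      IsExtension E'.obj E.obj E''.obj → c E = c E' + c E'' := fun E' E E'' hE =>
    K0.mk_eq_add_of_isExtension (hE.indTensor E''.property.projective) _ _ _
  have hzero : ∀ E, IsPerfectOn ∅ E.obj → c E = 0 := fun E hE =>
    K0.mk_eq_zero _ (hX''.indTensor hE (by simp))
  exact exists_K0_factorization c
    (fun E' E E'' D' D D'' hE hD h' h'' => by rw [hadd _ _ _ hE, hadd _ _ _ hD, h', h''])
    (fun E hE => by rw [hzero E hE, hzero _ isPerfectOn_zeroComplex])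

/-- The class of `Q[Σₙ] ⊗ T^i(X') ⊗ T^(n-i)(X'')` only depends on the class of `T^i(X')`. -/
lemma K0.mk_indPowTensorPow_congr {Y' : ChainComplex (Rep.{u} Q G) ℤ} (hX' : IsPerfectOn Z X')
    (hY' : IsPerfectOn Z Y') (hX'' : IsPerfectOn Z X'') (i : Fin (n + 1))
    (h : K0.mk (tensorPower X' i) hX'.tensorPower = K0.mk (tensorPower Y' i) hY'.tensorPower) :
    K0.mk (indPowTensorPow X' X'' i) (hX'.indPowTensorPow hX'' i) =
      K0.mk (indPowTensorPow Y' X'' i) (hY'.indPowTensorPow hX'' i) := by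
  obtain ⟨t, ht⟩ := exists_indTensor_operation hX'' i
  have h1 := ht _ hX'.tensorPower
  rw [h, ht _ hY'.tensorPower] at h1
  exact h1.symm

/-- The operation given by the tensor power on Grothendieck groups. -/
theorem exists_tensorPower_operation (n : ℕ) (Z : Set (PrimeSpectrum Q)) :
    ∃ t : K0 Z G → K0 (powSupport Z n) (G × Equiv.Perm (Fin n)),
      ∀ (X : ChainComplex (Rep.{u} Q G) ℤ) (hX : IsPerfectOn Z X),
        t (K0.mk X hX) = K0.mk (tensorPower X n) hX.tensorPower := by
  -- All powers at once: the formula for the power `m` of an extension involves every power `i ≤ m`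
  -- of the ends.
  let c : Perf Z G → ∀ m, K0 (powSupport Z m) (G × Equiv.Perm (Fin m)) := fun X m =>
    K0.mk (tensorPower X.obj m) X.property.tensorPower
  have hc : ∀ (X' X X'' : Perf Z G) (m : ℕ), IsExtension X'.obj X.obj X''.obj → c X m =
      ∑ i : Fin (m + 1), K0.mk (indPowTensorPow X'.obj X''.obj i)
        (X'.property.indPowTensorPow X''.property i) := fun X' X X'' m h =>
    K0.mk_tensorPower_of_isExtension h X''.property.projective _ _
  refine (exists_K0_factorization c ?_ ?_).imp' (fun t x => t x n) fun t ht X hX =>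
    congrFun (ht X hX) n
  · intro X' X X'' Y' Y Y'' hX hY h' h''
    funext m
    have hl : ∀ A B D : Perf Z G, c A = c B →
        ∑ i : Fin (m + 1), K0.mk (indPowTensorPow A.obj D.obj i)
          (A.property.indPowTensorPow D.property i) =
        ∑ i : Fin (m + 1), K0.mk (indPowTensorPow B.obj D.obj i)
          (B.property.indPowTensorPow D.property i) := fun A B D h =>
      Finset.sum_congr rfl fun i _ => K0.mk_indPowTensorPow_congr A.property B.property
        D.property i (congrFun h i)
    -- The direct sum is an extension in both orders, so the two sums agree without any comparison
    -- of summands.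
    have hs : ∀ A B : Perf Z G, ∑ i : Fin (m + 1), K0.mk (indPowTensorPow A.obj B.obj i)
          (A.property.indPowTensorPow B.property i) =
        ∑ i : Fin (m + 1), K0.mk (indPowTensorPow B.obj A.obj i)
          (B.property.indPowTensorPow A.property i) := fun A B => by
      rw [← hc A ⟨_, A.property.biprod B.property⟩ B m (isExtension_biprod _ _),
        ← hc B ⟨_, A.property.biprod B.property⟩ A m (isExtension_biprod_swap _ _)]
    -- Replace the left end, swap, replace the other end, and swap back.
    rw [hc _ _ _ m hX, hc _ _ _ m hY, hl X' Y' X'' h', hs, hl X'' Y'' Y' h'', hs]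
  · intro X hX
    funext m
    -- Positive powers of acyclic complexes are acyclic; the power `0` is instead independent of the
    -- complex.
    obtain _ | m := m
    · exact K0.mk_tensorPower_zero _ _
    · have h0 : ∀ Y : Perf Z G, IsPerfectOn ∅ Y.obj → c Y (m + 1) = 0 := fun Y hY => by
        refine K0.mk_eq_zero _ ?_
        have := hY.tensorPower (n := m + 1)
        rwa [powSupport_of_pos (Nat.succ_pos m)] at this
      rw [h0 X hX, h0 _ isPerfectOn_zeroComplex]

end Power

end PowerOp

end

open CategoryTheory PowerOp in
theorem mainTheorem9 {Q : Type u} [CommRing Q] [IsNoetherianRing Q]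
    (Z : Set (PrimeSpectrum Q)) (hZ : IsClosed Z) (G : Type u) [Group G] [Finite G]
    (n : ℕ) (hn : 1 ≤ n) :
    ∃ (hT : ∀ X : ChainComplex (Rep.{u} Q G) ℤ, IsPerfectOn Z X → IsPerfectOn Z (tensorPower X n))
      (hI : ∀ (X' X'' : ChainComplex (Rep.{u} Q G) ℤ) (i : Fin (n + 1)),
        IsPerfectOn Z X' → IsPerfectOn Z X'' → IsPerfectOn Z (indPowTensorPow X' X'' i))
      (t : K0 Z G → K0 Z (G × Equiv.Perm (Fin n))),
      (∀ (X : ChainComplex (Rep.{u} Q G) ℤ) (hX : IsPerfectOn Z X),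
        t (K0.mk X hX) = K0.mk (tensorPower X n) (hT X hX)) ∧
      ∀ (X' X X'' : ChainComplex (Rep.{u} Q G) ℤ) (hX' : IsPerfectOn Z X') (hX : IsPerfectOn Z X)
        (hX'' : IsPerfectOn Z X'') (f : X' ⟶ X) (g : X ⟶ X'') (w : f ≫ g = 0),
        (ShortComplex.mk f g w).ShortExact →
          t (K0.mk X hX) =
            ∑ i : Fin (n + 1), K0.mk (indPowTensorPow X' X'' i) (hI X' X'' i hX' hX'') := by
  have hT : ∀ X : ChainComplex (Rep.{u} Q G) ℤ, IsPerfectOn Z X →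
      IsPerfectOn Z (tensorPower X n) := fun X hX => by
    have := hX.tensorPower (n := n)
    rwa [powSupport_of_pos hn] at this
  have hI : ∀ (X' X'' : ChainComplex (Rep.{u} Q G) ℤ) (i : Fin (n + 1)),
      IsPerfectOn Z X' → IsPerfectOn Z X'' → IsPerfectOn Z (indPowTensorPow X' X'' i) :=
    fun X' X'' i hX' hX'' => by
      have := hX'.indPowTensorPow hX'' i
      rwa [powSupport_of_pos hn] at this
  -- The type `K0 Z'` depends on the support, so the equality is eliminated with `Z'` as a variable.
  have key : ∀ Z', powSupport Z n = Z' → ∃ t : K0 Z G → K0 Z' (G × Equiv.Perm (Fin n)),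
      ∀ (X : ChainComplex (Rep.{u} Q G) ℤ) (hX : IsPerfectOn Z X)
        (hT : IsPerfectOn Z' (tensorPower X n)), t (K0.mk X hX) = K0.mk (tensorPower X n) hT := by
    rintro _ rfl
    obtain ⟨t, ht⟩ := exists_tensorPower_operation (G := G) n Z
    exact ⟨t, fun X hX _ => ht X hX⟩
  obtain ⟨t, ht⟩ := key Z (powSupport_of_pos hn)
  refine ⟨hT, hI, t, fun X hX => ht X hX _, fun X' X X'' hX' hX hX'' f g w hS => ?_⟩
  rw [ht X hX (hT X hX)]
  exact K0.mk_tensorPower_of_isExtension ⟨f, g, w, hS⟩ hX''.projective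
    (fun i => hI X' X'' i hX' hX'') _
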